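/- **Setting.** Let $\mathfrak g_0$ be a finite-dimensional real simple Lie algebra with Cartan decomposition $\mathfrak g_0=\mathfrak k_0\oplus\mathfrak p_0$ and $\operatorname{rank}\mathfrak g_0=\operatorname{rank}\mathfrak k_0$ (the rank being the dimension of the Cartan subalgebras). Let $\mathfrak t_0$ be a maximal abelian subalgebra of $\mathfrak k_0$, and let $\mathfrak g,\mathfrak k,\mathfrak p,\mathfrak h$ be the complexifications of $\mathfrak g_0,\mathfrak k_0,\mathfrak p_0,\mathfrak t_0$, so that $\mathfrak h$ is a Cartan subalgebra of $\mathfrak g$ and of $\mathfrak k$. Let $\Delta$ be the root system of $(\mathfrak g,\mathfrak h)$, with root spaces $\mathfrak g^\alpha$. A root $\alpha$ is compact if $\mathfrak g^\alpha\subset\mathfrak k$ and noncompact if $\mathfrak g^\alpha\subset\mathfrak p$; let $\Delta_{\mathfrak k}$ be the set of compact roots. A positive root system of $\Delta$ is *Borel–de Siebenthal* if exactly one of its simple roots is noncompact and the coefficient of that simple root in the highest root is $1$ if $\mathfrak k$ has non-zero centre and $2$ if $\mathfrak k$ is semisimple. Assume that $\mathfrak k$ is semisimple. Let $P_{\mathfrak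 k}$ be a positive root system of $\Delta_{\mathfrak k}$ with set of simple roots $\Phi_{\mathfrak k}$, and let $P\supseteq P_{\mathfrak k}$ be a Borel–de Siebenthal positive root system of $\Delta$, with set of simple roots $\Phi$, noncompact simple root $\nu$ and highest root $\delta$. Put $\Phi_0=\Phi\setminus\{\nu\}$, and for $\psi\in\Phi$ let $n_\psi(\delta)$ be the coefficient of $\psi$ in $\delta$ written as a combination of elements of $\Phi$. Let $\mathfrak l_0\subset\mathfrak g$ be the sum of $\mathfrak h$ and the root spaces of the roots in which $\nu$ has coefficient $0$ (equivalently, the centralizer in $\mathfrak g$ of $\bigcap_{\psi\in\Phi_0}\ker\psi\subset\mathfrak h$), let $\Delta_0$ be the set of roots of $\mathfrak l_0$ and $P_0=\Delta_0\cap P_{\mathfrak k}$, and let $w_0$ be the longest element, with respect to $P_0$, of the Weyl group of $\mathfrak l_0$. Put $\lambda=w_0(\nu)$. For $\phi\in\Phi_0$ let $\mathfrak l'_0=\mathfrak l'_0(\phi)$ be the reductive subalgebra of $\mathfrak k$ that contains $\mathfrak h$ and has simple roots $\Phi_{\mathfrak k}\setminus\{\phi\}$, that is, the sum of $\mathfrak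 h$ and the root spaces of the compact roots that are combinations of elements of $\Phi_{\mathfrak k}\setminus\{\phi\}$. **Theorem.** 1. Let $\phi'\in\Phi_0$ with $n_{\phi'}(\delta)=1$. Then there is $\phi\in\Phi_0$ with $w_0(\phi')=-\phi$. For this $\phi$, there is an irreducible $\mathfrak l'_0(\phi)$-submodule of $\mathfrak p$ with highest weight $\lambda$; if $\nu'$ is the lowest weight of such a submodule (highest and lowest being taken relative to the positive system with simple roots $\Phi_{\mathfrak k}\setminus\{\phi\}$), then $(\Phi_{\mathfrak k}\setminus\{\phi\})\cup\{\nu'\}$ is the set of all simple roots of a Borel–de Siebenthal positive root system of $\Delta$ containing $P_{\mathfrak k}$. 2. Conversely, let $P'$ be a Borel–de Siebenthal positive root system of $\Delta$ containing $P_{\mathfrak k}$. Then either $P'=P$, or there are $\phi'\in\Phi_0$ with $n_{\phi'}(\delta)=1$, $\phi\in\Phi_0$ with $w_0(\phi')=-\phi$, and the lowest weight $\nu'$ of an irreducible $\mathfrak l'_0(\phi)$-submodule of $\mathfrak p$ with highest weight $\lambda$, as in 1, such that $(\Phi_{\mathfrak k}\setminus\{\phi\})\cup\{\nu'\}$ is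 the set of all simple roots of $P'$. -/

import Mathlib

open scoped TensorProduct

/-! ### Root combinatorics in a complex vector space -/

section Combinatorics

variable {V : Type*} [AddCommGroup V] [Module ℂ V]

/-- `Φ` is a simple system (base) of the root system `Δ`: a linearly independent set of roots such
that every root is a combination of elements of `Φ` with integer coefficients that are all
nonnegative or all nonpositive. -/
structure IsSimpleSystem (Δ Φ : Set V) : Prop where
  subset : Φ ⊆ Δ
  linearIndependent : LinearIndepOn ℂ id Φ
  mem_or_neg_mem : ∀ α ∈ Δ, α ∈ AddSubmonoid.closure Φ ∨ -α ∈ AddSubmonoid.closure Φ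

/-- `P` is a positive root system of the root system `Δ`: the set of roots that are nonnegative
with respect to some base of `Δ`. -/
def IsPositiveSystem (Δ P : Set V) : Prop :=
  ∃ Φ : Set V, IsSimpleSystem Δ Φ ∧ P = {α | α ∈ Δ ∧ α ∈ AddSubmonoid.closure Φ}

/-- The simple roots of a positive system: the positive roots that are not a sum of two positive
roots. -/
def simpleRoots (P : Set V) : Set V :=
  {α | α ∈ P ∧ ∀ β ∈ P, ∀ γ ∈ P, α ≠ β + γ}

/-- `HasCoeff Φ φ α n`: in the expression of `α` as an integral combination of elements of `Φ`,
the coefficient of `φ` is `n`. (For a linearly independent `Φ` the expression is unique.) -/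
def HasCoeff (Φ : Set V) (φ α : V) (n : ℤ) : Prop :=
  ∃ c : V →₀ ℤ, (c.support : Set V) ⊆ Φ ∧ α = c.sum (fun ψ m => m • ψ) ∧ c φ = n

/-- `μ` is the highest element of `S` for the order in which `β ≤ γ` means that `γ - β` is a sum of
elements of `Ψ`. -/
def IsHighest (Ψ S : Set V) (μ : V) : Prop :=
  μ ∈ S ∧ ∀ β ∈ S, μ - β ∈ AddSubmonoid.closure Ψ

/-- `μ` is the lowest element of `S` for the order in which `β ≤ γ` means that `γ - β` is a sum of
elements of `Ψ`. -/
def IsLowest (Ψ S : Set V) (μ : V) : Prop :=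
  μ ∈ S ∧ ∀ β ∈ S, β - μ ∈ AddSubmonoid.closure Ψ

/-- The length of `w` with respect to the positive system `P`: the number of positive roots that
`w` makes negative. -/
noncomputable def inversionLength (P : Set V) (w : V ≃ₗ[ℂ] V) : ℕ :=
  {α | α ∈ P ∧ -(w α) ∈ P}.ncard

/-- `w` is the longest element of the reflection group `G` with respect to the positive
system `P`. -/
def IsLongestElement (G : Subgroup (V ≃ₗ[ℂ] V)) (P : Set V) (w : V ≃ₗ[ℂ] V) : Prop :=
  w ∈ G ∧ ∀ u ∈ G, inversionLength P u ≤ inversionLength P w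

end Combinatorics

/-! ### Roots, weights and Weyl groups relative to a subalgebra `h` of a complex Lie algebra -/

section Roots

variable {g : Type*} [LieRing g] [LieAlgebra ℂ g]

/-- The space `{x | [H, x] = α(H) x for all H ∈ h}`, for a linear form `α` on `h`. -/
def rootSpace (h : LieSubalgebra ℂ g) (α : Module.Dual ℂ h) : Submodule ℂ g :=
  (LieModule.weightSpace g (fun H : h => α H)).toSubmodule

/-- The roots of `h` in `g` (nonzero linear forms with nonzero root space) whose root space is
contained in `V`. -/
def roots (h : LieSubalgebra ℂ g) (V : Submodule ℂ g) : Set (Module.Dual ℂ h) :=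
  {α | α ≠ 0 ∧ rootSpace h α ≠ ⊥ ∧ rootSpace h α ≤ V}

/-- The weights of `h` on the subspace `W` of `g`. -/
def weights (h : LieSubalgebra ℂ g) (W : Submodule ℂ g) : Set (Module.Dual ℂ h) :=
  {μ | rootSpace h μ ⊓ W ≠ ⊥}

/-- `c ∈ h` is the coroot of `α`: it lies in `[g^α, g^(-α)]` and `α(c) = 2`. -/
def IsCoroot (h : LieSubalgebra ℂ g) (α : Module.Dual ℂ h) (c : h) : Prop :=
  α c = 2 ∧ ∃ x ∈ rootSpace h α, ∃ y ∈ rootSpace h (-α), ⁅x, y⁆ = (c : g)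

/-- The group of automorphisms of the dual of `h` generated by the root reflections
`μ ↦ μ - μ(α^∨) α` for `α ∈ R`. -/
def weylGroup (h : LieSubalgebra ℂ g) (R : Set (Module.Dual ℂ h)) :
    Subgroup (Module.Dual ℂ h ≃ₗ[ℂ] Module.Dual ℂ h) :=
  Subgroup.closure
    {s | ∃ α ∈ R, ∃ c : h, IsCoroot h α c ∧ ∀ μ : Module.Dual ℂ h, s μ = μ - μ c • α}

/-- The Levi subalgebra of `s` attached to a set `Ψ` of simple roots: the centralizer in `s` of the
common kernel of the elements of `Ψ`. For `s` reductive with Cartan subalgebra `h` and `Ψ` a set of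
simple roots of `s`, this is the reductive subalgebra of `s` spanned by `h` and the root spaces
of the roots that are combinations of elements of `Ψ`; it contains `h`, and the Dynkin diagram of
its derived algebra is the subdiagram with vertices `Ψ`. -/
def leviSubalgebra (h s : LieSubalgebra ℂ g) (Ψ : Set (Module.Dual ℂ h)) : LieSubalgebra ℂ g where
  carrier := {x | x ∈ s ∧ ∀ E : h, (∀ ψ ∈ Ψ, ψ E = 0) → ⁅(E : g), x⁆ = 0}
  zero_mem' := ⟨s.zero_mem, fun E _ => lie_zero _⟩
  add_mem' := fun {x y} hx hy =>
    ⟨s.add_mem hx.1 hy.1, fun E hE => by rw [lie_add, hx.2 E hE, hy.2 E hE, add_zero]⟩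
  smul_mem' := fun c x hx =>
    ⟨s.smul_mem c hx.1, fun E hE => by rw [lie_smul, hx.2 E hE, smul_zero]⟩
  lie_mem' := fun {x y} hx hy =>
    ⟨s.lie_mem hx.1 hy.1, fun E hE => by
      rw [leibniz_lie, hx.2 E hE, hy.2 E hE, zero_lie, lie_zero, add_zero]⟩

/-- `η` is the lowest weight of an irreducible submodule, with highest weight `μ`, of `p` over the
Levi subalgebra of `k` attached to `Ψ`; highest and lowest refer to the positive system with
simple roots `Ψ`. -/
def IsLowestWeightOfSubmodule (h k : LieSubalgebra ℂ g) (p : Submodule ℂ g)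
    (Ψ : Set (Module.Dual ℂ h)) (μ η : Module.Dual ℂ h) : Prop :=
  ∃ W : LieSubmodule ℂ (leviSubalgebra h k Ψ) g,
    W.toSubmodule ≤ p ∧ LieModule.IsIrreducible ℂ (leviSubalgebra h k Ψ) W ∧
      IsHighest Ψ (weights h W.toSubmodule) μ ∧ IsLowest Ψ (weights h W.toSubmodule) η

/-- Borel-de Siebenthal positive root systems of `g = k ⊕ p`: exactly one simple root `ν` is
noncompact, and its coefficient in the highest root is `1` if `k` has nonzero centre and `2` if
`k` is semisimple. -/
def IsBorelDeSiebenthal (h k : LieSubalgebra ℂ g) (p : Submodule ℂ g)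
    (P : Set (Module.Dual ℂ h)) : Prop :=
  IsPositiveSystem (roots h ⊤) P ∧
    ∃ ν δ : Module.Dual ℂ h, simpleRoots P ∩ roots h p = {ν} ∧
      IsHighest (simpleRoots P) (roots h ⊤) δ ∧
      (LieAlgebra.center ℂ k ≠ ⊥ → HasCoeff (simpleRoots P) ν δ 1) ∧
      (LieAlgebra.IsSemisimple ℂ k → HasCoeff (simpleRoots P) ν δ 2)

end Roots

/-! ### Real Lie algebras, Cartan decompositions and complexification -/

section RealForms

variable {g₀ : Type*} [LieRing g₀] [LieAlgebra ℝ g₀]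

/-- A Cartan involution: an involutive automorphism `θ` such that `-B(x, θ y)` is positive
definite, `B` being the Killing form. -/
structure IsCartanInvolution (θ : g₀ ≃ₗ⁅ℝ⁆ g₀) : Prop where
  involutive : ∀ x, θ (θ x) = x
  killing_neg : ∀ x, x ≠ 0 → killingForm ℝ g₀ x (θ x) < 0

/-- The fixed point subalgebra `k₀` of `θ`. -/
def fixedSubalgebra (θ : g₀ ≃ₗ⁅ℝ⁆ g₀) : LieSubalgebra ℝ g₀ where
  carrier := {x | θ x = x}
  zero_mem' := map_zero θ
  add_mem' := fun {x y} (hx : θ x = x) (hy : θ y = y) => show θ (x + y) = x + y by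
    rw [map_add, hx, hy]
  smul_mem' := fun c x (hx : θ x = x) => show θ (c • x) = c • x by rw [map_smul, hx]
  lie_mem' := fun {x y} (hx : θ x = x) (hy : θ y = y) => show θ ⁅x, y⁆ = ⁅x, y⁆ by
    rw [LieEquiv.map_lie, hx, hy]

/-- The `-1` eigenspace `p₀` of `θ`. -/
def antifixedSubspace (θ : g₀ ≃ₗ⁅ℝ⁆ g₀) : Submodule ℝ g₀ where
  carrier := {x | θ x = -x}
  zero_mem' := show θ 0 = -0 by rw [map_zero, neg_zero]
  add_mem' := fun {x y} (hx : θ x = -x) (hy : θ y = -y) => show θ (x + y) = -(x + y) by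
    rw [map_add, hx, hy, neg_add]
  smul_mem' := fun c x (hx : θ x = -x) => show θ (c • x) = -(c • x) by
    rw [map_smul, hx, smul_neg]

/-- The rank of a real Lie algebra is `r`: this is the dimension of its Cartan subalgebras. -/
def HasRank (L : Type*) [LieRing L] [LieAlgebra ℝ L] (r : ℕ) : Prop :=
  ∀ H : LieSubalgebra ℝ L, H.IsCartanSubalgebra → Module.finrank ℝ H = r

/-- `t₀` is a maximal abelian subalgebra of the subalgebra `k₀`. -/
def IsMaximalAbelianIn (k₀ t₀ : LieSubalgebra ℝ g₀) : Prop :=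
  Maximal (fun s : LieSubalgebra ℝ g₀ => s ≤ k₀ ∧ IsLieAbelian s) t₀

end RealForms

/-!
The proof reduces the theorem to combinatorics of roots. Let `Δ` be the set of roots and `Δn` the set
of noncompact ones.

*The base of the compact roots.* In `P` the coefficient of `ν` in a root has absolute value at
most `2`, and the root is noncompact exactly when it is odd (`IsGradedBase.level`). Hence `Φk`
arises from `Φ` by replacing `ν` with the lowest root in which `ν` has coefficient `2`. As `-w₀`
permutes `Φ₀`, this root is `w₀ δ`, so that `Φk = Φ₀ ∪ {w₀ δ}` (`IsGradedBase.eq_insert_apply`), and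
`lam = w₀ ν` is the highest of all noncompact roots for the order given by `Φk`
(`IsGradedBase.sub_mem_closure_compact`). Applying `w₀` to `δ - 2 ν`, a combination of elements
of `Φ₀`, one sees that for `w₀ φ' = -φ` the coefficient of `φ'` in `δ` is twice the coefficient of
`φ` in `lam` with respect to `Φk` (`IsGradedBase.two_mul_coord`). So the condition on `φ'` says
that this coefficient `c` is `1/2` on `lam`; since `lam` is the highest and `-lam` the lowest
noncompact root, `c` is then `±1/2` on all noncompact roots and an integer on compact roots. This
situation is `IsExchangeable`.

*Exchange.* Let `η` be the lowest noncompact root with `c = 1/2`, for the order given by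
`Φk \ {φ}`. Then `φ - η` is a root (`IsExchangeable.sub_lowest_mem`), so `φ` is a positive
combination of `Φk \ {φ}` and `η`, and these form a base in which `2 c` is the coefficient of `η`.
Its highest root is the image of `φ` under the longest element for `Φk \ {φ}`, and `η` has
coefficient `2` there (`IsExchangeable.isGradedBase_insert`). Conversely, if `P'` is a
Borel-de Siebenthal system containing `Pk`, then its base minus the noncompact root `ν'` is
`Φk \ {φ}` for some `φ`. If `φ = w₀ δ`, then `P' = P`; otherwise `φ` lies in `Φ₀`, the form `2 c` is
the coefficient of `ν'`, and comparing its value `1` on `lam` with the coefficient formula shows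
that `P'` comes from an exchange (`IsGradedBase.eq_or_exists_exchange`).

*Modules.* The centre of the Levi subalgebra of `k` with simple roots `Φk \ {φ}` acts on the root
space of a noncompact root through a character that determines the value of `c`. The part of `p`
on which it acts as on the root space of `lam` is therefore the sum of the root spaces of the
noncompact roots with `c = 1/2`. It is irreducible, since any two of these roots are connected by
adding roots of the Levi subalgebra (`IsRootSet.eq_of_isLowest`), and every submodule of `p`
with highest weight `lam` has the same weights. Its lowest weight is `η`
(`IsSymmetricPair.isLowestWeightOfSubmodule_iff`).

*The Lie algebras.* It remains to see that `h` is a Cartan subalgebra of `g`, so that Mathlib's root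
system of a Lie algebra with nondegenerate Killing form is available. Elements of `k₀` and `p₀` act
by semisimple operators, so a maximal `θ`-stable abelian subalgebra containing `t₀` is a Cartan
subalgebra of `g₀`; as the ranks agree, it is `t₀` (`IsCartanInvolution.mem_of_commute`).
-/

set_option linter.unusedSectionVars false

/-! ### Linear combinations of simple roots and root systems -/

section LatticeCombinatorics

variable {V : Type*} [AddCommGroup V] [Module ℂ V] {Φ Ψ : Set V}

theorem LinearIndepOn.exists_linearMap_eq (hΦ : LinearIndepOn ℂ id Φ) (g : V → ℂ) :
    ∃ f : V →ₗ[ℂ] ℂ, ∀ ψ ∈ Φ, f ψ = g ψ := by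
  let b := Module.Basis.extend hΦ
  refine ⟨b.constr ℂ (fun i => g i), fun ψ hψ => ?_⟩
  have h1 : b ⟨ψ, hΦ.subset_extend _ hψ⟩ = ψ := Module.Basis.extend_apply_self hΦ _
  have h2 := b.constr_basis ℂ (fun i => g i) ⟨ψ, hΦ.subset_extend _ hψ⟩
  rwa [h1] at h2

theorem LinearIndepOn.exists_coord (hΦ : LinearIndepOn ℂ id Φ) (φ : V) :
    ∃ f : V →ₗ[ℂ] ℂ, (φ ∈ Φ → f φ = 1) ∧ ∀ ψ ∈ Φ \ {φ}, f ψ = 0 := by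
  classical
  obtain ⟨f, hf⟩ := hΦ.exists_linearMap_eq (fun ψ => if ψ = φ then 1 else 0)
  exact ⟨f, fun h => by simpa using hf φ h, fun ψ hψ => by rw [hf ψ hψ.1, if_neg (by exact hψ.2)]⟩

theorem exists_nat_of_mem_closure {f : V →ₗ[ℂ] ℂ} (hf : ∀ ψ ∈ Φ, ∃ n : ℕ, f ψ = n) {x : V}
    (hx : x ∈ AddSubmonoid.closure Φ) : ∃ n : ℕ, f x = n := by
  induction hx using AddSubmonoid.closure_induction with
  | mem x hx => exact hf x hx
  | zero => exact ⟨0, by simp⟩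
  | add x y _ _ hx hy =>
    obtain ⟨n, hn⟩ := hx
    obtain ⟨m, hm⟩ := hy
    exact ⟨n + m, by simp [hn, hm]⟩

theorem exists_int_of_mem_closure {f : V →ₗ[ℂ] ℂ} (hf : ∀ ψ ∈ Φ, ∃ n : ℤ, f ψ = n) {x : V}
    (hx : x ∈ AddSubgroup.closure Φ) : ∃ n : ℤ, f x = n := by
  induction hx using AddSubgroup.closure_induction with
  | mem x hx => exact hf x hx
  | zero => exact ⟨0, by simp⟩
  | add x y _ _ hx hy =>
    obtain ⟨n, hn⟩ := hx
    obtain ⟨m, hm⟩ := hy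
    exact ⟨n + m, by simp [hn, hm]⟩
  | neg x _ hx =>
    obtain ⟨n, hn⟩ := hx
    exact ⟨-n, by simp [hn]⟩

theorem eqOn_closure {M : Type*} [AddCommGroup M] [Module ℂ M] {f g : V →ₗ[ℂ] M}
    (hf : ∀ ψ ∈ Φ, f ψ = g ψ) {x : V} (hx : x ∈ AddSubgroup.closure Φ) : f x = g x := by
  induction hx using AddSubgroup.closure_induction with
  | mem x hx => exact hf x hx
  | zero => simp
  | add x y _ _ hx hy => simp [hx, hy]
  | neg x _ hx => simp [hx]

theorem eq_zero_of_mem_closure {f : V →ₗ[ℂ] ℂ} (hf : ∀ ψ ∈ Φ, f ψ = 0) {x : V}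
    (hx : x ∈ AddSubgroup.closure Φ) : f x = 0 := by
  simpa using eqOn_closure (g := 0) (by simpa using hf) hx

theorem mem_addSubgroupClosure {x : V} (hx : x ∈ AddSubmonoid.closure Φ) :
    x ∈ AddSubgroup.closure Φ := AddSubgroup.le_closure_toAddSubmonoid Φ hx

theorem addSubgroupClosure_le_span : ∀ x ∈ AddSubgroup.closure Φ, x ∈ Submodule.span ℂ Φ :=
  (AddSubgroup.closure_le (K := (Submodule.span ℂ Φ).toAddSubgroup)).2 Submodule.subset_span

/-- The height function of a linearly independent set `Φ`: it separates `0` and the elements of `Φ`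
from the other combinations of elements of `Φ` with nonnegative coefficients. -/
theorem LinearIndepOn.exists_height (hΦ : LinearIndepOn ℂ id Φ) :
    ∃ ht : V →ₗ[ℂ] ℂ, (∀ ψ ∈ Φ, ht ψ = 1) ∧ ∀ x ∈ AddSubmonoid.closure Φ,
      ∃ n : ℕ, ht x = n ∧ (n = 0 → x = 0) ∧ (n = 1 → x ∈ Φ) := by
  obtain ⟨f, hf⟩ := hΦ.exists_linearMap_eq (fun _ => 1)
  refine ⟨f, hf, fun x hx => ?_⟩
  induction hx using AddSubmonoid.closure_induction with
  | mem x hx => exact ⟨1, by simp [hf x hx], by simp, fun _ => hx⟩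
  | zero => exact ⟨0, by simp⟩
  | add x y _ _ hx hy =>
    obtain ⟨n, hn, h0, h1⟩ := hx
    obtain ⟨m, hm, k0, k1⟩ := hy
    refine ⟨n + m, by simp [hn, hm], fun h => ?_, fun h => ?_⟩
    · rw [h0 (by omega), k0 (by omega), add_zero]
    · obtain hn | hm : n = 0 ∨ m = 0 := by omega
      · rw [h0 hn, zero_add]; exact k1 (by omega)
      · rw [k0 hm, add_zero]; exact h1 (by omega)

theorem LinearIndepOn.eq_zero_of_mem_of_neg_mem (hΦ : LinearIndepOn ℂ id Φ) {x : V}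
    (hx : x ∈ AddSubmonoid.closure Φ) (hx' : -x ∈ AddSubmonoid.closure Φ) : x = 0 := by
  obtain ⟨f, -, hf⟩ := hΦ.exists_height
  obtain ⟨n, hn, h0, -⟩ := hf x hx
  obtain ⟨m, hm, -, -⟩ := hf _ hx'
  rw [map_neg, hn] at hm
  have : (n : ℂ) + m = 0 := by rw [← hm]; ring
  have : n + m = 0 := by exact_mod_cast this
  exact h0 (by omega)

theorem exists_eq_nsmul_add {φ : V} {x : V} (hx : x ∈ AddSubmonoid.closure Φ) :
    ∃ n : ℕ, ∃ y ∈ AddSubmonoid.closure (Φ \ {φ}), x = n • φ + y := by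
  induction hx using AddSubmonoid.closure_induction with
  | mem x hx =>
    by_cases h : x = φ
    · exact ⟨1, 0, zero_mem _, by simp [h]⟩
    · exact ⟨0, x, AddSubmonoid.subset_closure ⟨hx, h⟩, by simp⟩
  | zero => exact ⟨0, 0, zero_mem _, by simp⟩
  | add x y _ _ hx hy =>
    obtain ⟨n, a, ha, rfl⟩ := hx
    obtain ⟨m, b, hb, rfl⟩ := hy
    exact ⟨n + m, a + b, add_mem ha hb, by rw [add_nsmul]; abel⟩

theorem exists_eq_zsmul_add {φ : V} {x : V} (hx : x ∈ AddSubgroup.closure Φ) :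
    ∃ n : ℤ, ∃ y ∈ AddSubgroup.closure (Φ \ {φ}), x = n • φ + y := by
  induction hx using AddSubgroup.closure_induction with
  | mem x hx =>
    by_cases h : x = φ
    · exact ⟨1, 0, zero_mem _, by simp [h]⟩
    · exact ⟨0, x, AddSubgroup.subset_closure ⟨hx, h⟩, by simp⟩
  | zero => exact ⟨0, 0, zero_mem _, by simp⟩
  | add x y _ _ hx hy =>
    obtain ⟨n, a, ha, rfl⟩ := hx
    obtain ⟨m, b, hb, rfl⟩ := hy
    exact ⟨n + m, a + b, add_mem ha hb, by rw [add_zsmul]; abel⟩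
  | neg x _ hx =>
    obtain ⟨n, a, ha, rfl⟩ := hx
    exact ⟨-n, -a, neg_mem ha, by rw [neg_zsmul]; abel⟩

/-- A combination with nonnegative coefficients of a linearly independent set `Φ` that lies in the
span of a subset `Ψ` only involves `Ψ`. -/
theorem LinearIndepOn.mem_closure_of_mem_span (hΦ : LinearIndepOn ℂ id Φ) (hΨ : Ψ ⊆ Φ) {x : V}
    (hx : x ∈ AddSubmonoid.closure Φ) (hx' : x ∈ Submodule.span ℂ Ψ) :
    x ∈ AddSubmonoid.closure Ψ := by
  classical
  obtain ⟨f, hf⟩ := hΦ.exists_linearMap_eq (fun ψ => if ψ ∈ Ψ then 0 else 1)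
  suffices h : ∃ n : ℕ, f x = n ∧ (n = 0 → x ∈ AddSubmonoid.closure Ψ) by
    obtain ⟨n, hn, h⟩ := h
    have h0 : Submodule.span ℂ Ψ ≤ LinearMap.ker f :=
      Submodule.span_le.2 fun ψ hψ => by simp [hf ψ (hΨ hψ), hψ]
    have : f x = 0 := h0 hx'
    exact h (by rw [hn] at this; exact_mod_cast this)
  clear hx'
  induction hx using AddSubmonoid.closure_induction with
  | mem x hx =>
    by_cases h : x ∈ Ψ
    · exact ⟨0, by simp [hf x hx, h], fun _ => AddSubmonoid.subset_closure h⟩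
    · exact ⟨1, by simp [hf x hx, h], by simp⟩
  | zero => exact ⟨0, by simp⟩
  | add x y _ _ hx hy =>
    obtain ⟨n, hn, h0⟩ := hx
    obtain ⟨m, hm, k0⟩ := hy
    exact ⟨n + m, by simp [hn, hm], fun h => add_mem (h0 (by omega)) (k0 (by omega))⟩

theorem exists_finsupp_of_mem_closure {x : V} (hx : x ∈ AddSubgroup.closure Φ) :
    ∃ c : V →₀ ℤ, (c.support : Set V) ⊆ Φ ∧ x = c.sum (fun ψ m => m • ψ) := by
  classical
  induction hx using AddSubgroup.closure_induction with
  | mem x hx =>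
    refine ⟨Finsupp.single x 1, ?_, by simp⟩
    exact (Finset.coe_subset.2 Finsupp.support_single_subset).trans (by simpa using hx)
  | zero => exact ⟨0, by simp⟩
  | add x y _ _ hx hy =>
    obtain ⟨c, hc, rfl⟩ := hx
    obtain ⟨d, hd, rfl⟩ := hy
    refine ⟨c + d, ?_, ?_⟩
    · refine (Finset.coe_subset.2 Finsupp.support_add).trans ?_
      rw [Finset.coe_union]
      exact Set.union_subset hc hd
    · rw [Finsupp.sum_add_index'] <;> simp [add_smul]
  | neg x _ hx =>
    obtain ⟨c, hc, rfl⟩ := hx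
    refine ⟨-c, by rwa [Finsupp.support_neg], ?_⟩
    rw [Finsupp.sum_neg_index (by simp)]
    simp [Finsupp.sum]

theorem hasCoeff_zsmul_add {φ y : V} (hφ : φ ∈ Φ) (hy : y ∈ AddSubgroup.closure (Φ \ {φ}))
    (n : ℤ) : HasCoeff Φ φ (n • φ + y) n := by
  classical
  obtain ⟨c, hc, rfl⟩ := exists_finsupp_of_mem_closure hy
  have hcφ : c φ = 0 := by
    by_contra h
    exact (hc (Finsupp.mem_support_iff.2 h)).2 rfl
  refine ⟨Finsupp.single φ n + c, ?_, ?_, by simp [hcφ]⟩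
  · refine (Finset.coe_subset.2 Finsupp.support_add).trans ?_
    rw [Finset.coe_union]
    refine Set.union_subset ?_ (hc.trans Set.sdiff_subset)
    exact (Finset.coe_subset.2 Finsupp.support_single_subset).trans (by simpa using hφ)
  · rw [Finsupp.sum_add_index'] <;> simp [add_smul]

theorem HasCoeff.eq_coord {φ x : V} {n : ℤ} (h : HasCoeff Φ φ x n) {f : V →ₗ[ℂ] ℂ}
    (hf : f φ = 1) (hf0 : ∀ ψ ∈ Φ \ {φ}, f ψ = 0) : f x = n := by
  obtain ⟨c, hc, rfl, rfl⟩ := h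
  rw [Finsupp.sum, map_sum, Finset.sum_eq_single φ]
  · simp [hf]
  · intro ψ hψ hne
    rw [map_zsmul, hf0 ψ ⟨hc hψ, hne⟩, smul_zero]
  · intro h
    rw [Finsupp.notMem_support_iff.1 h]
    simp

theorem HasCoeff.mem_closure {φ x : V} {n : ℤ} (h : HasCoeff Φ φ x n) :
    x ∈ AddSubgroup.closure Φ := by
  obtain ⟨c, hc, rfl, -⟩ := h
  exact sum_mem fun ψ hψ => zsmul_mem (AddSubgroup.subset_closure (hc hψ)) _

theorem IsHighest.unique (hΨ : LinearIndepOn ℂ id Ψ) {S : Set V} {μ η : V} (h : IsHighest Ψ S μ)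
    (h' : IsHighest Ψ S η) : μ = η :=
  sub_eq_zero.1 (hΨ.eq_zero_of_mem_of_neg_mem (h.2 η h'.1) (by simpa using h'.2 μ h.1))

theorem IsLowest.unique (hΨ : LinearIndepOn ℂ id Ψ) {S : Set V} {μ η : V} (h : IsLowest Ψ S μ)
    (h' : IsLowest Ψ S η) : μ = η :=
  sub_eq_zero.1 (hΨ.eq_zero_of_mem_of_neg_mem (h'.2 μ h.1) (by simpa using h.2 η h'.1))

/-- `s` acts on the root system `Δ` as the reflection in the root `α`. -/
structure IsRootReflection (Δ : Set V) (α : V) (s : V ≃ₗ[ℂ] V) : Prop where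
  apply_self : s α = -α
  mapsTo : ∀ β ∈ Δ, s β ∈ Δ
  exists_eq : ∀ β ∈ Δ, ∃ n : ℤ, s β = β - n • α

/-- The properties of the root system of a complex semisimple Lie algebra that are used below.
The form `B` stands for the real part of an invariant form; it is positive definite on the lattice
spanned by the roots. -/
structure IsRootSet (Δ : Set V) (B : V →+ V →+ ℝ) : Prop where
  finite : Δ.Finite
  zero_notMem : (0 : V) ∉ Δ
  neg_mem : ∀ α ∈ Δ, -α ∈ Δ
  symm : ∀ x y, B x y = B y x
  pos : ∀ x ∈ AddSubgroup.closure Δ, x ≠ 0 → 0 < B x x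
  sub_mem : ∀ α ∈ Δ, ∀ β ∈ Δ, α ≠ β → 0 < B α β → α - β ∈ Δ
  reduced : ∀ α ∈ Δ, ∀ n : ℕ, n • α ∈ Δ → n = 1

theorem form_nonpos_of_mem_closure {B : V →+ V →+ ℝ} {x y : V} (h : ∀ ψ ∈ Φ, B x ψ ≤ 0)
    (hy : y ∈ AddSubmonoid.closure Φ) : B x y ≤ 0 := by
  induction hy using AddSubmonoid.closure_induction with
  | mem x hx => exact h x hx
  | zero => simp
  | add x y _ _ hx hy => rw [map_add]; linarith

theorem form_eq_zero_of_mem_closure {B : V →+ V →+ ℝ} {x y : V} (h : ∀ ψ ∈ Φ, B x ψ = 0)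
    (hy : y ∈ AddSubgroup.closure Φ) : B x y = 0 := by
  induction hy using AddSubgroup.closure_induction with
  | mem x hx => exact h x hx
  | zero => simp
  | add x y _ _ hx hy => rw [map_add, hx, hy, add_zero]
  | neg x _ hx => rw [map_neg, hx, neg_zero]

namespace IsSimpleSystem

variable {Δ : Set V} (hΦ : IsSimpleSystem Δ Φ)
include hΦ

theorem mem_intClosure {α : V} (hα : α ∈ Δ) : α ∈ AddSubgroup.closure Φ := by
  rcases hΦ.mem_or_neg_mem α hα with h | h
  · exact mem_addSubgroupClosure h
  · simpa using neg_mem (mem_addSubgroupClosure h)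

/-- A root with a positive coordinate is positive. -/
theorem mem_closure_of_coord_pos {α : V} (hα : α ∈ Δ) {f : V →ₗ[ℂ] ℂ}
    (hf : ∀ ψ ∈ Φ, ∃ n : ℕ, f ψ = n) {n : ℕ} (hn : 0 < n) (hfα : f α = n) :
    α ∈ AddSubmonoid.closure Φ := by
  refine (hΦ.mem_or_neg_mem α hα).resolve_right fun h => ?_
  obtain ⟨m, hm⟩ := exists_nat_of_mem_closure hf h
  rw [map_neg, hfα] at hm
  have : (n : ℂ) + m = 0 := by rw [← hm]; ring
  have : n + m = 0 := by exact_mod_cast this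
  omega

/-- A subset of a base is a base of the roots that it spans. -/
theorem restrict (hΨ : Ψ ⊆ Φ) {R : Set V} (hR : R ⊆ Δ) (hΨR : Ψ ⊆ R)
    (hspan : ∀ α ∈ R, α ∈ Submodule.span ℂ Ψ) : IsSimpleSystem R Ψ where
  subset := hΨR
  linearIndependent := hΦ.linearIndependent.mono hΨ
  mem_or_neg_mem α hα := (hΦ.mem_or_neg_mem α (hR hα)).imp
    (fun h => hΦ.linearIndependent.mem_closure_of_mem_span hΨ h (hspan α hα))
    (fun h => hΦ.linearIndependent.mem_closure_of_mem_span hΨ h (neg_mem (hspan α hα)))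

end IsSimpleSystem

namespace IsRootSet

variable {Δ : Set V} {B : V →+ V →+ ℝ} (hΔ : IsRootSet Δ B)
include hΔ

theorem ne_zero {α : V} (hα : α ∈ Δ) : α ≠ 0 := fun h => hΔ.zero_notMem (h ▸ hα)

theorem form_self_pos {α : V} (hα : α ∈ Δ) : 0 < B α α :=
  hΔ.pos α (AddSubgroup.subset_closure hα) (hΔ.ne_zero hα)

theorem form_comm (x y : V) : B x y = B y x := hΔ.symm x y

theorem add_mem_of_form_neg {α β : V} (hα : α ∈ Δ) (hβ : β ∈ Δ) (h : α ≠ -β) (hB : B α β < 0) :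
    α + β ∈ Δ := by
  simpa using hΔ.sub_mem α hα (-β) (hΔ.neg_mem β hβ) h (by simpa using hB)

/-- Every positive root that is not simple remains a positive root after subtraction of a suitable
simple root. -/
theorem exists_sub_simple_mem (hΦ : IsSimpleSystem Δ Φ) {α : V} (hα : α ∈ Δ)
    (hpos : α ∈ AddSubmonoid.closure Φ) (hns : α ∉ Φ) :
    ∃ ψ ∈ Φ, α - ψ ∈ Δ ∧ α - ψ ∈ AddSubmonoid.closure Φ := by
  have h1 : ∃ ψ ∈ Φ, 0 < B α ψ := by
    by_contra! h
    exact absurd (form_nonpos_of_mem_closure h hpos) (not_le.2 (hΔ.form_self_pos hα))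
  obtain ⟨ψ, hψ, hB⟩ := h1
  have hmem := hΔ.sub_mem α hα ψ (hΦ.subset hψ) (fun h => hns (h ▸ hψ)) hB
  refine ⟨ψ, hψ, hmem, (hΦ.mem_or_neg_mem _ hmem).resolve_right fun hneg => ?_⟩
  rw [neg_sub] at hneg
  obtain ⟨ht, h1, hht⟩ := hΦ.linearIndependent.exists_height
  obtain ⟨n, hn, hn0, -⟩ := hht α hpos
  obtain ⟨m, hm, hm0, -⟩ := hht _ hneg
  rw [map_sub, h1 ψ hψ, hn] at hm
  have : n + m = 1 := by
    have : (n : ℂ) + m = 1 := by rw [← hm]; ring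
    exact_mod_cast this
  have hn' : n ≠ 0 := fun h => hΔ.ne_zero hα (hn0 h)
  have := hm0 (by omega)
  exact hΔ.ne_zero hmem (by rw [← neg_sub, this, neg_zero])

theorem positive_induction (hΦ : IsSimpleSystem Δ Φ) {p : V → Prop} (hsimple : ∀ ψ ∈ Φ, p ψ)
    (hadd : ∀ α ∈ Δ, α ∈ AddSubmonoid.closure Φ → ∀ ψ ∈ Φ, α + ψ ∈ Δ → p α → p (α + ψ))
    {α : V} (hα : α ∈ Δ) (hpos : α ∈ AddSubmonoid.closure Φ) : p α := by
  obtain ⟨ht, h1, hht⟩ := hΦ.linearIndependent.exists_height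
  obtain ⟨n, hn, -, -⟩ := hht α hpos
  induction n generalizing α with
  | zero =>
    obtain ⟨m, hm, hm0, -⟩ := hht α hpos
    exact absurd (hm0 (by rw [hn] at hm; exact_mod_cast hm.symm)) (hΔ.ne_zero hα)
  | succ n ih =>
    by_cases hs : α ∈ Φ
    · exact hsimple α hs
    obtain ⟨ψ, hψ, hmem, hcl⟩ := hΔ.exists_sub_simple_mem hΦ hα hpos hs
    have := hadd _ hmem hcl ψ hψ (by simpa using hα)
      (ih hmem hcl (by rw [map_sub, hn, h1 ψ hψ]; push_cast; ring))
    simpa using this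

theorem simpleRoots_eq (hΦ : IsSimpleSystem Δ Φ) :
    simpleRoots {α | α ∈ Δ ∧ α ∈ AddSubmonoid.closure Φ} = Φ := by
  ext α
  constructor
  · rintro ⟨⟨hα, hpos⟩, hind⟩
    by_contra hns
    obtain ⟨ψ, hψ, hmem, hcl⟩ := hΔ.exists_sub_simple_mem hΦ hα hpos hns
    exact hind _ ⟨hmem, hcl⟩ ψ ⟨hΦ.subset hψ, AddSubmonoid.subset_closure hψ⟩ (by simp)
  · intro hα
    refine ⟨⟨hΦ.subset hα, AddSubmonoid.subset_closure hα⟩, ?_⟩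
    rintro β ⟨hβ, hβ'⟩ γ ⟨hγ, hγ'⟩ rfl
    obtain ⟨ht, h1, hht⟩ := hΦ.linearIndependent.exists_height
    obtain ⟨n, hn, hn0, -⟩ := hht β hβ'
    obtain ⟨m, hm, hm0, -⟩ := hht γ hγ'
    have h := h1 _ hα
    rw [map_add, hn, hm] at h
    have h : n + m = 1 := by exact_mod_cast h
    have := mt hn0 (hΔ.ne_zero hβ)
    have := mt hm0 (hΔ.ne_zero hγ)
    omega

end IsRootSet

end LatticeCombinatorics

/-! ### Longest elements and opposition involutions -/

section LongestElement

variable {V : Type*} [AddCommGroup V] [Module ℂ V] {Φ Ψ Δ R : Set V} {B : V →+ V →+ ℝ}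

theorem IsRootSet.restrict (hΔ : IsRootSet Δ B) (Ψ : Set V) :
    IsRootSet {α | α ∈ Δ ∧ α ∈ AddSubgroup.closure Ψ} B where
  finite := hΔ.finite.subset fun _ h => h.1
  zero_notMem h := hΔ.zero_notMem h.1
  neg_mem α h := ⟨hΔ.neg_mem α h.1, AddSubgroup.neg_mem _ h.2⟩
  symm := hΔ.symm
  pos x hx := hΔ.pos x (AddSubgroup.closure_mono (fun _ h => h.1) hx)
  sub_mem α hα β hβ hne h := ⟨hΔ.sub_mem α hα.1 β hβ.1 hne h, AddSubgroup.sub_mem _ hα.2 hβ.2⟩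
  reduced α hα n hn := hΔ.reduced α hα.1 n hn.1

/-- The group generated by the linear maps that act on the root system `Δ` as reflections in roots
belonging to `R`. As `Δ` need not span the space, several maps may correspond to one root. -/
def reflectionGroup (Δ R : Set V) : Subgroup (V ≃ₗ[ℂ] V) :=
  Subgroup.closure {s | ∃ α ∈ R, IsRootReflection Δ α s}

theorem reflectionGroup_apply (hfin : Δ.Finite) {w : V ≃ₗ[ℂ] V} (hw : w ∈ reflectionGroup Δ R) :
    ∀ β ∈ Δ, w β ∈ Δ ∧ w β - β ∈ AddSubgroup.closure R := by
  induction hw using Subgroup.closure_induction with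
  | mem s hs =>
    obtain ⟨α, hα, hs⟩ := hs
    intro β hβ
    obtain ⟨n, hn⟩ := hs.exists_eq β hβ
    refine ⟨hs.mapsTo β hβ, ?_⟩
    rw [hn, sub_sub_cancel_left]
    exact neg_mem (zsmul_mem (AddSubgroup.subset_closure hα) n)
  | one => exact fun β hβ => ⟨hβ, by simp⟩
  | mul u v _ _ hu hv =>
    intro β hβ
    obtain ⟨h1, h2⟩ := hv β hβ
    obtain ⟨h3, h4⟩ := hu _ h1
    refine ⟨h3, ?_⟩
    rw [LinearEquiv.mul_apply, ← sub_add_sub_cancel]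
    exact add_mem h4 h2
  | inv u _ hu =>
    intro β hβ
    have hsurj : Set.SurjOn u Δ Δ :=
      ((hfin.injOn_iff_bijOn_of_mapsTo fun β hβ => (hu β hβ).1).1 u.injective.injOn).surjOn
    obtain ⟨γ, hγ, rfl⟩ := hsurj hβ
    have h1 : u⁻¹ (u γ) = γ := u.symm_apply_apply γ
    rw [h1]
    exact ⟨hγ, by rw [← neg_sub]; exact neg_mem (hu γ hγ).2⟩

/-- A simple reflection permutes the positive roots other than the simple root itself. -/
theorem IsRootSet.reflection_mem_closure (hR : IsRootSet R B) (hΨ : IsSimpleSystem R Ψ) {ψ : V}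
    {s : V ≃ₗ[ℂ] V} (hψ : ψ ∈ Ψ) (hs : IsRootReflection R ψ s) {α : V} (hα : α ∈ R)
    (hpos : α ∈ AddSubmonoid.closure Ψ) (hne : α ≠ ψ) : s α ∈ AddSubmonoid.closure Ψ := by
  classical
  obtain ⟨n, y, hy, rfl⟩ := exists_eq_nsmul_add (φ := ψ) hpos
  have hy0 : y ≠ 0 := by
    rintro rfl
    rw [add_zero] at hα hne
    have := hR.reduced ψ (hΨ.subset hψ) n hα
    exact hne (by rw [this, one_nsmul])
  obtain ⟨f, hf⟩ := hΨ.linearIndependent.exists_linearMap_eq (fun χ => if χ = ψ then 0 else 1)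
  obtain ⟨ht, h1, hht⟩ := (hΨ.linearIndependent.mono Set.sdiff_subset).exists_height (Φ := Ψ \ {ψ})
  obtain ⟨m, hm, hm0, -⟩ := hht y hy
  have hfy : f y = m := by
    rw [← hm]
    refine eqOn_closure (fun χ hχ => ?_) (mem_addSubgroupClosure hy)
    rw [h1 χ hχ, hf χ hχ.1, if_neg (by exact hχ.2)]
  obtain ⟨k, hk⟩ := hs.exists_eq _ hα
  refine hΨ.mem_closure_of_coord_pos (hs.mapsTo _ hα) (f := f) (n := m) (fun χ hχ => ?_)
    (Nat.pos_of_ne_zero (mt hm0 hy0)) ?_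
  · rw [hf χ hχ]
    split_ifs
    · exact ⟨0, by simp⟩
    · exact ⟨1, by simp⟩
  · rw [hk, map_sub, map_add, map_nsmul, map_zsmul, hf ψ hψ, hfy]
    simp

theorem exists_isLongestElement (G : Subgroup (V ≃ₗ[ℂ] V)) {P : Set V} (hP : P.Finite) :
    ∃ w, IsLongestElement G P w := by
  let T : Set ℕ := {n | ∃ u ∈ G, inversionLength P u = n}
  have hT : BddAbove T := by
    refine ⟨P.ncard, ?_⟩
    rintro _ ⟨u, -, rfl⟩
    exact Set.ncard_le_ncard (fun _ h => h.1) hP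
  obtain ⟨w, hw, hlen⟩ := Nat.sSup_mem (s := T) ⟨_, 1, one_mem G, rfl⟩ hT
  exact ⟨w, hw, fun u hu => hlen ▸ le_csSup hT ⟨u, hu, rfl⟩⟩

/-- The defining property of the longest element `w` with respect to the base `Ψ`: the map `-w`
permutes the base. -/
structure IsOpposition (Ψ : Set V) (w : V ≃ₗ[ℂ] V) : Prop where
  neg_mem : ∀ ψ ∈ Ψ, -(w ψ) ∈ Ψ
  exists_eq : ∀ ψ ∈ Ψ, ∃ ψ' ∈ Ψ, w ψ' = -ψ

theorem IsOpposition.neg_mem_closure {w : V ≃ₗ[ℂ] V} (hw : IsOpposition Ψ w) {x : V}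
    (hx : x ∈ AddSubmonoid.closure Ψ) : -(w x) ∈ AddSubmonoid.closure Ψ := by
  induction hx using AddSubmonoid.closure_induction with
  | mem x hx => exact AddSubmonoid.subset_closure (hw.neg_mem x hx)
  | zero => simp
  | add x y _ _ hx hy => rw [map_add, neg_add]; exact add_mem hx hy

/-- A longest element makes every simple root negative, since otherwise multiplication by the
simple reflection would lengthen it; hence its negative permutes the positive roots and, comparing
heights, the simple roots. -/
theorem IsRootSet.isOpposition (hR : IsRootSet R B) (hΨ : IsSimpleSystem R Ψ)
    {G : Subgroup (V ≃ₗ[ℂ] V)} (hG : ∀ w ∈ G, ∀ β ∈ R, w β ∈ R)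
    (hs : ∀ ψ ∈ Ψ, ∃ s ∈ G, IsRootReflection R ψ s) {w : V ≃ₗ[ℂ] V}
    (hw : IsLongestElement G {α | α ∈ R ∧ α ∈ AddSubmonoid.closure Ψ} w) : IsOpposition Ψ w := by
  set P : Set V := {α | α ∈ R ∧ α ∈ AddSubmonoid.closure Ψ} with hP
  have hPfin : P.Finite := hR.finite.subset fun _ h => h.1
  have hneg : ∀ α ∈ P, -α ∉ P := fun α hα hα' =>
    hR.ne_zero hα.1 (hΨ.linearIndependent.eq_zero_of_mem_of_neg_mem hα.2 hα'.2)
  have key : ∀ ψ ∈ Ψ, -(w ψ) ∈ P := by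
    intro ψ hψ
    have hψP : ψ ∈ P := ⟨hΨ.subset hψ, AddSubmonoid.subset_closure hψ⟩
    by_contra hcon
    have hwψR := hG w hw.1 ψ hψP.1
    have hwψ : w ψ ∈ P := ⟨hwψR, (hΨ.mem_or_neg_mem _ hwψR).resolve_right
      fun h => hcon ⟨hR.neg_mem _ hwψR, h⟩⟩
    obtain ⟨s, hsG, hsr⟩ := hs ψ hψ
    have hss : ∀ α ∈ R, s (s α) = α := by
      intro α hα
      obtain ⟨n, hn⟩ := hsr.exists_eq α hα
      rw [hn, map_sub, map_zsmul, hsr.apply_self, hn]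
      simp
    have hlen := hw.2 (w * s) (mul_mem hw.1 hsG)
    have hsub : insert ψ (s '' {α | α ∈ P ∧ -(w α) ∈ P}) ⊆ {α | α ∈ P ∧ -((w * s) α) ∈ P} := by
      refine Set.insert_subset ⟨hψP, ?_⟩ ?_
      · rw [LinearEquiv.mul_apply, hsr.apply_self, map_neg, neg_neg]
        exact hwψ
      · rintro _ ⟨α, ⟨hα, hα'⟩, rfl⟩
        have hne : α ≠ ψ := fun h => hcon (h ▸ hα')
        refine ⟨⟨hsr.mapsTo α hα.1, hR.reflection_mem_closure hΨ hψ hsr hα.1 hα.2 hne⟩, ?_⟩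
        rw [LinearEquiv.mul_apply, hss α hα.1]
        exact hα'
    have hnot : ψ ∉ s '' {α | α ∈ P ∧ -(w α) ∈ P} := by
      rintro ⟨α, ⟨hα, -⟩, h⟩
      have h2 := hss α hα.1
      rw [h, hsr.apply_self] at h2
      exact hneg ψ hψP (h2 ▸ hα)
    have hfin : {α | α ∈ P ∧ -(w α) ∈ P}.Finite := hPfin.subset fun _ h => h.1
    have h1 := Set.ncard_le_ncard hsub (hPfin.subset fun _ h => h.1)
    rw [Set.ncard_insert_of_notMem hnot (hfin.image s),
      Set.ncard_image_of_injective _ s.injective] at h1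
    unfold inversionLength at hlen
    omega
  have hcl : ∀ x ∈ AddSubmonoid.closure Ψ, -(w x) ∈ AddSubmonoid.closure Ψ := by
    intro x hx
    induction hx using AddSubmonoid.closure_induction with
    | mem x hx => exact (key x hx).2
    | zero => simp
    | add x y _ _ hx hy => rw [map_add, neg_add]; exact add_mem hx hy
  have hmaps : Set.MapsTo (fun α => -(w α)) P P := fun α hα =>
    ⟨hR.neg_mem _ (hG w hw.1 α hα.1), hcl α hα.2⟩
  have hinj : Function.Injective (fun α => -(w α)) := fun a b h => w.injective (neg_injective h)
  have hsurj : Set.SurjOn (fun α => -(w α)) P P :=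
    ((hPfin.injOn_iff_bijOn_of_mapsTo hmaps).1 hinj.injOn).surjOn
  obtain ⟨ht, h1, hht⟩ := hΨ.linearIndependent.exists_height
  -- The heights cannot decrease under `-w`, so the preimage of a simple root is simple.
  have hmono : ∀ x ∈ AddSubmonoid.closure Ψ, ∃ n m : ℕ, ht x = n ∧ ht (-(w x)) = m ∧ n ≤ m := by
    intro x hx
    induction hx using AddSubmonoid.closure_induction with
    | mem x hx =>
      obtain ⟨m, hm, hm0, -⟩ := hht _ (key x hx).2
      exact ⟨1, m, by simp [h1 x hx], hm, Nat.pos_of_ne_zero (mt hm0 (hR.ne_zero (key x hx).1))⟩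
    | zero => exact ⟨0, 0, by simp⟩
    | add x y _ _ hx hy =>
      obtain ⟨n, m, hn, hm, h⟩ := hx
      obtain ⟨n', m', hn', hm', h'⟩ := hy
      refine ⟨n + n', m + m', by simp [hn, hn'], ?_, by omega⟩
      rw [map_add, neg_add, map_add, hm, hm']
      simp
  have hex : ∀ ψ ∈ Ψ, ∃ ψ' ∈ Ψ, w ψ' = -ψ := by
    intro ψ hψ
    obtain ⟨α, hα, hαψ⟩ := hsurj ⟨hΨ.subset hψ, AddSubmonoid.subset_closure hψ⟩
    refine ⟨α, ?_, by rw [← hαψ, neg_neg]⟩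
    obtain ⟨n, m, hn, hm, hnm⟩ := hmono α hα.2
    obtain ⟨n', hn', h0, h1'⟩ := hht α hα.2
    have e1 : n = n' := by rw [hn] at hn'; exact_mod_cast hn'
    have e2 : m = 1 := by
      simp only at hαψ
      rw [hαψ, h1 ψ hψ] at hm
      exact_mod_cast hm.symm
    have := mt h0 (hR.ne_zero hα.1)
    exact h1' (by omega)
  refine ⟨fun ψ hψ => ?_, hex⟩
  have hΨfin : Ψ.Finite := hR.finite.subset hΨ.subset
  choose! u hu hu' using hex
  have hub : Set.SurjOn u Ψ Ψ := by
    refine ((hΨfin.injOn_iff_bijOn_of_mapsTo hu).1 fun a ha b hb h => ?_).surjOn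
    have := hu' a ha
    rw [h, hu' b hb] at this
    exact (neg_injective this).symm
  obtain ⟨χ, hχ, rfl⟩ := hub hψ
  rw [hu' χ hχ, neg_neg]
  exact hχ

/-- A set of roots that is a union of cosets of the lattice spanned by `Ψ`, within the root
system `Δ`. -/
def IsCosetClosed (Δ Ψ X : Set V) : Prop :=
  X ⊆ Δ ∧ ∀ β ∈ X, ∀ γ ∈ Δ, γ - β ∈ AddSubgroup.closure Ψ → γ ∈ X

/-- `w` permutes the root system `Δ` and moves every root by an element of the lattice spanned
by `Ψ`. -/
def PreservesCosets (Δ Ψ : Set V) (w : V ≃ₗ[ℂ] V) : Prop :=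
  ∀ β ∈ Δ, (w β ∈ Δ ∧ w β - β ∈ AddSubgroup.closure Ψ) ∧
    w.symm β ∈ Δ ∧ w.symm β - β ∈ AddSubgroup.closure Ψ

theorem PreservesCosets.apply_mem {w : V ≃ₗ[ℂ] V} (hw : PreservesCosets Δ Ψ w) {X : Set V}
    (hX : IsCosetClosed Δ Ψ X) {β : V} (hβ : β ∈ X) : w β ∈ X :=
  hX.2 β hβ _ (hw β (hX.1 hβ)).1.1 (hw β (hX.1 hβ)).1.2

theorem PreservesCosets.symm_apply_mem {w : V ≃ₗ[ℂ] V} (hw : PreservesCosets Δ Ψ w) {X : Set V}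
    (hX : IsCosetClosed Δ Ψ X) {β : V} (hβ : β ∈ X) : w.symm β ∈ X :=
  hX.2 β hβ _ (hw β (hX.1 hβ)).2.1 (hw β (hX.1 hβ)).2.2

theorem IsOpposition.isLowest {w : V ≃ₗ[ℂ] V} (hw : IsOpposition Ψ w)
    (hw' : PreservesCosets Δ Ψ w) {X : Set V} (hX : IsCosetClosed Δ Ψ X) {μ : V}
    (hμ : IsHighest Ψ X μ) : IsLowest Ψ X (w μ) := by
  refine ⟨hw'.apply_mem hX hμ.1, fun β hβ => ?_⟩
  have := hw.neg_mem_closure (hμ.2 _ (hw'.symm_apply_mem hX hβ))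
  simpa using this

theorem IsOpposition.isHighest {w : V ≃ₗ[ℂ] V} (hw : IsOpposition Ψ w)
    (hw' : PreservesCosets Δ Ψ w) {X : Set V} (hX : IsCosetClosed Δ Ψ X) {μ : V}
    (hμ : IsLowest Ψ X μ) : IsHighest Ψ X (w μ) := by
  refine ⟨hw'.apply_mem hX hμ.1, fun β hβ => ?_⟩
  have := hw.neg_mem_closure (hμ.2 _ (hw'.symm_apply_mem hX hβ))
  simpa using this

theorem preservesCosets_of_mem (hfin : Δ.Finite) (hR : R ⊆ AddSubgroup.closure Ψ)
    {w : V ≃ₗ[ℂ] V} (hw : w ∈ reflectionGroup Δ R) : PreservesCosets Δ Ψ w := by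
  have hle : AddSubgroup.closure R ≤ AddSubgroup.closure Ψ := (AddSubgroup.closure_le _).2 hR
  intro β hβ
  have h1 := reflectionGroup_apply hfin hw β hβ
  have h2 := reflectionGroup_apply hfin (inv_mem hw) β hβ
  exact ⟨⟨h1.1, hle h1.2⟩, h2.1, hle h2.2⟩

/-- The longest element of the reflection group of the subsystem spanned by `Ψ` maps `Ψ` onto
`-Ψ`. The group may be any one between the group generated by the simple reflections and the group
generated by all maps acting on `Δ` as reflections in roots of the subsystem, since `G` is the Weyl
group in one application and the second group in the other. -/
theorem IsRootSet.isOpposition_of_isLongest (hΔ : IsRootSet Δ B)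
    (hΨ : IsSimpleSystem {α | α ∈ Δ ∧ α ∈ AddSubgroup.closure Ψ} Ψ)
    {G : Subgroup (V ≃ₗ[ℂ] V)}
    (hG : G ≤ reflectionGroup Δ {α | α ∈ Δ ∧ α ∈ AddSubgroup.closure Ψ})
    (hs : ∀ ψ ∈ Ψ, ∃ s ∈ G, IsRootReflection Δ ψ s) {w : V ≃ₗ[ℂ] V}
    (hw : IsLongestElement G {α | (α ∈ Δ ∧ α ∈ AddSubgroup.closure Ψ) ∧
      α ∈ AddSubmonoid.closure Ψ} w) : IsOpposition Ψ w ∧ PreservesCosets Δ Ψ w := by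
  have hpres : ∀ w ∈ G, PreservesCosets Δ Ψ w := fun w hw =>
    preservesCosets_of_mem hΔ.finite (fun _ h => h.2) (hG hw)
  have hGR : ∀ w ∈ G, ∀ β ∈ {α | α ∈ Δ ∧ α ∈ AddSubgroup.closure Ψ},
      w β ∈ {α | α ∈ Δ ∧ α ∈ AddSubgroup.closure Ψ} := by
    intro w hw β hβ
    have h := (hpres w hw β hβ.1).1
    exact ⟨h.1, by simpa using add_mem h.2 hβ.2⟩
  refine ⟨(hΔ.restrict Ψ).isOpposition hΨ hGR (fun ψ hψ => ?_) hw, hpres w hw.1⟩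
  obtain ⟨s, hsG, hs⟩ := hs ψ hψ
  exact ⟨s, hsG, hs.apply_self, hGR s hsG, fun β hβ => hs.exists_eq β hβ.1⟩

theorem IsRootSet.exists_isOpposition (hΔ : IsRootSet Δ B)
    (hrefl : ∀ α ∈ Δ, ∃ s, IsRootReflection Δ α s)
    (hΨ : IsSimpleSystem {α | α ∈ Δ ∧ α ∈ AddSubgroup.closure Ψ} Ψ) :
    ∃ w, IsOpposition Ψ w ∧ PreservesCosets Δ Ψ w := by
  obtain ⟨w, hw⟩ := exists_isLongestElement
    (reflectionGroup Δ {α | α ∈ Δ ∧ α ∈ AddSubgroup.closure Ψ})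
    (P := {α | (α ∈ Δ ∧ α ∈ AddSubgroup.closure Ψ) ∧ α ∈ AddSubmonoid.closure Ψ})
    (hΔ.finite.subset fun _ h => h.1.1)
  refine ⟨w, hΔ.isOpposition_of_isLongest hΨ le_rfl (fun ψ hψ => ?_) hw⟩
  obtain ⟨s, hs⟩ := hrefl ψ (hΨ.subset hψ).1
  exact ⟨s, Subgroup.subset_closure ⟨ψ, hΨ.subset hψ, hs⟩, hs⟩

/-- A nonempty set `T ⊆ S` that is stable under addition of roots from the lattice of `Ψ` is all
of `S`, when `S` has a lowest element. This is the combinatorial content of the irreducibility of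
the corresponding module. If `T` contains the lowest element, a minimal element `μ` of the
complement would satisfy `B μ μ ≤ 0`; otherwise the same argument applies to `S \ T`. -/
theorem IsRootSet.eq_of_isLowest (hΔ : IsRootSet Δ B) (hΨ : LinearIndepOn ℂ id Ψ) (hΨΔ : Ψ ⊆ Δ)
    {S T : Set V} {η : V} (hS : IsCosetClosed Δ Ψ S) (hη : IsLowest Ψ S η)
    (hdisj : ∀ β ∈ S, β ∉ AddSubgroup.closure Ψ) (hTS : T ⊆ S) (hT : T.Nonempty)
    (hadd : ∀ β ∈ T, ∀ γ ∈ Δ, γ ∈ AddSubgroup.closure Ψ → β + γ ∈ S → β + γ ∈ T) : T = S := by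
  have aux : ∀ T ⊆ S, η ∈ T →
      (∀ β ∈ T, ∀ γ ∈ Δ, γ ∈ AddSubgroup.closure Ψ → β + γ ∈ S → β + γ ∈ T) → S ⊆ T := by
    intro T hTS hηT hadd
    obtain ⟨ht, h1, hht⟩ := hΨ.exists_height
    suffices h : ∀ n : ℕ, ∀ μ ∈ S, ht (μ - η) = n → μ ∈ T by
      intro μ hμ
      obtain ⟨n, hn, -, -⟩ := hht _ (hη.2 μ hμ)
      exact h n μ hμ hn
    intro n
    induction n with
    | zero =>
      intro μ hμ hn
      obtain ⟨m, hm, hm0, -⟩ := hht _ (hη.2 μ hμ)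
      have := hm0 (by rw [hn] at hm; exact_mod_cast hm.symm)
      rwa [sub_eq_zero.1 this]
    | succ n ih =>
      intro μ hμ hn
      by_contra hμT
      have h2 : ∀ ψ ∈ Ψ, B μ ψ ≤ 0 := by
        intro ψ hψ
        by_contra! hB
        have hψc : ψ ∈ AddSubgroup.closure Ψ := AddSubgroup.subset_closure hψ
        have hmem := hΔ.sub_mem μ (hS.1 hμ) ψ (hΨΔ hψ) (fun h => hdisj μ hμ (h ▸ hψc)) hB
        have hmemS := hS.2 μ hμ _ hmem (by simpa using hψc)
        have := hadd _ (ih _ hmemS (by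
          rw [sub_right_comm, map_sub, hn, h1 ψ hψ]; push_cast; ring)) ψ (hΨΔ hψ) hψc
          (by simpa using hμ)
        exact hμT (by simpa using this)
      have h3 : B μ η ≤ 0 := by
        by_contra! hB
        have hmem := hΔ.sub_mem μ (hS.1 hμ) η (hS.1 hη.1) (fun h => hμT (h ▸ hηT)) hB
        have := hadd η hηT _ hmem (mem_addSubgroupClosure (hη.2 μ hμ)) (by simpa using hμ)
        exact hμT (by simpa using this)
      have h4 := form_nonpos_of_mem_closure h2 (hη.2 μ hμ)
      have h5 := hΔ.form_self_pos (hS.1 hμ)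
      rw [map_sub] at h4
      linarith
  by_cases hηT : η ∈ T
  · exact hTS.antisymm (aux T hTS hηT hadd)
  · exfalso
    obtain ⟨β, hβ⟩ := hT
    have := aux (S \ T) Set.sdiff_subset ⟨hη.1, hηT⟩
      (fun β hβ γ hγ hγ' h => ⟨h, fun hT' => hβ.2 ?_⟩)
    · exact (this (hTS hβ)).2 hβ
    · simpa using hadd _ hT' (-γ) (hΔ.neg_mem γ hγ) (AddSubgroup.neg_mem _ hγ')
        (by simpa using hβ.1)

end LongestElement

/-! ### Bases with one noncompact root of coefficient two -/

section GradedBases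

variable {V : Type*} [AddCommGroup V] [Module ℂ V] {Φ Ψ Δ Δn Φk : Set V} {B : V →+ V →+ ℝ}
  {ν δ : V}

/-- `Δn` is the set of noncompact roots of a `ℤ/2`-grading: a sum of two roots is noncompact if
and only if exactly one of them is. -/
structure IsNoncompactPart (Δ Δn : Set V) : Prop where
  subset : Δn ⊆ Δ
  neg_mem : ∀ α ∈ Δn, -α ∈ Δn
  add_mem_iff : ∀ α ∈ Δ, ∀ β ∈ Δ, α + β ∈ Δ → (α + β ∈ Δn ↔ ¬(α ∈ Δn ↔ β ∈ Δn))

theorem IsNoncompactPart.neg_mem_iff (hn : IsNoncompactPart Δ Δn) {α : V} :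
    -α ∈ Δn ↔ α ∈ Δn :=
  ⟨fun h => by simpa using hn.neg_mem _ h, hn.neg_mem α⟩

theorem IsNoncompactPart.isRootSet_compact (hn : IsNoncompactPart Δ Δn) (hΔ : IsRootSet Δ B) :
    IsRootSet (Δ \ Δn) B where
  finite := hΔ.finite.subset Set.sdiff_subset
  zero_notMem h := hΔ.zero_notMem h.1
  neg_mem α h := ⟨hΔ.neg_mem α h.1, fun h' => h.2 (hn.neg_mem_iff.1 h')⟩
  symm := hΔ.symm
  pos x hx := hΔ.pos x (AddSubgroup.closure_mono Set.sdiff_subset hx)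
  sub_mem α hα β hβ hne h := by
    have hmem := hΔ.sub_mem α hα.1 β hβ.1 hne h
    refine ⟨hmem, fun h' => ?_⟩
    rw [sub_eq_add_neg] at h' hmem
    have := (hn.add_mem_iff α hα.1 (-β) (hΔ.neg_mem β hβ.1) hmem).1 h'
    rw [hn.neg_mem_iff] at this
    exact this (iff_of_false hα.2 hβ.2)
  reduced α hα n hn := hΔ.reduced α hα.1 n hn.1

/-- The base of a Borel-de Siebenthal positive system, in the case in which the noncompact simple
root `ν` has coefficient `2` in the highest root `δ`. -/
structure IsGradedBase (Δ Δn Φ : Set V) (ν δ : V) : Prop where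
  simple : IsSimpleSystem Δ Φ
  inter_eq : Φ ∩ Δn = {ν}
  highest : IsHighest Φ Δ δ
  coeff : HasCoeff Φ ν δ 2

/-- `f` is the linear form that gives the coefficient of `φ` in the combinations of elements
of `Φ`. -/
def IsCoord (Φ : Set V) (φ : V) (f : V →ₗ[ℂ] ℂ) : Prop :=
  f φ = 1 ∧ ∀ ψ ∈ Φ \ {φ}, f ψ = 0

theorem IsSimpleSystem.exists_isCoord (hΦ : IsSimpleSystem Δ Φ) {φ : V} (hφ : φ ∈ Φ) :
    ∃ f, IsCoord Φ φ f := by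
  obtain ⟨f, h, h'⟩ := hΦ.linearIndependent.exists_coord φ
  exact ⟨f, h hφ, h'⟩

namespace IsCoord

variable {φ : V} {f : V →ₗ[ℂ] ℂ} (hf : IsCoord Φ φ f)
include hf

theorem exists_nat : ∀ ψ ∈ Φ, ∃ n : ℕ, f ψ = n := by
  intro ψ hψ
  by_cases h : ψ = φ
  · exact ⟨1, by simp [h, hf.1]⟩
  · exact ⟨0, by simp [hf.2 ψ ⟨hψ, h⟩]⟩

theorem exists_int : ∀ ψ ∈ Φ, ∃ n : ℤ, f ψ = n := fun ψ hψ => by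
  obtain ⟨n, hn⟩ := hf.exists_nat ψ hψ
  exact ⟨n, by simpa using hn⟩

theorem eq_zero {x : V} (hx : x ∈ AddSubgroup.closure (Φ \ {φ})) : f x = 0 :=
  eq_zero_of_mem_closure hf.2 hx

theorem sub_zsmul_mem {x : V} (hx : x ∈ AddSubgroup.closure Φ) {n : ℤ} (hn : f x = n) :
    x - n • φ ∈ AddSubgroup.closure (Φ \ {φ}) := by
  obtain ⟨m, y, hy, rfl⟩ := exists_eq_zsmul_add (φ := φ) hx
  rw [map_add, map_zsmul, hf.1, hf.eq_zero hy] at hn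
  have : m = n := by simpa using hn
  subst this
  simpa using hy

theorem sub_nsmul_mem {x : V} (hx : x ∈ AddSubmonoid.closure Φ) {n : ℕ} (hn : f x = n) :
    x - n • φ ∈ AddSubmonoid.closure (Φ \ {φ}) := by
  obtain ⟨m, y, hy, rfl⟩ := exists_eq_nsmul_add (φ := φ) hx
  rw [map_add, map_nsmul, hf.1, hf.eq_zero (mem_addSubgroupClosure hy)] at hn
  have : m = n := by simpa using hn
  subst this
  simpa using hy

theorem mem_closure_of_eq_zero {x : V} (hx : x ∈ AddSubmonoid.closure Φ) (hn : f x = 0) :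
    x ∈ AddSubmonoid.closure (Φ \ {φ}) := by
  simpa using hf.sub_nsmul_mem hx (n := 0) (by simpa using hn)

theorem mem_intClosure_of_eq_zero {x : V} (hx : x ∈ AddSubgroup.closure Φ) (hn : f x = 0) :
    x ∈ AddSubgroup.closure (Φ \ {φ}) := by
  simpa using hf.sub_zsmul_mem hx (n := 0) (by simpa using hn)

end IsCoord

namespace IsGradedBase

variable (h : IsGradedBase Δ Δn Φ ν δ) (hΔ : IsRootSet Δ B) (hn : IsNoncompactPart Δ Δn)
include h

theorem mem : ν ∈ Φ := (h.inter_eq.symm ▸ Set.mem_singleton ν : ν ∈ Φ ∩ Δn).1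

theorem noncompact : ν ∈ Δn := (h.inter_eq.symm ▸ Set.mem_singleton ν : ν ∈ Φ ∩ Δn).2

theorem notMem_noncompact {ψ : V} (hψ : ψ ∈ Φ \ {ν}) : ψ ∉ Δn := fun h' =>
  hψ.2 (h.inter_eq ▸ (⟨hψ.1, h'⟩ : ψ ∈ Φ ∩ Δn))

include hΔ hn

/-- The coefficient `m` of `ν` in a root satisfies `|m| ≤ 2`, and the root is noncompact if and
only if `m` is odd. -/
theorem level {f : V →ₗ[ℂ] ℂ} (hf : IsCoord Φ ν f) {α : V} (hα : α ∈ Δ) :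
    ∃ m : ℤ, f α = m ∧ -2 ≤ m ∧ m ≤ 2 ∧ (α ∈ Δn ↔ Odd m) := by
  have hpos : ∀ α ∈ Δ, α ∈ AddSubmonoid.closure Φ →
      ∃ n : ℕ, f α = n ∧ n ≤ 2 ∧ (α ∈ Δn ↔ Odd n) := by
    intro α hα hpos
    have h1 : ∃ n : ℕ, f α = n ∧ (α ∈ Δn ↔ Odd n) := by
      refine hΔ.positive_induction h.simple (p := fun α => ∃ n : ℕ, f α = n ∧ (α ∈ Δn ↔ Odd n))
        ?_ ?_ hα hpos
      · intro ψ hψ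
        by_cases hψν : ψ = ν
        · subst hψν
          exact ⟨1, by simpa using hf.1, iff_of_true h.noncompact odd_one⟩
        · exact ⟨0, by simpa using hf.2 ψ ⟨hψ, hψν⟩,
            iff_of_false (h.notMem_noncompact ⟨hψ, hψν⟩) (by simp)⟩
      · rintro α hα - ψ hψ hadd ⟨n, hfn, hodd⟩
        rw [hn.add_mem_iff α hα ψ (h.simple.subset hψ) hadd]
        by_cases hψν : ψ = ν
        · subst hψν
          refine ⟨n + 1, by simp [hfn, hf.1], ?_⟩
          simp [hodd, h.noncompact, Nat.odd_add_one]
        · refine ⟨n, by simp [hfn, hf.2 ψ ⟨hψ, hψν⟩], ?_⟩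
          simp [hodd, h.notMem_noncompact ⟨hψ, hψν⟩]
    obtain ⟨n, hfn, hodd⟩ := h1
    obtain ⟨m, hm⟩ := exists_nat_of_mem_closure hf.exists_nat (h.highest.2 α hα)
    rw [map_sub, h.coeff.eq_coord hf.1 hf.2, hfn] at hm
    refine ⟨n, hfn, ?_, hodd⟩
    have : (2 : ℂ) = m + n := by rw [← hm]; simp
    have : 2 = m + n := by exact_mod_cast this
    omega
  rcases h.simple.mem_or_neg_mem α hα with h' | h'
  · obtain ⟨n, h1, h2, h3⟩ := hpos α hα h'
    exact ⟨n, by simpa using h1, by omega, by omega, by simpa using h3⟩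
  · obtain ⟨n, h1, h2, h3⟩ := hpos _ (hΔ.neg_mem α hα) h'
    refine ⟨-n, by rw [← neg_neg α, map_neg, h1]; simp, by omega, by omega, ?_⟩
    rw [← hn.neg_mem_iff, h3]
    simp

theorem even_of_compact {f : V →ₗ[ℂ] ℂ} (hf : IsCoord Φ ν f) {α : V} (hα : α ∈ Δ \ Δn)
    (hpos : α ∈ AddSubmonoid.closure Φ) : f α = 0 ∨ f α = 2 := by
  obtain ⟨m, hm, h1, h2, hodd⟩ := h.level hΔ hn hf hα.1
  obtain ⟨n, hn'⟩ := exists_nat_of_mem_closure hf.exists_nat hpos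
  have hmn : m = n := by rw [hm] at hn'; exact_mod_cast hn'
  have : Even m := by
    rw [← Int.not_odd_iff_even, ← hodd]
    exact hα.2
  obtain ⟨k, hk⟩ := this
  obtain hm' | hm' : m = 0 ∨ m = 2 := by omega
  · exact Or.inl (by simp [hm, hm'])
  · exact Or.inr (by simp [hm, hm'])

theorem coord_noncompact {f : V →ₗ[ℂ] ℂ} (hf : IsCoord Φ ν f) {α : V} (hα : α ∈ Δn) :
    f α = 1 ∨ f α = -1 := by
  obtain ⟨m, hm, h1, h2, hodd⟩ := h.level hΔ hn hf (hn.subset hα)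
  obtain ⟨k, hk⟩ := hodd.1 hα
  obtain hm' | hm' : m = 1 ∨ m = -1 := by omega
  · exact Or.inl (by simp [hm, hm'])
  · exact Or.inr (by simp [hm, hm'])

theorem noncompact_of_coord {f : V →ₗ[ℂ] ℂ} (hf : IsCoord Φ ν f) {α : V} (hα : α ∈ Δ)
    (hfα : f α = 1) : α ∈ Δn := by
  obtain ⟨m, hm, h1, h2, hodd⟩ := h.level hΔ hn hf hα
  rw [hfα] at hm
  have : m = 1 := by exact_mod_cast hm.symm
  exact hodd.2 (this ▸ odd_one)

/-- The base of the compact roots contained in the positive system of `Φ` arises from `Φ` by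
replacing `ν` by the lowest of the roots in which `ν` has coefficient `2`. -/
theorem eq_insert {f : V →ₗ[ℂ] ℂ} (hf : IsCoord Φ ν f) (hΦk : IsSimpleSystem (Δ \ Δn) Φk)
    (hsub : Φk ⊆ AddSubmonoid.closure Φ) {ε : V}
    (hε : IsLowest (Φ \ {ν}) {α | α ∈ Δ ∧ f α = 2} ε) : Φk = insert ε (Φ \ {ν}) := by
  have hk := hn.isRootSet_compact hΔ
  have hcl : AddSubmonoid.closure Φk ≤ AddSubmonoid.closure Φ := (AddSubmonoid.closure_le).2 hsub
  have hmono : AddSubmonoid.closure (Φ \ {ν}) ≤ AddSubmonoid.closure Φ :=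
    AddSubmonoid.closure_mono Set.sdiff_subset
  have hposk : ∀ α ∈ Δ \ Δn, α ∈ AddSubmonoid.closure Φ → α ∈ AddSubmonoid.closure Φk := by
    intro α hα hpos
    refine (hΦk.mem_or_neg_mem α hα).resolve_right fun h' => ?_
    exact hΔ.ne_zero hα.1 (h.simple.linearIndependent.eq_zero_of_mem_of_neg_mem hpos (hcl h'))
  have hεn : ε ∉ Δn := by
    intro h'
    rcases h.coord_noncompact hΔ hn hf h' with h' | h' <;> rw [hε.1.2] at h' <;> norm_num at h'
  have hεpos : ε ∈ AddSubmonoid.closure Φ :=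
    h.simple.mem_closure_of_coord_pos hε.1.1 hf.exists_nat (n := 2) (by norm_num)
      (by simpa using hε.1.2)
  have hsupp : insert ε (Φ \ {ν}) ⊆ Φk := by
    refine Set.insert_subset ?_ fun ψ hψ => ?_
    · by_contra hns
      obtain ⟨χ, hχ, hmem, hpos⟩ := hk.exists_sub_simple_mem hΦk ⟨hε.1.1, hεn⟩
        (hposk _ ⟨hε.1.1, hεn⟩ hεpos) hns
      have hχ' := hΦk.subset hχ
      have hadd : f (ε - χ) + f χ = 2 := by rw [← map_add, sub_add_cancel, hε.1.2]
      -- One of the two summands of `ε` would be a root below `ε`.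
      have key : ∀ a b, a ∈ Δ → f a = 2 → b ∈ Δ → b ∈ AddSubmonoid.closure Φ → ε = a + b →
          False := by
        intro a b ha hfa hb hbpos hab
        have h1 := hmono (hε.2 a ⟨ha, hfa⟩)
        rw [hab, sub_add_cancel_left] at h1
        exact hΔ.ne_zero hb (h.simple.linearIndependent.eq_zero_of_mem_of_neg_mem hbpos h1)
      rcases h.even_of_compact hΔ hn hf hχ' (hsub hχ) with h1 | h1
      · refine key (ε - χ) χ hmem.1 ?_ hχ'.1 (hsub hχ) (by simp)
        rwa [h1, add_zero] at hadd
      · exact key χ (ε - χ) hχ'.1 h1 hmem.1 (hcl hpos) (by simp)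
    · by_contra hns
      have hψk : ψ ∈ Δ \ Δn := ⟨h.simple.subset hψ.1, h.notMem_noncompact hψ⟩
      obtain ⟨χ, hχ, hmem, hpos⟩ := hk.exists_sub_simple_mem hΦk hψk
        (hposk ψ hψk (AddSubmonoid.subset_closure hψ.1)) hns
      have := hΔ.simpleRoots_eq h.simple
      rw [← this] at hψ
      exact hψ.1.2 (ψ - χ) ⟨hmem.1, hcl hpos⟩ χ ⟨(hΦk.subset hχ).1, hsub hχ⟩ (by simp)
  refine Set.Subset.antisymm (fun χ hχ => ?_) hsupp
  by_contra hns
  have hχk := hΦk.subset hχ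
  have hmem : χ ∈ AddSubmonoid.closure (insert ε (Φ \ {ν})) := by
    have hle : AddSubmonoid.closure (Φ \ {ν}) ≤ AddSubmonoid.closure (insert ε (Φ \ {ν})) :=
      AddSubmonoid.closure_mono (Set.subset_insert _ _)
    rcases h.even_of_compact hΔ hn hf hχk (hsub hχ) with h1 | h1
    · exact hle (hf.mem_closure_of_eq_zero (hsub hχ) h1)
    · have := add_mem (hle (hε.2 χ ⟨hχk.1, h1⟩)) (AddSubmonoid.subset_closure
        (Set.mem_insert ε (Φ \ {ν})))
      simpa using this
  obtain ⟨g, hg⟩ := hΦk.exists_isCoord hχ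
  have : g χ = 0 := eq_zero_of_mem_closure (fun ψ hψ => hg.2 ψ ⟨hsupp hψ, fun h' => hns (h' ▸ hψ)⟩)
    (mem_addSubgroupClosure hmem)
  rw [hg.1] at this
  exact one_ne_zero this

end IsGradedBase

end GradedBases

/-! ### The root replacing the noncompact simple root -/

section NewBases

variable {V : Type*} [AddCommGroup V] [Module ℂ V] {Φ Ψ Δ Δn Φk : Set V} {B : V →+ V →+ ℝ}
  {ν δ : V}

theorem isCosetClosed_coord {φ : V} {f : V →ₗ[ℂ] ℂ} (hf : IsCoord Φ φ f) (z : ℂ) :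
    IsCosetClosed Δ (Φ \ {φ}) {α | α ∈ Δ ∧ f α = z} := by
  refine ⟨fun _ h => h.1, fun β hβ γ hγ hmem => ⟨hγ, ?_⟩⟩
  have := hf.eq_zero hmem
  rw [map_sub, sub_eq_zero] at this
  rw [this, hβ.2]

namespace IsGradedBase

variable (h : IsGradedBase Δ Δn Φ ν δ) (hΔ : IsRootSet Δ B) (hn : IsNoncompactPart Δ Δn)
include h

theorem isLowest_one {f : V →ₗ[ℂ] ℂ} (hf : IsCoord Φ ν f) :
    IsLowest (Φ \ {ν}) {α | α ∈ Δ ∧ f α = 1} ν := by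
  refine ⟨⟨h.simple.subset h.mem, hf.1⟩, fun β hβ => ?_⟩
  have := hf.sub_nsmul_mem (n := 1) (h.simple.mem_closure_of_coord_pos hβ.1 hf.exists_nat (n := 1)
    one_pos (by simpa using hβ.2)) (by simpa using hβ.2)
  simpa using this

theorem isHighest_two {f : V →ₗ[ℂ] ℂ} (hf : IsCoord Φ ν f) :
    IsHighest (Φ \ {ν}) {α | α ∈ Δ ∧ f α = 2} δ := by
  have hfδ : f δ = 2 := by simpa using h.coeff.eq_coord hf.1 hf.2
  exact ⟨⟨h.highest.1, hfδ⟩, fun β hβ =>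
    hf.mem_closure_of_eq_zero (h.highest.2 β hβ.1) (by rw [map_sub, hfδ, hβ.2, sub_self])⟩

include hΔ in
/-- A root system with a highest root is irreducible: if all roots lie in one of two orthogonal
lattices, then the lattice containing the highest root contains all simple roots, since these have
positive coefficients in the highest root. -/
theorem simple_subset_of_orthogonal {U U' : AddSubgroup V} (hU : ∀ x ∈ U, ∀ y ∈ U', B x y = 0)
    (hUU : ∀ α ∈ Δ, α ∈ U ∨ α ∈ U') (hδ : δ ∈ U) : ∀ ψ ∈ Φ, ψ ∈ U := by
  have hδpos : δ ∈ AddSubmonoid.closure Φ := by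
    have h1 := h.highest.2 (-δ) (hΔ.neg_mem δ h.highest.1)
    refine (h.simple.mem_or_neg_mem δ h.highest.1).resolve_right fun h2 => ?_
    have h3 : δ ∈ AddSubmonoid.closure Φ := by
      simpa using add_mem h1 h2
    exact hΔ.ne_zero h.highest.1 (h.simple.linearIndependent.eq_zero_of_mem_of_neg_mem h3 h2)
  have hdec : ∀ x ∈ AddSubmonoid.closure Φ, ∃ a ∈ AddSubmonoid.closure {ψ | ψ ∈ Φ ∧ ψ ∈ U},
      ∃ b ∈ AddSubmonoid.closure {ψ | ψ ∈ Φ ∧ ψ ∈ U'}, x = a + b := by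
    intro x hx
    induction hx using AddSubmonoid.closure_induction with
    | mem x hx =>
      rcases hUU x (h.simple.subset hx) with h' | h'
      · exact ⟨x, AddSubmonoid.subset_closure ⟨hx, h'⟩, 0, zero_mem _, by simp⟩
      · exact ⟨0, zero_mem _, x, AddSubmonoid.subset_closure ⟨hx, h'⟩, by simp⟩
    | zero => exact ⟨0, zero_mem _, 0, zero_mem _, by simp⟩
    | add x y _ _ hx hy =>
      obtain ⟨a, ha, b, hb, rfl⟩ := hx
      obtain ⟨c, hc, d, hd, rfl⟩ := hy
      exact ⟨a + c, add_mem ha hc, b + d, add_mem hb hd, by abel⟩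
  obtain ⟨a, ha, b, hb, hab⟩ := hdec δ hδpos
  have haU : a ∈ U := (AddSubmonoid.closure_le (S := U.toAddSubmonoid)).2 (fun ψ hψ => hψ.2) ha
  have hbU' : b ∈ U' := (AddSubmonoid.closure_le (S := U'.toAddSubmonoid)).2 (fun ψ hψ => hψ.2) hb
  have hbU : b ∈ U := by
    have := sub_mem hδ haU
    rwa [hab, add_sub_cancel_left] at this
  have hb0 : b = 0 := by
    by_contra hne
    have hbΔ : b ∈ AddSubgroup.closure Δ := mem_addSubgroupClosure
      (AddSubmonoid.closure_mono (fun ψ hψ => h.simple.subset hψ.1) hb)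
    have := hΔ.pos b hbΔ hne
    rw [hU b hbU b hbU'] at this
    exact lt_irrefl _ this
  rw [hb0, add_zero] at hab
  intro ψ hψ
  by_contra hψU
  obtain ⟨g, hg⟩ := h.simple.exists_isCoord hψ
  have hgδ : g δ = 0 := by
    rw [hab]
    exact eq_zero_of_mem_closure (fun χ hχ => hg.2 χ ⟨hχ.1, fun he => hψU (he ▸ hχ.2)⟩)
      (mem_addSubgroupClosure ha)
  obtain ⟨n, hn⟩ := exists_nat_of_mem_closure hg.exists_nat (h.highest.2 ψ (h.simple.subset hψ))
  rw [map_sub, hgδ, hg.1] at hn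
  have : (n : ℂ) + 1 = 0 := by rw [← hn]; ring
  have : n + 1 = 0 := by exact_mod_cast this
  omega

include hΔ hn

/-- No root is orthogonal to all noncompact roots. Indeed a compact root that is not orthogonal to a
noncompact root lies in the lattice of noncompact roots, so this lattice and its orthogonal
complement contain all roots, and the root system is irreducible. -/
theorem exists_noncompact_form_ne_zero {α : V} (hα : α ∈ Δ) : ∃ β ∈ Δn, B α β ≠ 0 := by
  by_contra! horth
  let U := AddSubgroup.closure Δn
  let U' : AddSubgroup V :=
    { carrier := {x | ∀ β ∈ Δn, B x β = 0}
      zero_mem' := fun β _ => by simp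
      add_mem' := fun {x y} hx hy β hβ => by
        rw [map_add, AddMonoidHom.add_apply, hx β hβ, hy β hβ, add_zero]
      neg_mem' := fun {x} hx β hβ => by rw [map_neg, AddMonoidHom.neg_apply, hx β hβ, neg_zero] }
  have hU' : ∀ x ∈ U', ∀ y ∈ U, B x y = 0 := fun x hx y hy => form_eq_zero_of_mem_closure hx hy
  have hU : ∀ x ∈ U, ∀ y ∈ U', B x y = 0 := fun x hx y hy => by
    rw [hΔ.form_comm]; exact hU' y hy x hx
  have hUU : ∀ γ ∈ Δ, γ ∈ U ∨ γ ∈ U' := by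
    intro γ hγ
    by_contra! hcon
    have h1 : ¬∀ β ∈ Δn, B γ β = 0 := hcon.2
    push Not at h1
    obtain ⟨β, hβ, hB⟩ := h1
    have hγn : γ ∉ Δn := fun h' => hcon.1 (AddSubgroup.subset_closure h')
    have hU1 : β ∈ U := AddSubgroup.subset_closure hβ
    rcases lt_or_gt_of_ne hB with hB | hB
    · have hmem := hΔ.add_mem_of_form_neg hγ (hn.subset hβ)
        (fun he => hγn (he ▸ hn.neg_mem β hβ)) hB
      have h2 : γ + β ∈ U := AddSubgroup.subset_closure
        ((hn.add_mem_iff γ hγ β (hn.subset hβ) hmem).2 (by simp [hγn, hβ]))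
      exact hcon.1 (by simpa using sub_mem h2 hU1)
    · have hmem := hΔ.sub_mem γ hγ β (hn.subset hβ) (fun he => hγn (he ▸ hβ)) hB
      rw [sub_eq_add_neg] at hmem
      have h2 : γ + -β ∈ U := AddSubgroup.subset_closure
        ((hn.add_mem_iff γ hγ (-β) (hΔ.neg_mem β (hn.subset hβ)) hmem).2
          (by simp [hγn, hn.neg_mem β hβ]))
      exact hcon.1 (by simpa using add_mem h2 hU1)
  rcases hUU δ h.highest.1 with hδ | hδ
  · have h1 := h.simple_subset_of_orthogonal hΔ hU hUU hδ
    have h2 : α ∈ U := (AddSubgroup.closure_le U).2 h1 (h.simple.mem_intClosure hα)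
    have h3 := hΔ.form_self_pos hα
    rw [hU' α horth α h2] at h3
    exact lt_irrefl _ h3
  · have h1 := h.simple_subset_of_orthogonal hΔ hU' (fun γ hγ => (hUU γ hγ).symm) hδ ν h.mem
    have h3 := hΔ.form_self_pos (h.simple.subset h.mem)
    rw [h1 ν h.noncompact] at h3
    exact lt_irrefl _ h3

variable {w : V ≃ₗ[ℂ] V} (hw : IsOpposition (Φ \ {ν}) w) (hw' : PreservesCosets Δ (Φ \ {ν}) w)
  (hΦk : IsSimpleSystem (Δ \ Δn) Φk) (hsub : Φk ⊆ AddSubmonoid.closure Φ)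
include hw hw' hΦk hsub

/-- The base of the compact roots arises from `Φ` by replacing `ν` by the image of the highest root
under the longest element. -/
theorem eq_insert_apply : Φk = insert (w δ) (Φ \ {ν}) := by
  obtain ⟨f, hf⟩ := h.simple.exists_isCoord h.mem
  exact h.eq_insert hΔ hn hf hΦk hsub
    (hw.isLowest hw' (isCosetClosed_coord hf 2) (h.isHighest_two hf))

/-- The image `λ` of `ν` under the longest element is the highest weight of the space spanned by
the noncompact root spaces. This rests on `λ + ν ≥ ε`, where `ε` is the lowest root in which `ν`
has coefficient `2`: as `ε` is not simple, `ε - ν` is a root. -/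
theorem sub_mem_closure_compact {β : V} (hβ : β ∈ Δn) :
    w ν - β ∈ AddSubmonoid.closure Φk := by
  obtain ⟨f, hf⟩ := h.simple.exists_isCoord h.mem
  have hins := h.eq_insert_apply hΔ hn hw hw' hΦk hsub
  have hmono : AddSubmonoid.closure (Φ \ {ν}) ≤ AddSubmonoid.closure Φk :=
    AddSubmonoid.closure_mono (hins ▸ Set.subset_insert _ _)
  have hε := hw.isLowest hw' (isCosetClosed_coord hf 2) (h.isHighest_two hf)
  have hlam := hw.isHighest hw' (isCosetClosed_coord hf 1) (h.isLowest_one hf)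
  have hεk : w δ ∈ AddSubmonoid.closure Φk :=
    AddSubmonoid.subset_closure (hins ▸ Set.mem_insert _ _)
  rcases h.coord_noncompact hΔ hn hf hβ with h1 | h1
  · exact hmono (hlam.2 β ⟨hn.subset hβ, h1⟩)
  · have h2 : -β - ν ∈ AddSubmonoid.closure (Φ \ {ν}) :=
      (h.isLowest_one hf).2 (-β) ⟨hΔ.neg_mem β (hn.subset hβ), by simp [h1]⟩
    have hεpos : w δ ∈ AddSubmonoid.closure Φ :=
      h.simple.mem_closure_of_coord_pos hε.1.1 hf.exists_nat (n := 2) (by norm_num)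
        (by simpa using hε.1.2)
    have hns : w δ ∉ Φ := by
      intro hmem
      by_cases he : w δ = ν
      · have := hε.1.2
        rw [he, hf.1] at this
        norm_num at this
      · have := hε.1.2
        rw [hf.2 _ ⟨hmem, he⟩] at this
        norm_num at this
    obtain ⟨ψ, hψ, hmem, hpos⟩ := hΔ.exists_sub_simple_mem h.simple hε.1.1 hεpos hns
    have hψν : ψ = ν := by
      by_contra hne
      have h3 := hε.2 (w δ - ψ) ⟨hmem, by
        rw [map_sub, hε.1.2, hf.2 ψ ⟨hψ, hne⟩, sub_zero]⟩
      rw [sub_sub_cancel_left] at h3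
      exact hΔ.ne_zero (h.simple.subset hψ) (h.simple.linearIndependent.eq_zero_of_mem_of_neg_mem
        (AddSubmonoid.subset_closure hψ) (AddSubmonoid.closure_mono Set.sdiff_subset h3))
    subst hψν
    have h3 := hlam.2 (w δ - ψ) ⟨hmem, by rw [map_sub, hε.1.2, hf.1]; norm_num⟩
    have h4 := add_mem (add_mem (hmono h3) (hmono h2)) hεk
    convert h4 using 1
    abel

/-- In the base of the compact roots, the coefficient at `φ = -w φ'` of the highest weight `w ν`
is half the coefficient of `φ'` in the highest root. -/
theorem two_mul_coord {φ φ' : V} (hφ' : φ' ∈ Φ \ {ν}) (hφ : w φ' = -φ)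
    {c : V →ₗ[ℂ] ℂ} (hc : IsCoord Φk φ c) {n : ℤ} (hδ : HasCoeff Φ φ' δ n) :
    2 * c (w ν) = n := by
  obtain ⟨f, hf⟩ := h.simple.exists_isCoord h.mem
  obtain ⟨g, hg⟩ := h.simple.exists_isCoord hφ'.1
  have hins := h.eq_insert_apply hΔ hn hw hw' hΦk hsub
  have hε := hw.isLowest hw' (isCosetClosed_coord hf 2) (h.isHighest_two hf)
  have hφ0 : φ ∈ Φ \ {ν} := by
    have := hw.neg_mem φ' hφ'
    rwa [hφ, neg_neg] at this
  have hcε : c (w δ) = 0 := by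
    refine hc.2 _ ⟨hins ▸ Set.mem_insert _ _, fun he => ?_⟩
    have h1 := hε.1.2
    rw [Set.mem_singleton_iff.1 he, hf.2 φ hφ0] at h1
    norm_num at h1
  have hy := hf.sub_zsmul_mem h.coeff.mem_closure (n := 2) (by
    simpa using h.coeff.eq_coord hf.1 hf.2)
  have h1 : (c ∘ₗ w.toLinearMap) (δ - (2 : ℤ) • ν) = -g (δ - (2 : ℤ) • ν) := by
    refine eqOn_closure (g := -g) (fun ψ hψ => ?_) hy
    change c (w ψ) = -g ψ
    by_cases he : ψ = φ'
    · rw [he, hφ, map_neg, hc.1, hg.1]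
    · have h2 := hc.2 (-(w ψ)) ⟨hins ▸ Set.mem_insert_of_mem _ (hw.neg_mem ψ hψ), fun h3 => he ?_⟩
      · rw [map_neg, neg_eq_zero] at h2
        rw [h2, hg.2 ψ ⟨hψ.1, he⟩, neg_zero]
      · refine w.injective ?_
        rw [hφ, ← Set.mem_singleton_iff.1 h3, neg_neg]
  have hgν : g ν = 0 := hg.2 ν ⟨h.mem, fun he => hφ'.2 (Set.mem_singleton_iff.1 he).symm⟩
  have hgδ : g δ = n := hδ.eq_coord hg.1 hg.2
  simp only [LinearMap.comp_apply, LinearEquiv.coe_coe, map_sub, map_zsmul, hcε, hgν, hgδ] at h1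
  simp only [zsmul_eq_mul, Int.cast_ofNat, zero_sub, mul_zero, sub_zero, neg_inj] at h1
  exact h1

end IsGradedBase

/-- Two distinct simple roots are at an obtuse angle. -/
theorem IsRootSet.form_simple_nonpos (hΔ : IsRootSet Δ B) (hΦ : IsSimpleSystem Δ Φ) {ψ χ : V}
    (hψ : ψ ∈ Φ) (hχ : χ ∈ Φ) (hne : ψ ≠ χ) : B ψ χ ≤ 0 := by
  by_contra! hB
  have hmem := hΔ.sub_mem ψ (hΦ.subset hψ) χ (hΦ.subset hχ) hne hB
  have key : ∀ a ∈ Φ, ∀ b ∈ Φ, a ≠ b → a - b ∉ AddSubmonoid.closure Φ := by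
    intro a ha b hb hab hcl
    obtain ⟨f, hf⟩ := hΦ.exists_isCoord hb
    obtain ⟨n, hn⟩ := exists_nat_of_mem_closure hf.exists_nat hcl
    rw [map_sub, hf.1, hf.2 a ⟨ha, hab⟩] at hn
    have : (n : ℂ) + 1 = 0 := by rw [← hn]; ring
    have : n + 1 = 0 := by exact_mod_cast this
    omega
  rcases hΦ.mem_or_neg_mem _ hmem with h' | h'
  · exact key ψ hψ χ hχ hne h'
  · exact key χ hχ ψ hψ hne.symm (by simpa using h')

/-- If twice a vector `η` is an integral combination of simple roots, one of whose coefficients is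
positive, then `η` has a positive product with some simple root. Otherwise the part `a` of `2 η`
with positive coefficients would satisfy `B a a ≤ 0`. -/
theorem IsRootSet.exists_form_pos (hΔ : IsRootSet Δ B) (hΦ : IsSimpleSystem Δ Φ) {φ η : V}
    {c : V →ₗ[ℂ] ℂ} (hc : IsCoord Φ φ c) (hη : 2 • η ∈ AddSubgroup.closure Φ)
    {n : ℤ} (hn : 0 < n) (hcη : c (2 • η) = n) : ∃ ψ ∈ Φ, 0 < B ψ η := by
  classical
  by_contra! hB
  obtain ⟨d, hd, hsum⟩ := exists_finsupp_of_mem_closure hη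
  have hcoef : ∀ e : V → ℕ,
      c (∑ ψ ∈ d.support, e ψ • ψ) = if φ ∈ d.support then (e φ : ℂ) else 0 := by
    intro e
    split_ifs with hmem
    · rw [map_sum, Finset.sum_eq_single_of_mem φ hmem]
      · simp [hc.1]
      · intro ψ hψ hne
        rw [map_nsmul, hc.2 ψ ⟨hd hψ, hne⟩, smul_zero]
    · rw [map_sum]
      refine Finset.sum_eq_zero fun ψ hψ => ?_
      rw [map_nsmul, hc.2 ψ ⟨hd hψ, fun he => hmem (Set.mem_singleton_iff.1 he ▸ hψ)⟩, smul_zero]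
  set a : V := ∑ ψ ∈ d.support, (d ψ).toNat • ψ with ha
  set b : V := ∑ ψ ∈ d.support, (-d ψ).toNat • ψ with hb
  have hab : a = b + 2 • η := by
    rw [hsum, Finsupp.sum, ha, hb, ← Finset.sum_add_distrib]
    refine Finset.sum_congr rfl fun ψ _ => ?_
    rw [← natCast_zsmul, ← natCast_zsmul, ← add_zsmul]
    congr 1
    omega
  have hBab : B a b ≤ 0 := by
    rw [hb, map_sum]
    refine Finset.sum_nonpos fun χ hχ => ?_
    rw [ha, map_sum, AddMonoidHom.finsetSum_apply]
    refine Finset.sum_nonpos fun ψ hψ => ?_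
    rw [map_nsmul, map_nsmul, AddMonoidHom.nsmul_apply]
    by_cases he : ψ = χ
    · subst he
      obtain h0 | h0 : (d ψ).toNat = 0 ∨ (-d ψ).toNat = 0 := by omega
      · simp [h0]
      · simp [h0]
    · have := hΔ.form_simple_nonpos hΦ (hd hψ) (hd hχ) he
      simp only [nsmul_eq_mul]
      exact mul_nonpos_of_nonneg_of_nonpos (Nat.cast_nonneg _)
        (mul_nonpos_of_nonneg_of_nonpos (Nat.cast_nonneg _) this)
  have hBaη : B a η ≤ 0 := by
    rw [ha, map_sum, AddMonoidHom.finsetSum_apply]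
    refine Finset.sum_nonpos fun ψ hψ => ?_
    rw [map_nsmul, AddMonoidHom.nsmul_apply, nsmul_eq_mul]
    exact mul_nonpos_of_nonneg_of_nonpos (Nat.cast_nonneg _) (hB ψ (hd hψ))
  have hcd : c (2 • η) = d φ := by
    refine HasCoeff.eq_coord (Φ := Φ) ⟨d, hd, hsum, rfl⟩ hc.1 hc.2
  have hdφ : d φ = n := by rw [hcη] at hcd; exact_mod_cast hcd.symm
  have ha0 : a ≠ 0 := by
    intro h0
    have := hcoef fun ψ => (d ψ).toNat
    rw [← ha, h0, map_zero, if_pos (Finsupp.mem_support_iff.2 (by omega))] at this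
    have : (d φ).toNat = 0 := by exact_mod_cast this.symm
    omega
  have haΔ : a ∈ AddSubgroup.closure Δ :=
    sum_mem fun ψ hψ => nsmul_mem (AddSubgroup.subset_closure (hΦ.subset (hd hψ))) _
  have hpos := hΔ.pos a haΔ ha0
  have : B a a = B a b + 2 * B a η := by
    have h1 := congrArg (B a) hab
    rw [map_add, map_nsmul, nsmul_eq_mul] at h1
    exact_mod_cast h1
  linarith

end NewBases

/-! ### Exchange of a compact simple root for a noncompact root -/

section Exchange

variable {V : Type*} [AddCommGroup V] [Module ℂ V] {Φ Ψ Δ Δn Φk : Set V} {B : V →+ V →+ ℝ}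
  {ν δ : V}

/-- The data from which a new Borel-de Siebenthal base is built by exchanging the compact simple
root `φ` for a noncompact root: `lam` is the highest noncompact root with respect to the base `Φk`
of the compact roots, and `φ` has coefficient `1/2` in it. -/
structure IsExchangeable (Δ Δn Φk : Set V) (φ lam : V) (c : V →ₗ[ℂ] ℂ) : Prop where
  simple : IsSimpleSystem (Δ \ Δn) Φk
  mem : φ ∈ Φk
  coord : IsCoord Φk φ c
  lam_mem : lam ∈ Δn
  lam_sub_mem : ∀ β ∈ Δn, lam - β ∈ AddSubmonoid.closure Φk
  coord_lam : c lam = 1 / 2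

namespace IsExchangeable

variable {φ lam : V} {c : V →ₗ[ℂ] ℂ} (h : IsExchangeable Δ Δn Φk φ lam c)
  (hΔ : IsRootSet Δ B) (hn : IsNoncompactPart Δ Δn)
include h

theorem coord_compact {α : V} (hα : α ∈ Δ \ Δn) : ∃ n : ℤ, c α = n :=
  exists_int_of_mem_closure h.coord.exists_int (h.simple.mem_intClosure hα)

include hn in
/-- The coefficient `c` lies between its values on the lowest noncompact root `-lam` and the
highest one `lam`, and differs from the latter by an integer. -/
theorem coord_noncompact {β : V} (hβ : β ∈ Δn) : c β = 1 / 2 ∨ c β = -(1 / 2) := by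
  obtain ⟨m, hm⟩ := exists_nat_of_mem_closure h.coord.exists_nat (h.lam_sub_mem β hβ)
  obtain ⟨k, hk⟩ := exists_nat_of_mem_closure h.coord.exists_nat (h.lam_sub_mem _ (hn.neg_mem β hβ))
  rw [map_sub, h.coord_lam] at hm hk
  rw [map_neg] at hk
  have : (m : ℂ) + k = 1 := by rw [← hm, ← hk]; ring
  have : m + k = 1 := by exact_mod_cast this
  obtain h0 | h0 : m = 0 ∨ m = 1 := by omega
  · rw [h0] at hm
    left
    linear_combination -hm
  · rw [h0] at hm
    right
    push_cast at hm
    linear_combination -hm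

theorem noncompact_of_coord {α : V} (hα : α ∈ Δ) (hc : c α = 1 / 2) : α ∈ Δn := by
  by_contra hαn
  obtain ⟨n, hn⟩ := h.coord_compact ⟨hα, hαn⟩
  rw [hc] at hn
  have : (1 : ℂ) = 2 * n := by rw [← hn]; norm_num
  have : (1 : ℤ) = 2 * n := by exact_mod_cast this
  omega

include hn in
theorem compact_of_coord {α : V} (hα : α ∈ Δ) {n : ℤ} (hc : c α = n) : α ∈ Δ \ Δn := by
  refine ⟨hα, fun hαn => ?_⟩
  rcases h.coord_noncompact hn hαn with h' | h'
  · have : (1 : ℂ) = 2 * n := by rw [← hc, h']; norm_num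
    have : (1 : ℤ) = 2 * n := by exact_mod_cast this
    omega
  · have : (-1 : ℂ) = 2 * n := by rw [← hc, h']; norm_num
    have : (-1 : ℤ) = 2 * n := by exact_mod_cast this
    omega

include hn in
theorem isCosetClosed : IsCosetClosed Δ (Φk \ {φ}) {β | β ∈ Δn ∧ c β = 1 / 2} := by
  refine ⟨fun β hβ => hn.subset hβ.1, fun β hβ γ hγ hmem => ?_⟩
  have := (isCosetClosed_coord (Δ := Δ) h.coord (1 / 2)).2 β ⟨hn.subset hβ.1, hβ.2⟩ γ hγ hmem
  exact ⟨h.noncompact_of_coord hγ this.2, this.2⟩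

theorem isHighest : IsHighest (Φk \ {φ}) {β | β ∈ Δn ∧ c β = 1 / 2} lam :=
  ⟨⟨h.lam_mem, h.coord_lam⟩, fun β hβ =>
    h.coord.mem_closure_of_eq_zero (h.lam_sub_mem β hβ.1)
      (by rw [map_sub, h.coord_lam, hβ.2, sub_self])⟩

include hn in
theorem isSimpleSystem_diff :
    IsSimpleSystem {α | α ∈ Δ ∧ α ∈ AddSubgroup.closure (Φk \ {φ})} (Φk \ {φ}) := by
  refine h.simple.restrict Set.sdiff_subset (fun α hα => ?_) (fun _ hψ => ?_) fun α hα => ?_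
  · exact h.compact_of_coord hn hα.1 (n := 0) (by simpa using h.coord.eq_zero hα.2)
  · exact ⟨(h.simple.subset hψ.1).1, AddSubgroup.subset_closure hψ⟩
  · exact addSubgroupClosure_le_span α hα.2

include hΔ hn in
theorem exists_isOpposition (hrefl : ∀ α ∈ Δ, ∃ s, IsRootReflection Δ α s) :
    ∃ w, IsOpposition (Φk \ {φ}) w ∧ PreservesCosets Δ (Φk \ {φ}) w :=
  hΔ.exists_isOpposition hrefl (h.isSimpleSystem_diff hn)

include hΔ hn in
theorem exists_isLowest (hrefl : ∀ α ∈ Δ, ∃ s, IsRootReflection Δ α s) :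
    ∃ η, IsLowest (Φk \ {φ}) {β | β ∈ Δn ∧ c β = 1 / 2} η := by
  obtain ⟨w, hw, hw'⟩ := h.exists_isOpposition hΔ hn hrefl
  exact ⟨_, hw.isLowest hw' (h.isCosetClosed hn) h.isHighest⟩

variable {η : V} (hη : IsLowest (Φk \ {φ}) {β | β ∈ Δn ∧ c β = 1 / 2} η)
include hΔ hn hη

/-- The lowest weight `η` cannot be at an obtuse angle to all the compact simple roots, and it is so
to those different from `φ`. Hence its product with `φ` is positive, and `φ - η` is a root. -/
theorem sub_lowest_mem : φ - η ∈ Δ ∧ c (φ - η) = 1 / 2 := by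
  have hηΔ := hn.subset hη.1.1
  have hφk := h.simple.subset h.mem
  have hψ0 : ∀ ψ ∈ Φk \ {φ}, B ψ η ≤ 0 := by
    intro ψ hψ
    by_contra! hB
    rw [hΔ.form_comm] at hB
    have hψk := h.simple.subset hψ.1
    have hmem := hΔ.sub_mem η hηΔ ψ hψk.1 (fun he => hψk.2 (he ▸ hη.1.1)) hB
    have hmem' := (h.isCosetClosed hn).2 η hη.1 (η - ψ) hmem (by
      rw [sub_sub_cancel_left]
      exact neg_mem (AddSubgroup.subset_closure hψ))
    have h1 := hη.2 _ hmem'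
    rw [sub_sub_cancel_left] at h1
    exact hΔ.ne_zero hψk.1 (h.simple.linearIndependent.eq_zero_of_mem_of_neg_mem
      (AddSubmonoid.subset_closure hψ.1) (AddSubmonoid.closure_mono Set.sdiff_subset h1))
  have hlat : 2 • η ∈ AddSubgroup.closure Φk := by
    have h1 := mem_addSubgroupClosure (h.lam_sub_mem η hη.1.1)
    have h2 := mem_addSubgroupClosure (h.lam_sub_mem _ (hn.neg_mem η hη.1.1))
    have := sub_mem h2 h1
    convert this using 1
    rw [two_nsmul]
    abel
  obtain ⟨ψ, hψ, hB⟩ := (hn.isRootSet_compact hΔ).exists_form_pos h.simple h.coord hlat one_pos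
    (by rw [map_nsmul, hη.1.2]; norm_num)
  have hψφ : ψ = φ := by
    by_contra hne
    exact absurd (hψ0 ψ ⟨hψ, hne⟩) (not_le.2 hB)
  subst hψφ
  refine ⟨hΔ.sub_mem ψ hφk.1 η hηΔ (fun he => hφk.2 (he ▸ hη.1.1)) hB, ?_⟩
  rw [map_sub, h.coord.1, hη.1.2]
  norm_num

theorem simple_mem_closure : φ ∈ AddSubmonoid.closure (insert η (Φk \ {φ})) := by
  have hs := h.sub_lowest_mem hΔ hn hη
  have h1 := hη.2 (φ - η) ⟨h.noncompact_of_coord hs.1 hs.2, hs.2⟩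
  have hη' : η ∈ AddSubmonoid.closure (insert η (Φk \ {φ})) :=
    AddSubmonoid.subset_closure (Set.mem_insert _ _)
  have h2 := add_mem (add_mem (AddSubmonoid.closure_mono (Set.subset_insert _ _) h1) hη') hη'
  simpa using h2

theorem closure_le_closure_insert :
    AddSubmonoid.closure Φk ≤ AddSubmonoid.closure (insert η (Φk \ {φ})) := by
  refine AddSubmonoid.closure_le.2 fun ψ hψ => ?_
  by_cases he : ψ = φ
  · rw [SetLike.mem_coe, he]
    exact h.simple_mem_closure hΔ hn hη
  · exact AddSubmonoid.subset_closure (Set.mem_insert_of_mem _ ⟨hψ, he⟩)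

theorem mem_closure_insert {β : V} (hβ : β ∈ Δn) (hc : c β = 1 / 2) :
    β ∈ AddSubmonoid.closure (insert η (Φk \ {φ})) := by
  have h1 := AddSubmonoid.closure_mono (Set.subset_insert η (Φk \ {φ})) (hη.2 β ⟨hβ, hc⟩)
  simpa using add_mem h1 (AddSubmonoid.subset_closure (Set.mem_insert η (Φk \ {φ})))

theorem isSimpleSystem_insert : IsSimpleSystem Δ (insert η (Φk \ {φ})) where
  subset := Set.insert_subset (hn.subset hη.1.1) fun ψ hψ => (h.simple.subset hψ.1).1
  linearIndependent := by
    refine LinearIndepOn.id_insert (h.simple.linearIndependent.mono Set.sdiff_subset) fun hmem => ?_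
    have : Submodule.span ℂ (Φk \ {φ}) ≤ LinearMap.ker c := Submodule.span_le.2 h.coord.2
    have h1 : c η = 0 := this hmem
    rw [hη.1.2] at h1
    norm_num at h1
  mem_or_neg_mem α hα := by
    by_cases hαn : α ∈ Δn
    · rcases h.coord_noncompact hn hαn with h' | h'
      · exact Or.inl (h.mem_closure_insert hΔ hn hη hαn h')
      · exact Or.inr
          (h.mem_closure_insert hΔ hn hη (hn.neg_mem α hαn) (by rw [map_neg, h', neg_neg]))
    · exact (h.simple.mem_or_neg_mem α ⟨hα, hαn⟩).imp
        (fun h' => h.closure_le_closure_insert hΔ hn hη h')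
        (fun h' => h.closure_le_closure_insert hΔ hn hη h')

theorem insert_diff : insert η (Φk \ {φ}) \ {η} = Φk \ {φ} := by
  refine Set.insert_sdiff_self_of_notMem fun hmem => ?_
  exact (h.simple.subset hmem.1).2 hη.1.1

theorem isCoord_insert : IsCoord (insert η (Φk \ {φ})) η ((2 : ℂ) • c) := by
  refine ⟨by simp [hη.1.2], fun ψ hψ => ?_⟩
  rw [h.insert_diff hΔ hn hη] at hψ
  simp [h.coord.2 ψ hψ]

/-- In a positive root, twice the coefficient `c` is at most `2`: a chain of positive roots cannot
pass the value `3`, since compact roots have even and noncompact roots small values. -/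
theorem coord_le {α : V} (hα : α ∈ Δ) (hpos : α ∈ AddSubmonoid.closure (insert η (Φk \ {φ}))) :
    ∃ n : ℕ, 2 * c α = n ∧ n ≤ 2 := by
  refine hΔ.positive_induction (h.isSimpleSystem_insert hΔ hn hη)
    (p := fun α => ∃ n : ℕ, 2 * c α = n ∧ n ≤ 2) ?_ ?_ hα hpos
  · rintro ψ (rfl | hψ)
    · exact ⟨1, by rw [hη.1.2]; norm_num, by norm_num⟩
    · exact ⟨0, by rw [h.coord.2 ψ hψ]; norm_num, by norm_num⟩
  · rintro α - - ψ hψ hadd ⟨n, hn', hle⟩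
    obtain ⟨m, hm, hm'⟩ : ∃ m : ℕ, 2 * c (α + ψ) = m ∧ m ≤ 3 := by
      rcases hψ with rfl | hψ
      · exact ⟨n + 1, by rw [map_add, mul_add, hn', hη.1.2]; push_cast; norm_num, by omega⟩
      · exact ⟨n, by rw [map_add, mul_add, hn', h.coord.2 ψ hψ]; norm_num, by omega⟩
    refine ⟨m, hm, ?_⟩
    by_contra hlt
    have hm3 : m = 3 := by omega
    rw [hm3] at hm
    by_cases hnc : α + ψ ∈ Δn
    · rcases h.coord_noncompact hn hnc with h' | h' <;> rw [h'] at hm <;> norm_num at hm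
    · obtain ⟨k, hk⟩ := h.coord_compact ⟨hadd, hnc⟩
      rw [hk] at hm
      have : 2 * k = 3 := by exact_mod_cast hm
      omega

/-- Exchanging `φ` for `η` gives a Borel-de Siebenthal base. Its highest root is the image of `φ`
under the longest element `w` for `Φk \ {φ}`: it lies above the roots with a coefficient `c`
different from `0` because `w φ - w η = w (φ - η)` is positive, and above the others because
none of them is orthogonal to all noncompact roots. -/
theorem isGradedBase_insert (hrefl : ∀ α ∈ Δ, ∃ s, IsRootReflection Δ α s)
    (hirr : ∀ α ∈ Δ, ∃ β ∈ Δn, B α β ≠ 0) :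
    ∃ δ', IsGradedBase Δ Δn (insert η (Φk \ {φ})) η δ' := by
  obtain ⟨w, hw, hw'⟩ := h.exists_isOpposition hΔ hn hrefl
  set Φ' := insert η (Φk \ {φ}) with hΦ'
  have hbase := h.isSimpleSystem_insert hΔ hn hη
  have hmono : AddSubmonoid.closure (Φk \ {φ}) ≤ AddSubmonoid.closure Φ' :=
    AddSubmonoid.closure_mono (Set.subset_insert _ _)
  have hlow2 : IsLowest (Φk \ {φ}) {α | α ∈ Δ ∧ c α = 1} φ := by
    refine ⟨⟨(h.simple.subset h.mem).1, h.coord.1⟩, fun α hα => ?_⟩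
    have hαk := h.compact_of_coord hn hα.1 (n := 1) (by simpa using hα.2)
    have := h.coord.sub_nsmul_mem (n := 1) (h.simple.mem_closure_of_coord_pos hαk
      h.coord.exists_nat (n := 1) one_pos (by simpa using hα.2)) (by simpa using hα.2)
    simpa using this
  have hhigh2 := hw.isHighest hw' (isCosetClosed_coord h.coord 1) hlow2
  have hhigh1 := hw.isHighest hw' (h.isCosetClosed hn) hη
  have hs := h.sub_lowest_mem hΔ hn hη
  have hws := hw'.apply_mem (h.isCosetClosed hn) ⟨h.noncompact_of_coord hs.1 hs.2, hs.2⟩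
  have h21 : w φ - w η ∈ AddSubmonoid.closure Φ' := by
    rw [← map_sub]
    exact h.mem_closure_insert hΔ hn hη hws.1 hws.2
  have hS : ∀ β ∈ Δn, c β = 1 / 2 → w φ - β ∈ AddSubmonoid.closure Φ' := by
    intro β hβ hc
    have := add_mem h21 (hmono (hhigh1.2 β ⟨hβ, hc⟩))
    rwa [sub_add_sub_cancel] at this
  have hpos : ∀ α ∈ Δ, α ∈ AddSubmonoid.closure Φ' → w φ - α ∈ AddSubmonoid.closure Φ' := by
    intro α hα hαpos
    by_cases hαn : α ∈ Δn
    · refine hS α hαn ((h.coord_noncompact hn hαn).resolve_right fun h' => ?_)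
      obtain ⟨n, h1, -⟩ := h.coord_le hΔ hn hη hα hαpos
      rw [h'] at h1
      have : (n : ℂ) + 1 = 0 := by rw [← h1]; norm_num
      have : n + 1 = 0 := by exact_mod_cast this
      omega
    · obtain ⟨n, h1, hle⟩ := h.coord_le hΔ hn hη hα hαpos
      obtain ⟨k, hk⟩ := h.coord_compact ⟨hα, hαn⟩
      have hkn : 2 * k = n := by rw [hk] at h1; exact_mod_cast h1
      obtain h0 | h0 : k = 0 ∨ k = 1 := by omega
      · have hα0 : α ∈ AddSubgroup.closure (Φk \ {φ}) :=
          h.coord.mem_intClosure_of_eq_zero (h.simple.mem_intClosure ⟨hα, hαn⟩) (by simp [hk, h0])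
        have hex : ∃ β ∈ Δn, c β = 1 / 2 ∧ B α β ≠ 0 := by
          obtain ⟨β, hβ, hB⟩ := hirr α hα
          rcases h.coord_noncompact hn hβ with h' | h'
          · exact ⟨β, hβ, h', hB⟩
          · exact ⟨-β, hn.neg_mem β hβ, by rw [map_neg, h', neg_neg], by simpa using hB⟩
        obtain ⟨β, hβ, hcβ, hB⟩ := hex
        rw [hΔ.form_comm] at hB
        have hβα : β ≠ α := fun he => hαn (he ▸ hβ)
        have hβα' : β ≠ -α := fun he => hαn (hn.neg_mem_iff.1 (he ▸ hβ))
        rcases lt_or_gt_of_ne hB with hB | hB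
        · have hmem := hΔ.add_mem_of_form_neg (hn.subset hβ) hα hβα' hB
          have hmem' := (h.isCosetClosed hn).2 β ⟨hβ, hcβ⟩ _ hmem (by simpa using hα0)
          have := add_mem (hS _ hmem'.1 hmem'.2) (h.mem_closure_insert hΔ hn hη hβ hcβ)
          convert this using 1
          abel
        · have hmem := hΔ.sub_mem β (hn.subset hβ) α hα hβα hB
          have hmem' := (h.isCosetClosed hn).2 β ⟨hβ, hcβ⟩ _ hmem (by simpa using hα0)
          have := add_mem (hS _ hβ hcβ) (h.mem_closure_insert hΔ hn hη hmem'.1 hmem'.2)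
          convert this using 1
          abel
      · exact hmono (hhigh2.2 α ⟨hα, by simp [hk, h0]⟩)
  have hδpos : w φ ∈ AddSubmonoid.closure Φ' := by
    have := add_mem (hS η hη.1.1 hη.1.2) (h.mem_closure_insert hΔ hn hη hη.1.1 hη.1.2)
    simpa using this
  refine ⟨w φ, hbase, ?_, ⟨hhigh2.1.1, fun α hα => ?_⟩, ?_⟩
  · ext ψ
    constructor
    · rintro ⟨rfl | hψ, hψn⟩
      · rfl
      · exact absurd hψn (h.simple.subset hψ.1).2
    · rintro rfl
      exact ⟨Set.mem_insert _ _, hη.1.1⟩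
  · rcases hbase.mem_or_neg_mem α hα with h' | h'
    · exact hpos α hα h'
    · rw [sub_eq_add_neg]
      exact add_mem hδpos h'
  · have h1 := (h.isCoord_insert hΔ hn hη).sub_zsmul_mem (mem_addSubgroupClosure hδpos) (n := 2)
      (by simp [hhigh2.1.2])
    have := hasCoeff_zsmul_add (Set.mem_insert η (Φk \ {φ})) h1 2
    simpa using this

end IsExchangeable

namespace IsGradedBase

variable {Φ' : Set V} {ν' δ' : V} {w : V ≃ₗ[ℂ] V}

theorem isExchangeable (h : IsGradedBase Δ Δn Φ ν δ) (hΔ : IsRootSet Δ B)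
    (hn : IsNoncompactPart Δ Δn) (hw : IsOpposition (Φ \ {ν}) w)
    (hw' : PreservesCosets Δ (Φ \ {ν}) w) (hΦk : IsSimpleSystem (Δ \ Δn) Φk)
    (hsub : Φk ⊆ AddSubmonoid.closure Φ) {φ φ' : V} (hφ' : φ' ∈ Φ \ {ν}) (hφ : w φ' = -φ)
    {c : V →ₗ[ℂ] ℂ} (hc : IsCoord Φk φ c) (hδ : HasCoeff Φ φ' δ 1) :
    IsExchangeable Δ Δn Φk φ (w ν) c where
  simple := hΦk
  mem := by
    have := hw.neg_mem φ' hφ'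
    rw [hφ, neg_neg] at this
    rw [h.eq_insert_apply hΔ hn hw hw' hΦk hsub]
    exact Set.mem_insert_of_mem _ this
  coord := hc
  lam_mem := by
    obtain ⟨f, hf⟩ := h.simple.exists_isCoord h.mem
    have := hw.isHighest hw' (isCosetClosed_coord hf 1) (h.isLowest_one hf)
    exact h.noncompact_of_coord hΔ hn hf this.1.1 this.1.2
  lam_sub_mem β hβ := h.sub_mem_closure_compact hΔ hn hw hw' hΦk hsub hβ
  coord_lam := by
    have := h.two_mul_coord hΔ hn hw hw' hΦk hsub hφ' hφ hc hδ
    push_cast at this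
    linear_combination this / 2

theorem isSimpleSystem_diff (h : IsGradedBase Δ Δn Φ ν δ) :
    IsSimpleSystem {α | α ∈ Δ ∧ α ∈ AddSubgroup.closure (Φ \ {ν})} (Φ \ {ν}) :=
  h.simple.restrict Set.sdiff_subset (fun _ hα => hα.1)
    (fun _ hψ => ⟨h.simple.subset hψ.1, AddSubgroup.subset_closure hψ⟩)
    (fun α hα => addSubgroupClosure_le_span α hα.2)

/-- Two Borel-de Siebenthal bases with the same compact elements coincide if some root involves both
noncompact simple roots with coefficient `2`: then each noncompact simple root has coefficient `1`
in the other base, and is the lowest root of this kind. -/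
theorem eq_of_diff_eq (h : IsGradedBase Δ Δn Φ ν δ) (h' : IsGradedBase Δ Δn Φ' ν' δ')
    (hdiff : Φ' \ {ν'} = Φ \ {ν}) {f f' : V →ₗ[ℂ] ℂ} (hf : IsCoord Φ ν f) (hf' : IsCoord Φ' ν' f')
    {ε : V} (hε : f ε = 2) (hε' : f' ε = 2) (hεΔ : ε ∈ Δ) : Φ' = Φ := by
  have hν' : f ν' = 1 := by
    have h1 := hf'.sub_zsmul_mem (h'.simple.mem_intClosure hεΔ) (n := 2) (by simpa using hε')
    rw [hdiff] at h1
    have h2 := hf.eq_zero h1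
    rw [map_sub, map_zsmul, hε, zsmul_eq_mul] at h2
    push_cast at h2
    linear_combination -h2 / 2
  have h1 := (h.isLowest_one hf).2 ν' ⟨h'.simple.subset h'.mem, hν'⟩
  have hν : f' ν = 1 := by
    have h2 := hf'.eq_zero (hdiff ▸ mem_addSubgroupClosure h1)
    rw [map_sub, hf'.1] at h2
    linear_combination -h2
  have h2 := (h'.isLowest_one hf').2 ν ⟨h.simple.subset h.mem, hν⟩
  rw [hdiff] at h2
  have h3 : ν' = ν := sub_eq_zero.1 ((h.simple.linearIndependent.mono
    Set.sdiff_subset).eq_zero_of_mem_of_neg_mem h1 (by simpa using h2))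
  rw [← Set.insert_sdiff_self_of_mem h'.mem, ← Set.insert_sdiff_self_of_mem h.mem, hdiff, h3]

/-- Every Borel-de Siebenthal base compatible with `Φk`, other than `Φ`, arises from an exchange. -/
theorem eq_or_exists_exchange (h : IsGradedBase Δ Δn Φ ν δ) (hΔ : IsRootSet Δ B)
    (hn : IsNoncompactPart Δ Δn) (hrefl : ∀ α ∈ Δ, ∃ s, IsRootReflection Δ α s)
    (hw : IsOpposition (Φ \ {ν}) w) (hw' : PreservesCosets Δ (Φ \ {ν}) w)
    (hΦk : IsSimpleSystem (Δ \ Δn) Φk) (hsub : Φk ⊆ AddSubmonoid.closure Φ)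
    (h' : IsGradedBase Δ Δn Φ' ν' δ') (hsub' : Φk ⊆ AddSubmonoid.closure Φ') :
    Φ' = Φ ∨ ∃ φ' ∈ Φ \ {ν}, HasCoeff Φ φ' δ 1 ∧ ∃ φ ∈ Φ \ {ν}, w φ' = -φ ∧
      Φ' = insert ν' (Φk \ {φ}) ∧ ∃ c, IsExchangeable Δ Δn Φk φ (w ν) c ∧
        IsLowest (Φk \ {φ}) {β | β ∈ Δn ∧ c β = 1 / 2} ν' := by
  obtain ⟨u, hu, hu'⟩ := hΔ.exists_isOpposition hrefl h'.isSimpleSystem_diff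
  obtain ⟨f, hf⟩ := h.simple.exists_isCoord h.mem
  obtain ⟨f', hf'⟩ := h'.simple.exists_isCoord h'.mem
  have hins := h.eq_insert_apply hΔ hn hw hw' hΦk hsub
  have hins' := h'.eq_insert_apply hΔ hn hu hu' hΦk hsub'
  have hε := hw.isLowest hw' (isCosetClosed_coord hf 2) (h.isHighest_two hf)
  have hε' := hu.isLowest hu' (isCosetClosed_coord hf' 2) (h'.isHighest_two hf')
  have hεn : w δ ∉ Φ \ {ν} := fun hmem => by
    have := hε.1.2
    rw [hf.2 _ hmem] at this
    norm_num at this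
  have hεn' : u δ' ∉ Φ' \ {ν'} := fun hmem => by
    have := hε'.1.2
    rw [hf'.2 _ hmem] at this
    norm_num at this
  have hdiff : Φk \ {w δ} = Φ \ {ν} := by rw [hins, Set.insert_sdiff_self_of_notMem hεn]
  have hdiff' : Φk \ {u δ'} = Φ' \ {ν'} := by rw [hins', Set.insert_sdiff_self_of_notMem hεn']
  by_cases he : u δ' = w δ
  · left
    rw [he] at hdiff' hε'
    exact h.eq_of_diff_eq h' (hdiff'.symm.trans hdiff) hf hf' hε.1.2 hε'.1.2 hε.1.1
  right
  set φ := u δ' with hφdef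
  have hφk : φ ∈ Φk := hins' ▸ Set.mem_insert _ _
  have hφ0 : φ ∈ Φ \ {ν} := hdiff ▸ ⟨hφk, he⟩
  obtain ⟨φ', hφ', hφφ'⟩ := hw.exists_eq φ hφ0
  obtain ⟨c, hc⟩ := hΦk.exists_isCoord hφk
  have h2 : f' φ = 2 := hε'.1.2
  -- Twice the coefficient of `φ` in the base `Φk` is the coefficient of `ν'` in the base `Φ'`.
  have hcν' : 2 * c ν' = 1 := by
    have h1 := hf'.sub_zsmul_mem (h'.simple.mem_intClosure (hΦk.subset hφk).1) (n := 2)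
      (by simpa using h2)
    rw [← hdiff'] at h1
    have h3 := hc.eq_zero h1
    rw [map_sub, map_zsmul, hc.1, zsmul_eq_mul] at h3
    push_cast at h3
    linear_combination -h3
  have hcf : ∀ α ∈ Δ, 2 * c α = f' α := by
    intro α hα
    have h1 := eqOn_closure (f := (2 : ℂ) • c) (g := f') (fun χ hχ => ?_)
      (h'.simple.mem_intClosure hα)
    · simpa using h1
    · by_cases hχν : χ = ν'
      · subst hχν
        simpa [hf'.1] using hcν'
      · have h3 : χ ∈ Φ' \ {ν'} := ⟨hχ, hχν⟩
        rw [hf'.2 χ h3]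
        rw [← hdiff'] at h3
        simp [hc.2 χ h3]
  obtain ⟨g, hg⟩ := h.simple.exists_isCoord hφ'.1
  have hδint := h.simple.mem_intClosure h.highest.1
  obtain ⟨n, hgn⟩ := exists_int_of_mem_closure hg.exists_int hδint
  have hcoeff : HasCoeff Φ φ' δ n := by
    have := hasCoeff_zsmul_add hφ'.1 (hg.sub_zsmul_mem hδint hgn) n
    simpa using this
  have hlamn : w ν ∈ Δn := by
    have := hw.isHighest hw' (isCosetClosed_coord hf 1) (h.isLowest_one hf)
    exact h.noncompact_of_coord hΔ hn hf this.1.1 this.1.2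
  have hn1 : n = 1 := by
    have h3 := h.two_mul_coord hΔ hn hw hw' hΦk hsub hφ' hφφ' hc hcoeff
    rw [hcf _ (hn.subset hlamn)] at h3
    -- The coefficient is not `-1` because `2 δ = δ - (-δ)` is a sum of simple roots.
    obtain ⟨k, hk⟩ := exists_nat_of_mem_closure hg.exists_nat
      (h.highest.2 (-δ) (hΔ.neg_mem δ h.highest.1))
    rw [map_sub, map_neg, hgn] at hk
    have hk' : n + n = k := by
      have : (n : ℂ) + n = k := by rw [← hk]; ring
      exact_mod_cast this
    rcases h'.coord_noncompact hΔ hn hf' hlamn with h4 | h4 <;> rw [h4] at h3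
    · exact_mod_cast h3.symm
    · have : (-1 : ℤ) = n := by exact_mod_cast h3
      omega
  subst hn1
  have hex := h.isExchangeable hΔ hn hw hw' hΦk hsub hφ' hφφ' hc hcoeff
  refine ⟨φ', hφ', hcoeff, φ, hφ0, hφφ', ?_, c, hex, ⟨h'.noncompact, ?_⟩, fun β hβ => ?_⟩
  · rw [hdiff', Set.insert_sdiff_self_of_mem h'.mem]
  · linear_combination hcν' / 2
  · rw [hdiff']
    refine (h'.isLowest_one hf').2 β ⟨hn.subset hβ.1, ?_⟩
    rw [← hcf β (hn.subset hβ.1), hβ.2]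
    norm_num

end IsGradedBase

end Exchange

/-! ### Root systems of complex semisimple Lie algebras -/

section KillingRoots

open LieModule

variable {g : Type*} [LieRing g] [LieAlgebra ℂ g] {h : LieSubalgebra ℂ g}

theorem mem_rootSpace_iff {α : Module.Dual ℂ h} {x : g} :
    x ∈ rootSpace h α ↔ ∀ H : h, ⁅(H : g), x⁆ = α H • x := by
  unfold rootSpace
  rw [LieSubmodule.mem_toSubmodule, mem_weightSpace]
  rfl

theorem lie_mem_rootSpace {α β : Module.Dual ℂ h} {x y : g} (hx : x ∈ rootSpace h α)
    (hy : y ∈ rootSpace h β) : ⁅x, y⁆ ∈ rootSpace h (α + β) := by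
  rw [mem_rootSpace_iff] at *
  intro H
  rw [leibniz_lie, hx H, hy H, smul_lie, lie_smul, ← add_smul, LinearMap.add_apply]

variable [FiniteDimensional ℂ g] [LieAlgebra.IsKilling ℂ g] [h.IsCartanSubalgebra]

theorem rootSpace_eq_toSubmodule (α : Module.Dual ℂ h) :
    rootSpace h α = (LieAlgebra.rootSpace h (α : h → ℂ)).toSubmodule := by
  ext x
  rw [mem_rootSpace_iff, LieSubmodule.mem_toSubmodule]
  constructor
  · intro hx
    exact weightSpace_le_genWeightSpace g _ ((mem_weightSpace _ _).2 hx)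
  · intro hx H
    exact LieAlgebra.IsKilling.lie_eq_smul_of_mem_rootSpace hx H

theorem rootSpace_zero_eq : rootSpace h (0 : Module.Dual ℂ h) = h.toSubmodule := by
  rw [rootSpace_eq_toSubmodule]
  have := LieAlgebra.rootSpace_zero_eq (R := ℂ) (L := g) h
  exact congrArg LieSubmodule.toSubmodule this

theorem exists_weight_of_mem_roots {α : Module.Dual ℂ h} (hα : α ∈ roots h ⊤) :
    ∃ β : Weight ℂ h g, β.IsNonZero ∧ β.toLinear = α := by
  have h1 : LieAlgebra.rootSpace h (α : h → ℂ) ≠ ⊥ := by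
    intro h0
    refine hα.2.1 ?_
    rw [rootSpace_eq_toSubmodule, h0, LieSubmodule.bot_toSubmodule]
  refine ⟨⟨α, h1⟩, fun h0 => hα.1 ?_, rfl⟩
  ext H
  exact congrFun h0 H

theorem weight_mem_roots {β : Weight ℂ h g} (hβ : β.IsNonZero) : β.toLinear ∈ roots h ⊤ := by
  refine ⟨fun h0 => hβ (by simpa using h0), fun h0 => ?_, le_top⟩
  rw [rootSpace_eq_toSubmodule, LieSubmodule.toSubmodule_eq_bot] at h0
  exact β.genWeightSpace_ne_bot' h0

theorem mem_roots_top_iff {α : Module.Dual ℂ h} :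
    α ∈ roots h ⊤ ↔ α ∈ Set.range (LieAlgebra.IsKilling.rootSystem h).root := by
  constructor
  · intro hα
    obtain ⟨β, hβ, rfl⟩ := exists_weight_of_mem_roots hα
    exact ⟨⟨β, by simpa using hβ⟩, rfl⟩
  · rintro ⟨β, rfl⟩
    exact weight_mem_roots (LieSubalgebra.isNonZero_coe_root β)

/-- The real part of the canonical invariant form of the root system of `(g, h)`. -/
noncomputable def realRootForm (h : LieSubalgebra ℂ g) [h.IsCartanSubalgebra] :
    Module.Dual ℂ h →+ Module.Dual ℂ h →+ ℝ :=
  AddMonoidHom.mk' (fun x => AddMonoidHom.mk'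
    (fun y => ((LieAlgebra.IsKilling.rootSystem h).RootForm x y).re)
    (fun y z => by rw [map_add, Complex.add_re]))
    (fun x y => by ext z; simp)

theorem realRootForm_apply (x y : Module.Dual ℂ h) :
    realRootForm h x y = ((LieAlgebra.IsKilling.rootSystem h).RootForm x y).re := rfl

/-- On the root lattice the invariant form is the sum of the squares of the values on coroots, and
these are integers. -/
theorem realRootForm_self (x : Module.Dual ℂ h) (hx : x ∈ AddSubgroup.closure (roots h ⊤)) :
    ∃ n : h.root → ℤ, (∀ i, x ((LieAlgebra.IsKilling.rootSystem h).coroot i) = n i) ∧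
      (LieAlgebra.IsKilling.rootSystem h).RootForm x x = ((∑ i, n i * n i : ℤ) : ℂ) := by
  have key : ∀ i, ∃ n : ℤ, x ((LieAlgebra.IsKilling.rootSystem h).coroot i) = n := by
    intro i
    induction hx using AddSubgroup.closure_induction with
    | mem x hx =>
      obtain ⟨j, rfl⟩ := mem_roots_top_iff.1 hx
      refine ⟨(LieAlgebra.IsKilling.rootSystem h).pairingIn ℤ j i, ?_⟩
      have := (LieAlgebra.IsKilling.rootSystem h).algebraMap_pairingIn ℤ j i
      simpa using this.symm
    | zero => exact ⟨0, by simp⟩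
    | add x y _ _ hx hy =>
      obtain ⟨n, hn⟩ := hx
      obtain ⟨m, hm⟩ := hy
      exact ⟨n + m, by rw [LinearMap.add_apply, hn, hm, Int.cast_add]⟩
    | neg x _ hx =>
      obtain ⟨n, hn⟩ := hx
      exact ⟨-n, by rw [LinearMap.neg_apply, hn, Int.cast_neg]⟩
  choose n hn using key
  refine ⟨n, hn, ?_⟩
  rw [RootPairing.rootForm_apply_apply]
  push_cast
  refine Finset.sum_congr rfl fun i _ => ?_
  rw [← hn i]
  rfl

theorem realRootForm_pos {x : Module.Dual ℂ h} (hx : x ∈ AddSubgroup.closure (roots h ⊤))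
    (hx0 : x ≠ 0) : 0 < realRootForm h x x := by
  obtain ⟨n, hn, hform⟩ := realRootForm_self x hx
  have hne : ∃ i, n i ≠ 0 := by
    by_contra! h0
    refine hx0 ?_
    have hker : Submodule.span ℂ (Set.range (LieAlgebra.IsKilling.rootSystem h).coroot) ≤
        LinearMap.ker x := by
      rw [Submodule.span_le]
      rintro _ ⟨i, rfl⟩
      rw [SetLike.mem_coe, LinearMap.mem_ker, hn i, h0 i, Int.cast_zero]
    rw [RootPairing.IsRootSystem.span_coroot_eq_top] at hker
    exact LinearMap.ker_eq_top.1 (top_le_iff.1 hker)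
  obtain ⟨i, hi⟩ := hne
  rw [realRootForm_apply, hform, Complex.intCast_re, Int.cast_pos]
  exact Finset.sum_pos' (fun j _ => mul_self_nonneg _) ⟨i, Finset.mem_univ _, mul_self_pos.2 hi⟩

theorem isRootSet_roots : IsRootSet (roots h ⊤) (realRootForm h) where
  finite := by
    refine (Set.finite_range (LieAlgebra.IsKilling.rootSystem h).root).subset fun α hα => ?_
    exact mem_roots_top_iff.1 hα
  zero_notMem h0 := h0.1 rfl
  neg_mem α hα := by
    rw [mem_roots_top_iff] at *
    exact (LieAlgebra.IsKilling.rootSystem h).neg_mem_range_root_iff.2 hα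
  symm x y := by
    rw [realRootForm_apply, realRootForm_apply]
    congr 1
    exact (LieAlgebra.IsKilling.rootSystem h).rootForm_symmetric.eq x y
  pos x hx hx0 := realRootForm_pos hx hx0
  sub_mem α hα β hβ hne hB := by
    have hββ := realRootForm_pos (AddSubgroup.subset_closure hβ) hβ.1
    obtain ⟨m, -, hm⟩ := realRootForm_self β (AddSubgroup.subset_closure hβ)
    obtain ⟨i, rfl⟩ := mem_roots_top_iff.1 hα
    obtain ⟨j, rfl⟩ := mem_roots_top_iff.1 hβ
    rw [mem_roots_top_iff]
    refine (LieAlgebra.IsKilling.rootSystem h).root_sub_root_mem_of_pairingIn_pos ?_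
      (fun he => hne (he ▸ rfl))
    have h2 := ((LieAlgebra.IsKilling.rootSystem h).posRootForm
      ℤ).toInvariantForm.two_mul_apply_root_root i j
    have h2 : 2 * (LieAlgebra.IsKilling.rootSystem h).RootForm
        ((LieAlgebra.IsKilling.rootSystem h).root i) ((LieAlgebra.IsKilling.rootSystem h).root j) =
        (LieAlgebra.IsKilling.rootSystem h).pairing i j *
          (LieAlgebra.IsKilling.rootSystem h).RootForm
            ((LieAlgebra.IsKilling.rootSystem h).root j)
            ((LieAlgebra.IsKilling.rootSystem h).root j) := h2
    rw [← (LieAlgebra.IsKilling.rootSystem h).algebraMap_pairingIn ℤ i j] at h2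
    have h3 := congrArg Complex.re h2
    simp only [algebraMap_int_eq, eq_intCast] at h3
    rw [Complex.mul_re, Complex.mul_re, Complex.intCast_re, Complex.intCast_im, zero_mul, sub_zero,
      Complex.re_ofNat, Complex.im_ofNat, zero_mul, sub_zero] at h3
    rw [realRootForm_apply] at hB hββ
    have h4 : (0 : ℝ) < (LieAlgebra.IsKilling.rootSystem h).pairingIn ℤ i j :=
      pos_of_mul_pos_left (b := _) (h3 ▸ mul_pos two_pos hB) hββ.le
    exact_mod_cast h4
  reduced α hα n hn := by
    obtain ⟨β, hβ, rfl⟩ := exists_weight_of_mem_roots hα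
    obtain ⟨γ, hγ, hγβ⟩ := exists_weight_of_mem_roots hn
    have h1 : (γ : h → ℂ) = (n : ℂ) • (β : h → ℂ) := by
      ext H
      have := LinearMap.congr_fun hγβ H
      simpa using this
    rcases LieAlgebra.IsKilling.eq_neg_one_or_eq_zero_or_eq_one_of_eq_smul β γ hβ n h1 with
      h2 | h2 | h2
    · have : (n : ℂ) + 1 = 0 := by rw [h2]; ring
      have : n + 1 = 0 := by exact_mod_cast this
      omega
    · rw [h2, zero_smul] at h1
      exact absurd h1 hγ
    · exact_mod_cast h2

theorem isCoroot_coroot {β : Weight ℂ h g} (hβ : β.IsNonZero) :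
    IsCoroot h β.toLinear (LieAlgebra.IsKilling.coroot β) := by
  refine ⟨LieAlgebra.IsKilling.root_apply_coroot hβ, ?_⟩
  obtain ⟨H, e, f, ht, he, hf⟩ := LieAlgebra.IsKilling.exists_isSl2Triple_of_weight_isNonZero hβ
  refine ⟨e, by rw [rootSpace_eq_toSubmodule]; exact he, f, by
    rw [rootSpace_eq_toSubmodule]; exact hf, ?_⟩
  rw [ht.lie_e_f, ht.h_eq_coroot hβ he hf]

theorem IsCoroot.eq_coroot {β : Weight ℂ h g} {c : h} (hc : IsCoroot h β.toLinear c) :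
    c = LieAlgebra.IsKilling.coroot β := by
  obtain ⟨h2, x, hx, y, hy, hxy⟩ := hc
  rw [rootSpace_eq_toSubmodule] at hx hy
  refine LieAlgebra.IsKilling.eq_coroot_of_mem_corootSpace_of_two β ?_ h2
  rw [LieAlgebra.mem_corootSpace]
  exact Submodule.subset_span ⟨x, hx, y, hy, hxy⟩

theorem isRootReflection_of_isCoroot {α : Module.Dual ℂ h} (hα : α ∈ roots h ⊤) {c : h}
    (hc : IsCoroot h α c) {s : Module.Dual ℂ h ≃ₗ[ℂ] Module.Dual ℂ h}
    (hs : ∀ μ : Module.Dual ℂ h, s μ = μ - μ c • α) : IsRootReflection (roots h ⊤) α s := by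
  obtain ⟨β, hβ, rfl⟩ := exists_weight_of_mem_roots hα
  obtain rfl := hc.eq_coroot
  let i : h.root := ⟨β, by simpa using hβ⟩
  have hsr : ∀ μ, s μ = (LieAlgebra.IsKilling.rootSystem h).reflection i μ := fun μ => hs μ
  refine ⟨?_, fun γ hγ => ?_, fun γ hγ => ?_⟩
  · rw [hs, hc.1, two_smul]
    abel
  · rw [mem_roots_top_iff] at hγ ⊢
    obtain ⟨j, rfl⟩ := hγ
    rw [hsr, ← RootPairing.root_reflectionPerm]
    exact ⟨_, rfl⟩
  · obtain ⟨γ, hγ, rfl⟩ := exists_weight_of_mem_roots hγ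
    refine ⟨(chainBotCoeff β γ - chainTopCoeff β γ : ℤ), ?_⟩
    rw [hs, Weight.toLinear_apply, LieAlgebra.IsKilling.apply_coroot_eq_cast β γ,
      Int.cast_smul_eq_zsmul]

theorem exists_weylGroup_reflection {R : Set (Module.Dual ℂ h)} (hR : R ⊆ roots h ⊤)
    {α : Module.Dual ℂ h} (hα : α ∈ R) :
    ∃ s ∈ weylGroup h R, IsRootReflection (roots h ⊤) α s := by
  obtain ⟨β, hβ, rfl⟩ := exists_weight_of_mem_roots (hR hα)
  let i : h.root := ⟨β, by simpa using hβ⟩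
  have hs : ∀ μ, (LieAlgebra.IsKilling.rootSystem h).reflection i μ =
      μ - μ (LieAlgebra.IsKilling.coroot β) • β.toLinear := fun μ => rfl
  exact ⟨(LieAlgebra.IsKilling.rootSystem h).reflection i,
    Subgroup.subset_closure ⟨_, hα, _, isCoroot_coroot hβ, hs⟩,
    isRootReflection_of_isCoroot (hR hα) (isCoroot_coroot hβ) hs⟩

theorem weylGroup_le_reflectionGroup {R : Set (Module.Dual ℂ h)} (hR : R ⊆ roots h ⊤) :
    weylGroup h R ≤ reflectionGroup (roots h ⊤) R := by
  refine Subgroup.closure_mono ?_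
  rintro s ⟨α, hα, c, hc, hs⟩
  exact ⟨α, hα, isRootReflection_of_isCoroot (hR hα) hc hs⟩

theorem exists_smul_eq_of_mem_rootSpace {α : Module.Dual ℂ h} (hα : α ∈ roots h ⊤) {x y : g}
    (hx : x ∈ rootSpace h α) (hx0 : x ≠ 0) (hy : y ∈ rootSpace h α) : ∃ c : ℂ, c • x = y := by
  obtain ⟨β, hβ, rfl⟩ := exists_weight_of_mem_roots hα
  rw [rootSpace_eq_toSubmodule] at hx hy
  have := (finrank_eq_one_iff_of_nonzero' (⟨x, hx⟩ : LieAlgebra.rootSpace h β)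
    (fun h0 => hx0 (congrArg Subtype.val h0))).1
    (LieAlgebra.IsKilling.finrank_rootSpace_eq_one β hβ) ⟨y, hy⟩
  obtain ⟨c, hc⟩ := this
  exact ⟨c, congrArg Subtype.val hc⟩

theorem rootSpace_le_of_mem {α : Module.Dual ℂ h} (hα : α ∈ roots h ⊤) {x : g}
    (hx : x ∈ rootSpace h α) (hx0 : x ≠ 0) {W : Submodule ℂ g} (hxW : x ∈ W) :
    rootSpace h α ≤ W := by
  intro y hy
  obtain ⟨c, rfl⟩ := exists_smul_eq_of_mem_rootSpace hα hx hx0 hy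
  exact W.smul_mem c hxW

theorem exists_ne_zero_of_mem_roots {α : Module.Dual ℂ h} (hα : α ∈ roots h ⊤) :
    ∃ x ∈ rootSpace h α, x ≠ 0 := (Submodule.ne_bot_iff _).1 hα.2.1

/-- If `α`, `β` and `α + β` are roots, then the bracket of the root spaces of `α` and `β` does not
vanish: the vectors of weight `β` are not at the top of the `α`-string. -/
theorem lie_ne_zero_of_add_mem_roots {α β : Module.Dual ℂ h} (hα : α ∈ roots h ⊤)
    (hβ : β ∈ roots h ⊤) (hαβ : α + β ∈ roots h ⊤) {x y : g} (hx : x ∈ rootSpace h α)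
    (hx0 : x ≠ 0) (hy : y ∈ rootSpace h β) (hy0 : y ≠ 0) : ⁅x, y⁆ ≠ 0 := by
  obtain ⟨γ, hγ, hγeq⟩ := exists_weight_of_mem_roots hαβ
  obtain ⟨a, ha, rfl⟩ := exists_weight_of_mem_roots hα
  obtain ⟨b, hb, rfl⟩ := exists_weight_of_mem_roots hβ
  obtain ⟨z, hz, hz0⟩ := (chainTop a b).exists_ne_zero
  obtain ⟨H, e, f, ht, he, hf⟩ := LieAlgebra.IsKilling.exists_isSl2Triple_of_weight_isNonZero ha
  obtain rfl := ht.h_eq_coroot ha he hf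
  have prim : ht.HasPrimitiveVectorWith z (LieAlgebra.IsKilling.chainLength a b : ℂ) :=
    have := LieAlgebra.lie_mem_genWeightSpace_of_mem_genWeightSpace he hz
    ⟨hz0, (LieAlgebra.IsKilling.chainLength_smul _ _ hz).symm, by
      rwa [genWeightSpace_add_chainTop _ _ ha] at this⟩
  have h1 : 1 ≤ chainTopCoeff a b := by
    have h2 : LieAlgebra.rootSpace h ((1 : ℤ) • (a : h → ℂ) + b) ≠ ⊥ := by
      have h3 : ((1 : ℤ) • (a : h → ℂ) + b) = γ := by
        ext H
        have := LinearMap.congr_fun hγeq H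
        simpa using this.symm
      rw [h3]
      exact γ.genWeightSpace_ne_bot'
    have := ((LieAlgebra.IsKilling.rootSpace_zsmul_add_ne_bot_iff a b ha 1).1 h2).1
    exact_mod_cast this
  obtain ⟨m, hm⟩ : ∃ m, chainTopCoeff a b = m + 1 := ⟨chainTopCoeff a b - 1, by omega⟩
  have hle : m + 1 ≤ LieAlgebra.IsKilling.chainLength a b := by
    rw [← hm]
    exact LieAlgebra.IsKilling.chainTopCoeff_le_chainLength a b
  have hbsp : (toEnd ℂ g g f ^ (m + 1)) z ∈ rootSpace h b.toLinear := by
    rw [rootSpace_eq_toSubmodule]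
    have := LieAlgebra.toEnd_pow_apply_mem hf hz (m + 1)
    rw [coe_chainTop', hm, smul_neg, neg_add_cancel_left] at this
    exact this
  obtain ⟨c, rfl⟩ := exists_smul_eq_of_mem_rootSpace hβ hbsp
    (prim.pow_toEnd_f_ne_zero_of_eq_nat rfl hle) hy
  obtain ⟨d, rfl⟩ := exists_smul_eq_of_mem_rootSpace hα
    (by rw [rootSpace_eq_toSubmodule]; exact he) ht.e_ne_zero hx
  have hc : c ≠ 0 := fun h0 => hy0 (by rw [h0, zero_smul])
  have hd : d ≠ 0 := fun h0 => hx0 (by rw [h0, zero_smul])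
  rw [smul_lie, lie_smul, prim.lie_e_pow_succ_toEnd_f]
  refine smul_ne_zero hd (smul_ne_zero hc (smul_ne_zero (mul_ne_zero ?_ ?_)
    (prim.pow_toEnd_f_ne_zero_of_eq_nat rfl (by omega))))
  · exact_mod_cast Nat.succ_ne_zero m
  · rw [sub_ne_zero]
    exact_mod_cast (by omega : LieAlgebra.IsKilling.chainLength a b ≠ m)

theorem rootSpace_le_of_lie_mem {α β : Module.Dual ℂ h} (hα : α ∈ roots h ⊤)
    (hβ : β ∈ roots h ⊤) (hαβ : α + β ∈ roots h ⊤) {W : Submodule ℂ g}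
    (hW : ∀ x ∈ rootSpace h α, ∀ y ∈ rootSpace h β, ⁅x, y⁆ ∈ W) : rootSpace h (α + β) ≤ W := by
  obtain ⟨x, hx, hx0⟩ := exists_ne_zero_of_mem_roots hα
  obtain ⟨y, hy, hy0⟩ := exists_ne_zero_of_mem_roots hβ
  exact rootSpace_le_of_mem hαβ (lie_mem_rootSpace hx hy)
    (lie_ne_zero_of_add_mem_roots hα hβ hαβ hx hx0 hy hy0) (hW x hx y hy)

/-- A decomposition `g = k ⊕ p` as for a symmetric pair, with `h ⊆ k`. -/
structure IsSymmetricPair (h k : LieSubalgebra ℂ g) (p : Submodule ℂ g) : Prop where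
  le : h ≤ k
  isCompl : IsCompl k.toSubmodule p
  lie_mem_p : ∀ x ∈ k, ∀ y ∈ p, ⁅x, y⁆ ∈ p
  lie_mem_k : ∀ x ∈ p, ∀ y ∈ p, ⁅x, y⁆ ∈ k

namespace IsSymmetricPair

variable {k : LieSubalgebra ℂ g} {p : Submodule ℂ g} (hkp : IsSymmetricPair h k p)
include hkp

theorem eq_zero_of_mem {x : g} (hx : x ∈ k) (hx' : x ∈ p) : x = 0 :=
  Submodule.disjoint_def.1 hkp.isCompl.disjoint x hx hx'

theorem rootSpace_le_or {α : Module.Dual ℂ h} (hα : α ∈ roots h ⊤) :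
    rootSpace h α ≤ k.toSubmodule ∨ rootSpace h α ≤ p := by
  obtain ⟨x, hx, hx0⟩ := exists_ne_zero_of_mem_roots hα
  obtain ⟨a, ha, b, hb, rfl⟩ := Submodule.mem_sup.1
    (hkp.isCompl.sup_eq_top ▸ Submodule.mem_top : x ∈ k.toSubmodule ⊔ p)
  rw [mem_rootSpace_iff] at hx
  have key : ∀ H : h, ⁅(H : g), a⁆ - α H • a = 0 := by
    intro H
    refine hkp.eq_zero_of_mem (k.sub_mem (k.lie_mem (hkp.le H.2) ha) (k.smul_mem _ ha)) ?_
    have h1 : ⁅(H : g), a⁆ - α H • a = α H • b - ⁅(H : g), b⁆ := by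
      have := hx H
      rw [lie_add, smul_add] at this
      rw [sub_eq_sub_iff_add_eq_add, this, add_comm]
    rw [h1]
    exact sub_mem (p.smul_mem _ hb) (hkp.lie_mem_p _ (hkp.le H.2) b hb)
  have hasp : a ∈ rootSpace h α := mem_rootSpace_iff.2 fun H => sub_eq_zero.1 (key H)
  by_cases ha0 : a = 0
  · right
    subst ha0
    rw [zero_add] at hx hx0
    exact rootSpace_le_of_mem hα (mem_rootSpace_iff.2 hx) hx0 hb
  · exact Or.inl (rootSpace_le_of_mem hα hasp ha0 ha)

theorem noncompact_subset : roots h p ⊆ roots h ⊤ := fun _ hα => ⟨hα.1, hα.2.1, le_top⟩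

theorem not_le_of_mem_roots {α : Module.Dual ℂ h} (hα : α ∈ roots h p) :
    ¬rootSpace h α ≤ k.toSubmodule := by
  intro hle
  obtain ⟨x, hx, hx0⟩ := exists_ne_zero_of_mem_roots (hkp.noncompact_subset hα)
  exact hx0 (hkp.eq_zero_of_mem (hle hx) (hα.2.2 hx))

theorem le_of_notMem {α : Module.Dual ℂ h} (hα : α ∈ roots h ⊤) (hn : α ∉ roots h p) :
    rootSpace h α ≤ k.toSubmodule :=
  (hkp.rootSpace_le_or hα).resolve_right fun hle => hn ⟨hα.1, hα.2.1, hle⟩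

theorem roots_compact_eq : roots h k.toSubmodule = roots h ⊤ \ roots h p := by
  ext α
  constructor
  · intro hα
    exact ⟨⟨hα.1, hα.2.1, le_top⟩, fun hn => hkp.not_le_of_mem_roots hn hα.2.2⟩
  · intro hα
    exact ⟨hα.1.1, hα.1.2.1, hkp.le_of_notMem hα.1 hα.2⟩

/-- The decomposition `g = k ⊕ p` grades the roots. The root `-α` is noncompact with `α`, as the
coroot of `α` would otherwise lie in `h ∩ p = 0`. -/
theorem isNoncompactPart : IsNoncompactPart (roots h ⊤) (roots h p) where
  subset := hkp.noncompact_subset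
  neg_mem α hα := by
    have hα' := isRootSet_roots.neg_mem α (hkp.noncompact_subset hα)
    by_contra hn
    have hle := hkp.le_of_notMem hα' hn
    obtain ⟨β, hβ, rfl⟩ := exists_weight_of_mem_roots (hkp.noncompact_subset hα)
    obtain ⟨h2, x, hx, y, hy, hxy⟩ := isCoroot_coroot hβ
    have h1 : ⁅x, y⁆ ∈ p := by
      rw [← lie_skew]
      exact neg_mem (hkp.lie_mem_p y (hle hy) x (hα.2.2 hx))
    have h3 := hkp.eq_zero_of_mem (hkp.le (hxy ▸ Subtype.property _)) h1
    rw [hxy] at h3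
    rw [show LieAlgebra.IsKilling.coroot β = 0 from Subtype.ext h3, map_zero] at h2
    exact two_ne_zero h2.symm
  add_mem_iff α hα β hβ hαβ := by
    by_cases hαn : α ∈ roots h p <;> by_cases hβn : β ∈ roots h p
    · refine iff_of_false (fun hn => hkp.not_le_of_mem_roots hn ?_) (by simp [hαn, hβn])
      exact rootSpace_le_of_lie_mem hα hβ hαβ fun x hx y hy =>
        hkp.lie_mem_k x (hαn.2.2 hx) y (hβn.2.2 hy)
    · refine iff_of_true ⟨hαβ.1, hαβ.2.1, ?_⟩ (by simp [hαn, hβn])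
      refine rootSpace_le_of_lie_mem hα hβ hαβ fun x hx y hy => ?_
      rw [← lie_skew]
      exact neg_mem (hkp.lie_mem_p y (hkp.le_of_notMem hβ hβn hy) x (hαn.2.2 hx))
    · refine iff_of_true ⟨hαβ.1, hαβ.2.1, ?_⟩ (by simp [hαn, hβn])
      exact rootSpace_le_of_lie_mem hα hβ hαβ fun x hx y hy =>
        hkp.lie_mem_p x (hkp.le_of_notMem hα hαn hx) y (hβn.2.2 hy)
    · refine iff_of_false (fun hn => hkp.not_le_of_mem_roots hn ?_) (by simp [hαn, hβn])
      exact rootSpace_le_of_lie_mem hα hβ hαβ fun x hx y hy =>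
        k.lie_mem (hkp.le_of_notMem hα hαn hx) (hkp.le_of_notMem hβ hβn hy)

end IsSymmetricPair

end KillingRoots

/-! ### Submodules over Levi subalgebras -/

section LeviModules

open LieModule

variable {g : Type*} [LieRing g] [LieAlgebra ℂ g] {h k : LieSubalgebra ℂ g}

/-- A linear form vanishing on the common kernel of a set of linear forms is a combination of
these. -/
theorem mem_span_of_forall_eq_zero {V : Type*} [AddCommGroup V] [Module ℂ V] [FiniteDimensional ℂ V]
    {Ψ : Set (Module.Dual ℂ V)} {μ : Module.Dual ℂ V}
    (hμ : ∀ E, (∀ ψ ∈ Ψ, ψ E = 0) → μ E = 0) : μ ∈ Submodule.span ℂ Ψ := by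
  rw [← Subspace.dualCoannihilator_dualAnnihilator_eq (W := Submodule.span ℂ Ψ),
    Submodule.mem_dualAnnihilator]
  intro E hE
  refine hμ E fun ψ hψ => ?_
  exact (Submodule.mem_dualCoannihilator _).1 hE ψ (Submodule.subset_span hψ)

theorem eq_zero_of_mem_span {V : Type*} [AddCommGroup V] [Module ℂ V]
    {Ψ : Set (Module.Dual ℂ V)} {μ : Module.Dual ℂ V} (hμ : μ ∈ Submodule.span ℂ Ψ) {E : V}
    (hE : ∀ ψ ∈ Ψ, ψ E = 0) : μ E = 0 := by
  have : Submodule.span ℂ Ψ ≤ LinearMap.ker (LinearMap.applyₗ (R := ℂ) (M₂ := ℂ) E) :=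
    Submodule.span_le.2 fun ψ hψ => hE ψ hψ
  exact this hμ

variable [FiniteDimensional ℂ g] [LieAlgebra.IsKilling ℂ g] [h.IsCartanSubalgebra]

/-- A subspace stable under `h` is the sum of its weight spaces. -/
theorem le_of_forall_inf_rootSpace_le {W U : Submodule ℂ g}
    (hW : ∀ H : h, ∀ x ∈ W, ⁅(H : g), x⁆ ∈ W) (hU : ∀ α, rootSpace h α ⊓ W ≤ U) : W ≤ U := by
  let N : LieSubmodule ℂ h g := { W with lie_mem := fun {H x} hx => hW H x hx }
  have h1 := congrArg LieSubmodule.toSubmodule (eq_iSup_inf_genWeightSpace ℂ h g N)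
  rw [LieSubmodule.iSup_toSubmodule] at h1
  change N.toSubmodule ≤ U
  rw [h1]
  refine iSup_le fun χ => ?_
  refine le_trans ?_ (hU χ.toLinear)
  rw [rootSpace_eq_toSubmodule, LieSubmodule.inf_toSubmodule, inf_comm]
  rfl

theorem lie_eq_zero_of_mem {x y : g} (hx : x ∈ h) (hy : y ∈ h) : ⁅x, y⁆ = 0 :=
  congrArg Subtype.val (trivial_lie_zero h h ⟨x, hx⟩ ⟨y, hy⟩)

theorem le_leviSubalgebra (hk : h ≤ k) (Ψ : Set (Module.Dual ℂ h)) : h ≤ leviSubalgebra h k Ψ :=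
  fun _ hx => ⟨hk hx, fun E _ => lie_eq_zero_of_mem E.2 hx⟩

theorem rootSpace_le_leviSubalgebra {Ψ : Set (Module.Dual ℂ h)} {γ : Module.Dual ℂ h}
    (hγk : rootSpace h γ ≤ k.toSubmodule) (hγ : γ ∈ Submodule.span ℂ Ψ) :
    rootSpace h γ ≤ (leviSubalgebra h k Ψ).toSubmodule := by
  intro x hx
  refine ⟨hγk hx, fun E hE => ?_⟩
  rw [mem_rootSpace_iff.1 hx E, eq_zero_of_mem_span hγ hE, zero_smul]

/-- The roots of the Levi subalgebra attached to a set of simple roots `Ψ` are the roots in the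
lattice spanned by `Ψ`. -/
theorem roots_leviSubalgebra {Φ Ψ : Set (Module.Dual ℂ h)} (hΦ : IsSimpleSystem (roots h ⊤) Φ)
    (hΨ : Ψ ⊆ Φ) :
    roots h (leviSubalgebra h ⊤ Ψ).toSubmodule =
      {α | α ∈ roots h ⊤ ∧ α ∈ AddSubgroup.closure Ψ} := by
  ext α
  constructor
  · intro hα
    have hα' : α ∈ roots h ⊤ := ⟨hα.1, hα.2.1, le_top⟩
    refine ⟨hα', ?_⟩
    obtain ⟨x, hx, hx0⟩ := exists_ne_zero_of_mem_roots hα'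
    have hspan : α ∈ Submodule.span ℂ Ψ := by
      refine mem_span_of_forall_eq_zero fun E hE => ?_
      have h1 := (hα.2.2 hx).2 E hE
      rw [mem_rootSpace_iff.1 hx E] at h1
      exact (smul_eq_zero.1 h1).resolve_right hx0
    rcases hΦ.mem_or_neg_mem α hα' with h1 | h1
    · exact mem_addSubgroupClosure (hΦ.linearIndependent.mem_closure_of_mem_span hΨ h1 hspan)
    · simpa using neg_mem (mem_addSubgroupClosure
        (hΦ.linearIndependent.mem_closure_of_mem_span hΨ h1 (neg_mem hspan)))
  · intro hα
    exact ⟨hα.1.1, hα.1.2.1, rootSpace_le_leviSubalgebra le_top (addSubgroupClosure_le_span α hα.2)⟩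

/-- The vectors in `p` on which the centre of the Levi subalgebra of `k` attached to `Ψ` acts
through the character `lam`. -/
def IsSymmetricPair.isotypicPart {p : Submodule ℂ g} (hkp : IsSymmetricPair h k p)
    (Ψ : Set (Module.Dual ℂ h)) (lam : Module.Dual ℂ h) :
    LieSubmodule ℂ (leviSubalgebra h k Ψ) g where
  carrier := {x | x ∈ p ∧ ∀ E : h, (∀ ψ ∈ Ψ, ψ E = 0) → ⁅(E : g), x⁆ = lam E • x}
  zero_mem' := ⟨p.zero_mem, fun E _ => by rw [lie_zero, smul_zero]⟩
  add_mem' := fun {x y} hx hy =>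
    ⟨p.add_mem hx.1 hy.1, fun E hE => by rw [lie_add, hx.2 E hE, hy.2 E hE, smul_add]⟩
  smul_mem' := fun c x hx =>
    ⟨p.smul_mem c hx.1, fun E hE => by rw [lie_smul, hx.2 E hE, smul_comm]⟩
  lie_mem := fun {y x} hx =>
    ⟨hkp.lie_mem_p y y.2.1 x hx.1, fun E hE => by
      change ⁅(E : g), ⁅(y : g), x⁆⁆ = lam E • ⁅(y : g), x⁆
      rw [leibniz_lie, y.2.2 E hE, zero_lie, zero_add, hx.2 E hE, lie_smul]⟩

namespace IsSymmetricPair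

variable {p : Submodule ℂ g} (hkp : IsSymmetricPair h k p)
include hkp

theorem isotypicPart_le_p (Ψ : Set (Module.Dual ℂ h)) (lam : Module.Dual ℂ h) :
    (hkp.isotypicPart Ψ lam).toSubmodule ≤ p := by
  intro x hx
  exact And.left hx

theorem mem_roots_of_mem_weights {W : Submodule ℂ g} (hWp : W ≤ p) {μ : Module.Dual ℂ h}
    (hμ : μ ∈ weights h W) : μ ∈ roots h p ∧ rootSpace h μ ≤ W := by
  obtain ⟨x, ⟨hx, hxW⟩, hx0⟩ := (Submodule.ne_bot_iff _).1 hμ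
  have hμ0 : μ ≠ 0 := by
    rintro rfl
    rw [SetLike.mem_coe, rootSpace_zero_eq] at hx
    exact hx0 (hkp.eq_zero_of_mem (hkp.le hx) (hWp hxW))
  have hμ' : μ ∈ roots h ⊤ := ⟨hμ0, (Submodule.ne_bot_iff _).2 ⟨x, hx, hx0⟩, le_top⟩
  have hle := rootSpace_le_of_mem hμ' hx hx0 hxW
  exact ⟨⟨hμ0, hμ'.2.1, hle.trans hWp⟩, hle⟩

theorem mem_weights_of_le {W : Submodule ℂ g} {μ : Module.Dual ℂ h} (hμ : μ ∈ roots h ⊤)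
    (hle : rootSpace h μ ≤ W) : μ ∈ weights h W := by
  change rootSpace h μ ⊓ W ≠ ⊥
  rw [inf_eq_left.2 hle]
  exact hμ.2.1

/-- A submodule `W` of `p` over a Levi subalgebra is contained in any subspace that contains the
root spaces of the weights of `W`. -/
theorem le_of_forall_rootSpace_le {Ψ : Set (Module.Dual ℂ h)}
    {W : LieSubmodule ℂ (leviSubalgebra h k Ψ) g} {U : Submodule ℂ g}
    (hU : ∀ μ ∈ weights h W.toSubmodule, rootSpace h μ ≤ U) : W.toSubmodule ≤ U := by
  refine le_of_forall_inf_rootSpace_le (h := h) (fun H x hx => ?_) fun α => ?_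
  · exact W.lie_mem (x := ⟨H, le_leviSubalgebra hkp.le Ψ H.2⟩) hx
  · by_cases hα : rootSpace h α ⊓ W.toSubmodule = ⊥
    · rw [hα]
      exact bot_le
    · exact inf_le_left.trans (hU α hα)

variable {Φk : Set (Module.Dual ℂ h)} {φ lam η : Module.Dual ℂ h}
  {c : Module.Dual ℂ h →ₗ[ℂ] ℂ} (hex : IsExchangeable (roots h ⊤) (roots h p) Φk φ lam c)
include hex

/-- The centre of the Levi subalgebra acts on the root spaces of `μ` and `lam` through the same
character if and only if `μ - lam` is a combination of `Φk \ {φ}`, that is, if `c` has the same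
value on both. -/
theorem weights_isotypicPart :
    weights h (hkp.isotypicPart (Φk \ {φ}) lam).toSubmodule =
      {β | β ∈ roots h p ∧ c β = 1 / 2} := by
  ext μ
  constructor
  · intro hμ
    obtain ⟨hμp, hle⟩ := hkp.mem_roots_of_mem_weights (hkp.isotypicPart_le_p _ _) hμ
    refine ⟨hμp, ?_⟩
    obtain ⟨x, hx, hx0⟩ := exists_ne_zero_of_mem_roots (hkp.noncompact_subset hμp)
    have hspan : μ - lam ∈ Submodule.span ℂ (Φk \ {φ}) := by
      refine mem_span_of_forall_eq_zero fun E hE => ?_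
      have h1 := (hle hx).2 E hE
      rw [mem_rootSpace_iff.1 hx E, ← sub_eq_zero, ← sub_smul] at h1
      exact (smul_eq_zero.1 h1).resolve_right hx0
    have h0 : c (μ - lam) = 0 := by
      have : Submodule.span ℂ (Φk \ {φ}) ≤ LinearMap.ker c :=
        Submodule.span_le.2 fun ψ hψ => hex.coord.2 ψ hψ
      exact this hspan
    rw [← hex.coord_lam, ← sub_eq_zero, ← map_sub, h0]
  · intro hμ
    refine hkp.mem_weights_of_le (hkp.noncompact_subset hμ.1) fun x hx => ⟨hμ.1.2.2 hx, ?_⟩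
    intro E hE
    rw [mem_rootSpace_iff.1 hx E]
    have h1 : lam - μ ∈ Submodule.span ℂ (Φk \ {φ}) :=
      addSubgroupClosure_le_span _ (mem_addSubgroupClosure (hex.isHighest.2 μ hμ))
    have h2 := eq_zero_of_mem_span h1 hE
    rw [LinearMap.sub_apply, sub_eq_zero] at h2
    rw [h2]

/-- The weights of the isotypic part are connected by roots of the Levi subalgebra, which makes a
nonzero submodule of it contain all its weight spaces. -/
theorem isotypicPart_le (hη : IsLowest (Φk \ {φ}) {β | β ∈ roots h p ∧ c β = 1 / 2} η)
    {W : LieSubmodule ℂ (leviSubalgebra h k (Φk \ {φ})) g}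
    (hW : W ≤ hkp.isotypicPart (Φk \ {φ}) lam) (hW0 : W ≠ ⊥) :
    hkp.isotypicPart (Φk \ {φ}) lam ≤ W := by
  have hWp : W.toSubmodule ≤ p := fun x hx => (hW hx).1
  have hn := hkp.isNoncompactPart
  have hT : {β | β ∈ roots h p ∧ rootSpace h β ≤ W.toSubmodule} =
      {β | β ∈ roots h p ∧ c β = 1 / 2} := by
    refine isRootSet_roots.eq_of_isLowest (Ψ := Φk \ {φ}) ?_ ?_ (hex.isCosetClosed hn) hη
      ?_ ?_ ?_ ?_
    · exact hex.simple.linearIndependent.mono Set.sdiff_subset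
    · exact fun ψ hψ => (hex.simple.subset hψ.1).1
    · intro β hβ hmem
      have := hex.coord.eq_zero hmem
      rw [hβ.2] at this
      norm_num at this
    · intro β hβ
      rw [← hkp.weights_isotypicPart hex]
      exact hkp.mem_weights_of_le (hkp.noncompact_subset hβ.1) (hβ.2.trans hW)
    · by_contra hemp
      refine hW0 ((LieSubmodule.toSubmodule_eq_bot W).1 (eq_bot_iff.2 ?_))
      refine hkp.le_of_forall_rootSpace_le fun μ hμ => ?_
      exact absurd ⟨μ, hkp.mem_roots_of_mem_weights hWp hμ⟩ hemp
    · intro β hβ γ hγ hmem hadd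
      have hγn := (hex.compact_of_coord hn hγ (n := 0) (by simpa using hex.coord.eq_zero hmem)).2
      have hle := rootSpace_le_leviSubalgebra (hkp.le_of_notMem hγ hγn)
        (addSubgroupClosure_le_span γ hmem)
      refine ⟨hadd.1, ?_⟩
      rw [add_comm]
      refine rootSpace_le_of_lie_mem hγ (hkp.noncompact_subset hβ.1)
        (by rw [add_comm]; exact hkp.noncompact_subset hadd.1) fun x hx y hy => ?_
      exact W.lie_mem (x := ⟨x, hle hx⟩) (hβ.2 hy)
  refine hkp.le_of_forall_rootSpace_le fun μ hμ => ?_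
  rw [hkp.weights_isotypicPart hex, ← hT] at hμ
  exact hμ.2

theorem isotypicPart_ne_bot : hkp.isotypicPart (Φk \ {φ}) lam ≠ ⊥ := by
  intro h0
  have h1 : lam ∈ weights h (hkp.isotypicPart (Φk \ {φ}) lam).toSubmodule := by
    rw [hkp.weights_isotypicPart hex]
    exact hex.isHighest.1
  refine h1 ?_
  rw [h0, LieSubmodule.bot_toSubmodule, inf_bot_eq]

theorem isIrreducible_isotypicPart
    (hη : IsLowest (Φk \ {φ}) {β | β ∈ roots h p ∧ c β = 1 / 2} η) :
    LieModule.IsIrreducible ℂ (leviSubalgebra h k (Φk \ {φ}))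
      (hkp.isotypicPart (Φk \ {φ}) lam) := by
  have : Nontrivial (hkp.isotypicPart (Φk \ {φ}) lam) :=
    (LieSubmodule.nontrivial_iff_ne_bot _ _ _).2 (hkp.isotypicPart_ne_bot hex)
  refine LieModule.IsIrreducible.mk fun N hN => ?_
  have h1 : hkp.isotypicPart (Φk \ {φ}) lam ≤
      N.map (hkp.isotypicPart (Φk \ {φ}) lam).incl := by
    refine hkp.isotypicPart_le hex hη ?_ ?_
    · exact LieSubmodule.map_incl_le
    · intro h0
      refine hN ?_
      rw [LieSubmodule.eq_bot_iff] at h0 ⊢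
      intro m hm
      exact Subtype.ext (h0 m (LieSubmodule.mem_map _ |>.2 ⟨m, hm, rfl⟩))
  rw [eq_top_iff]
  intro m _
  obtain ⟨m', hm', he⟩ := (LieSubmodule.mem_map _).1 (h1 m.2)
  rwa [← show m' = m from Subtype.ext he]

/-- The irreducible submodules of `p` with highest weight `lam`, over the Levi subalgebra of `k`
obtained by omitting `φ`, have the lowest noncompact root of level `1 / 2` as lowest weight. -/
theorem isLowestWeightOfSubmodule_iff
    (hη : IsLowest (Φk \ {φ}) {β | β ∈ roots h p ∧ c β = 1 / 2} η) {ν' : Module.Dual ℂ h} :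
    IsLowestWeightOfSubmodule h k p (Φk \ {φ}) lam ν' ↔ ν' = η := by
  have hweights := hkp.weights_isotypicPart hex
  constructor
  · rintro ⟨W, hWp, -, hhigh, hlow⟩
    have h1 : hkp.isotypicPart (Φk \ {φ}) lam ≤ W := by
      refine le_trans (hkp.isotypicPart_le hex hη (W := hkp.isotypicPart (Φk \ {φ}) lam ⊓ W)
        inf_le_left ?_) inf_le_right
      intro h0
      obtain ⟨hlam, hle⟩ := hkp.mem_roots_of_mem_weights hWp hhigh.1
      obtain ⟨x, hx, hx0⟩ := exists_ne_zero_of_mem_roots (hkp.noncompact_subset hlam)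
      have h2 : lam ∈ weights h (hkp.isotypicPart (Φk \ {φ}) lam).toSubmodule := by
        rw [hweights]
        exact hex.isHighest.1
      have h3 := (hkp.mem_roots_of_mem_weights (hkp.isotypicPart_le_p _ _) h2).2
      exact hx0 ((LieSubmodule.eq_bot_iff _).1 h0 x ⟨h3 hx, hle hx⟩)
    have h2 : weights h W.toSubmodule = {β | β ∈ roots h p ∧ c β = 1 / 2} := by
      ext β
      constructor
      · intro hβ
        refine ⟨(hkp.mem_roots_of_mem_weights hWp hβ).1, ?_⟩
        have := hex.coord.eq_zero (mem_addSubgroupClosure (hhigh.2 β hβ))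
        rw [map_sub, hex.coord_lam, sub_eq_zero] at this
        exact this.symm
      · intro hβ
        rw [← hweights] at hβ
        obtain ⟨hβp, hle⟩ := hkp.mem_roots_of_mem_weights (hkp.isotypicPart_le_p _ _) hβ
        exact hkp.mem_weights_of_le (hkp.noncompact_subset hβp) (hle.trans h1)
    rw [h2] at hlow
    exact hlow.unique (hex.simple.linearIndependent.mono Set.sdiff_subset) hη
  · rintro rfl
    refine ⟨hkp.isotypicPart (Φk \ {φ}) lam, hkp.isotypicPart_le_p _ _,
      hkp.isIrreducible_isotypicPart hex hη, ?_, ?_⟩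
    · rw [hweights]
      exact hex.isHighest
    · rw [hweights]
      exact hη

end IsSymmetricPair

end LeviModules

/-! ### Real forms and complexification -/

section Complexification

variable {g₀ : Type*} [LieRing g₀] [LieAlgebra ℝ g₀]

theorem exists_eq_tmul_add_tmul (x : ℂ ⊗[ℝ] g₀) :
    ∃ a b : g₀, x = (1 : ℂ) ⊗ₜ[ℝ] a + Complex.I ⊗ₜ[ℝ] b := by
  induction x using TensorProduct.induction_on with
  | zero => exact ⟨0, 0, by simp⟩
  | tmul z a =>
    refine ⟨z.re • a, z.im • a, ?_⟩
    rw [TensorProduct.tmul_smul, TensorProduct.tmul_smul, TensorProduct.smul_tmul',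
      TensorProduct.smul_tmul', ← TensorProduct.add_tmul]
    congr 1
    rw [Complex.real_smul, Complex.real_smul, mul_one, Complex.re_add_im]
  | add x y hx hy =>
    obtain ⟨a, b, rfl⟩ := hx
    obtain ⟨c, d, rfl⟩ := hy
    exact ⟨a + c, b + d, by rw [TensorProduct.tmul_add, TensorProduct.tmul_add]; abel⟩

theorem eq_zero_of_tmul_add_tmul {a b : g₀}
    (h : (1 : ℂ) ⊗ₜ[ℝ] a + Complex.I ⊗ₜ[ℝ] b = 0) : a = 0 ∧ b = 0 := by
  constructor
  · have := congrArg ((TensorProduct.lid ℝ g₀).toLinearMap ∘ₗ LinearMap.rTensor g₀ Complex.reLm) h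
    simpa using this
  · have := congrArg ((TensorProduct.lid ℝ g₀).toLinearMap ∘ₗ LinearMap.rTensor g₀ Complex.imLm) h
    simpa using this

theorem mem_baseChange_iff {V : Submodule ℝ g₀} {a b : g₀} :
    (1 : ℂ) ⊗ₜ[ℝ] a + Complex.I ⊗ₜ[ℝ] b ∈ V.baseChange ℂ ↔ a ∈ V ∧ b ∈ V := by
  constructor
  · intro h
    rw [Submodule.baseChange_eq_span] at h
    have key : ∀ x ∈ Submodule.span ℂ (V.map (TensorProduct.mk ℝ ℂ g₀ 1) : Set (ℂ ⊗[ℝ] g₀)),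
        ∃ a ∈ V, ∃ b ∈ V, x = (1 : ℂ) ⊗ₜ[ℝ] a + Complex.I ⊗ₜ[ℝ] b := by
      intro x hx
      induction hx using Submodule.span_induction with
      | mem x hx =>
        obtain ⟨a, ha, rfl⟩ := hx
        exact ⟨a, ha, 0, V.zero_mem, by simp⟩
      | zero => exact ⟨0, V.zero_mem, 0, V.zero_mem, by simp⟩
      | add x y _ _ hx hy =>
        obtain ⟨a, ha, b, hb, rfl⟩ := hx
        obtain ⟨c, hc, d, hd, rfl⟩ := hy
        exact ⟨a + c, add_mem ha hc, b + d, add_mem hb hd, by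
          rw [TensorProduct.tmul_add, TensorProduct.tmul_add]; abel⟩
      | smul z x _ hx =>
        obtain ⟨a, ha, b, hb, rfl⟩ := hx
        refine ⟨z.re • a - z.im • b, sub_mem (V.smul_mem _ ha) (V.smul_mem _ hb),
          z.im • a + z.re • b, add_mem (V.smul_mem _ ha) (V.smul_mem _ hb), ?_⟩
        have hz : z = (z.re : ℂ) + z.im * Complex.I := (Complex.re_add_im z).symm
        have h1 : (z.im : ℂ) * Complex.I * Complex.I = -(z.im : ℂ) := by
          rw [mul_assoc, Complex.I_mul_I, mul_neg_one]
        have h2 : ∀ (r : ℝ) (v : g₀), (1 : ℂ) ⊗ₜ[ℝ] (r • v) = (r : ℂ) ⊗ₜ[ℝ] v := fun r v => by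
          rw [TensorProduct.tmul_smul, TensorProduct.smul_tmul', Complex.real_smul, mul_one]
        have h3 : ∀ (r : ℝ) (v : g₀), Complex.I ⊗ₜ[ℝ] (r • v) = ((r : ℂ) * Complex.I) ⊗ₜ[ℝ] v :=
          fun r v => by
            rw [TensorProduct.tmul_smul, TensorProduct.smul_tmul', Complex.real_smul]
        rw [TensorProduct.tmul_sub, TensorProduct.tmul_add, h2, h2, h3, h3, smul_add,
          TensorProduct.smul_tmul', TensorProduct.smul_tmul', smul_eq_mul, smul_eq_mul, mul_one]
        nth_rewrite 1 2 [hz]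
        rw [add_mul, h1, TensorProduct.add_tmul, TensorProduct.add_tmul, TensorProduct.neg_tmul]
        abel
    obtain ⟨c, hc, d, hd, he⟩ := key _ h
    have h0 : (1 : ℂ) ⊗ₜ[ℝ] (a - c) + Complex.I ⊗ₜ[ℝ] (b - d) = 0 := by
      rw [TensorProduct.tmul_sub, TensorProduct.tmul_sub, sub_add_sub_comm, he, sub_self]
    obtain ⟨h1, h2⟩ := eq_zero_of_tmul_add_tmul h0
    rw [sub_eq_zero.1 h1, sub_eq_zero.1 h2]
    exact ⟨hc, hd⟩
  · rintro ⟨ha, hb⟩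
    exact add_mem (Submodule.tmul_mem_baseChange_of_mem _ ha)
      (Submodule.tmul_mem_baseChange_of_mem _ hb)

theorem lie_tmul_add_tmul (a b c d : g₀) :
    ⁅(1 : ℂ) ⊗ₜ[ℝ] a + Complex.I ⊗ₜ[ℝ] b, (1 : ℂ) ⊗ₜ[ℝ] c + Complex.I ⊗ₜ[ℝ] d⁆ =
      (1 : ℂ) ⊗ₜ[ℝ] (⁅a, c⁆ - ⁅b, d⁆) + Complex.I ⊗ₜ[ℝ] (⁅a, d⁆ + ⁅b, c⁆) := by
  simp only [add_lie, lie_add, LieAlgebra.ExtendScalars.bracket_tmul, mul_one, one_mul,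
    Complex.I_mul_I, TensorProduct.tmul_sub, TensorProduct.tmul_add, TensorProduct.neg_tmul]
  abel

theorem lie_one_tmul (z a b : g₀) :
    ⁅(1 : ℂ) ⊗ₜ[ℝ] z, (1 : ℂ) ⊗ₜ[ℝ] a + Complex.I ⊗ₜ[ℝ] b⁆ =
      (1 : ℂ) ⊗ₜ[ℝ] ⁅z, a⁆ + Complex.I ⊗ₜ[ℝ] ⁅z, b⁆ := by
  simpa using lie_tmul_add_tmul z 0 a b

theorem lie_mem_baseChange {U V W : Submodule ℝ g₀} (hVW : ∀ x ∈ V, ∀ y ∈ W, ⁅x, y⁆ ∈ U)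
    {x y : ℂ ⊗[ℝ] g₀} (hx : x ∈ V.baseChange ℂ) (hy : y ∈ W.baseChange ℂ) :
    ⁅x, y⁆ ∈ U.baseChange ℂ := by
  obtain ⟨a, b, rfl⟩ := exists_eq_tmul_add_tmul x
  obtain ⟨c, d, rfl⟩ := exists_eq_tmul_add_tmul y
  rw [mem_baseChange_iff] at hx hy
  rw [lie_tmul_add_tmul, mem_baseChange_iff]
  exact ⟨sub_mem (hVW _ hx.1 _ hy.1) (hVW _ hx.2 _ hy.2),
    add_mem (hVW _ hx.1 _ hy.2) (hVW _ hx.2 _ hy.1)⟩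

theorem isCompl_baseChange {V W : Submodule ℝ g₀} (hVW : IsCompl V W) :
    IsCompl (V.baseChange ℂ) (W.baseChange ℂ) := by
  refine ⟨Submodule.disjoint_def.2 fun x hx hx' => ?_, codisjoint_iff.2 (eq_top_iff.2 ?_)⟩
  · obtain ⟨a, b, rfl⟩ := exists_eq_tmul_add_tmul x
    rw [mem_baseChange_iff] at hx hx'
    rw [Submodule.disjoint_def.1 hVW.disjoint a hx.1 hx'.1,
      Submodule.disjoint_def.1 hVW.disjoint b hx.2 hx'.2]
    simp
  · rintro x -
    obtain ⟨a, b, rfl⟩ := exists_eq_tmul_add_tmul x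
    obtain ⟨a₁, ha₁, a₂, ha₂, rfl⟩ := Submodule.mem_sup.1
      (hVW.sup_eq_top ▸ Submodule.mem_top : a ∈ V ⊔ W)
    obtain ⟨b₁, hb₁, b₂, hb₂, rfl⟩ := Submodule.mem_sup.1
      (hVW.sup_eq_top ▸ Submodule.mem_top : b ∈ V ⊔ W)
    refine Submodule.mem_sup.2 ⟨_, mem_baseChange_iff.2 ⟨ha₁, hb₁⟩, _,
      mem_baseChange_iff.2 ⟨ha₂, hb₂⟩, ?_⟩
    rw [TensorProduct.tmul_add, TensorProduct.tmul_add]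
    abel

theorem isKilling_complexification [FiniteDimensional ℝ g₀] [LieAlgebra.IsKilling ℝ g₀] :
    LieAlgebra.IsKilling ℂ (ℂ ⊗[ℝ] g₀) where
  killingCompl_top_eq_bot := by
    rw [LieSubmodule.eq_bot_iff]
    intro x hx
    rw [LieIdeal.mem_killingCompl] at hx
    obtain ⟨a, b, rfl⟩ := exists_eq_tmul_add_tmul x
    have key : ∀ c, killingForm ℝ g₀ a c = 0 ∧ killingForm ℝ g₀ b c = 0 := by
      intro c
      have h1 := hx (1 ⊗ₜ c) trivial
      rw [LieModule.traceForm_comm] at h1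
      change LieModule.traceForm ℂ (ℂ ⊗[ℝ] g₀) (ℂ ⊗[ℝ] g₀) _ _ = 0 at h1
      rw [LieModule.traceForm_baseChange] at h1
      rw [map_add, LinearMap.add_apply, LinearMap.BilinForm.baseChange_tmul,
        LinearMap.BilinForm.baseChange_tmul, mul_one, mul_one, Complex.real_smul,
        Complex.real_smul, mul_one] at h1
      have h2 := congrArg Complex.re h1
      have h3 := congrArg Complex.im h1
      simp only [Complex.add_re, Complex.add_im, Complex.ofReal_re, Complex.ofReal_im,
        Complex.re_ofReal_mul, Complex.im_ofReal_mul, Complex.I_re, Complex.I_im, mul_zero, mul_one,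
        add_zero, zero_add, Complex.zero_re, Complex.zero_im] at h2 h3
      exact ⟨h2, h3⟩
    have hsep : ∀ a, (∀ c, killingForm ℝ g₀ a c = 0) → a = 0 := fun a ha =>
      (LieAlgebra.IsKilling.killingForm_nondegenerate ℝ g₀).1 a ha
    rw [hsep a fun c => (key c).1, hsep b fun c => (key c).2]
    simp

end Complexification

/-! ### Cartan involutions and the equal rank condition -/

section CartanInvolution

variable {g₀ : Type*} [LieRing g₀] [LieAlgebra ℝ g₀]

/-- The abelian subalgebra underlying a subspace of commuting elements. -/
def LieSubalgebra.ofCommute (V : Submodule ℝ g₀) (hV : ∀ x ∈ V, ∀ y ∈ V, ⁅x, y⁆ = 0) :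
    LieSubalgebra ℝ g₀ :=
  { V with lie_mem' := fun {x y} hx hy => (hV x hx y hy).symm ▸ V.zero_mem }

theorem LieSubalgebra.isLieAbelian_iff_forall {s : LieSubalgebra ℝ g₀} :
    IsLieAbelian s ↔ ∀ x ∈ s, ∀ y ∈ s, ⁅x, y⁆ = 0 := by
  constructor
  · intro _ x hx y hy
    exact congrArg Subtype.val (trivial_lie_zero s s ⟨x, hx⟩ ⟨y, hy⟩)
  · exact fun h => ⟨fun x y => Subtype.ext (h x x.2 y y.2)⟩

theorem lie_eq_zero_of_mem_sup_span {s : Submodule ℝ g₀} (hs : ∀ x ∈ s, ∀ y ∈ s, ⁅x, y⁆ = 0)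
    {z : g₀} (hz : ∀ x ∈ s, ⁅x, z⁆ = 0) :
    ∀ x ∈ s ⊔ Submodule.span ℝ {z}, ∀ y ∈ s ⊔ Submodule.span ℝ {z}, ⁅x, y⁆ = 0 := by
  intro x hx y hy
  obtain ⟨x₁, hx₁, x₂, hx₂, rfl⟩ := Submodule.mem_sup.1 hx
  obtain ⟨y₁, hy₁, y₂, hy₂, rfl⟩ := Submodule.mem_sup.1 hy
  obtain ⟨c, rfl⟩ := Submodule.mem_span_singleton.1 hx₂
  obtain ⟨d, rfl⟩ := Submodule.mem_span_singleton.1 hy₂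
  simp [hs x₁ hx₁ y₁ hy₁, hz x₁ hx₁, ← lie_skew z y₁, hz y₁ hy₁]

namespace IsCartanInvolution

variable {θ : g₀ ≃ₗ⁅ℝ⁆ g₀} (hθ : IsCartanInvolution θ)
include hθ

theorem isKilling : LieAlgebra.IsKilling ℝ g₀ where
  killingCompl_top_eq_bot := by
    rw [LieSubmodule.eq_bot_iff]
    intro x hx
    rw [LieIdeal.mem_killingCompl] at hx
    by_contra hx0
    have h1 := hx (θ x) trivial
    rw [LieModule.traceForm_comm] at h1
    exact (hθ.killing_neg x hx0).ne h1

/-- The elements of `k₀` and `p₀` act by skew-symmetric and symmetric operators for the inner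
product `-B(x, θ y)`, so their adjoint operators are semisimple. -/
theorem lie_eq_zero_of_lie_lie_eq_zero {z x : g₀} (hz : θ z = z ∨ θ z = -z)
    (hzx : ⁅z, ⁅z, x⁆⁆ = 0) : ⁅z, x⁆ = 0 := by
  by_contra h0
  refine (hθ.killing_neg _ h0).ne ?_
  have h1 : killingForm ℝ g₀ ⁅z, x⁆ ⁅z, θ x⁆ = 0 := by
    rw [← LieModule.traceForm_apply_lie_apply, ← lie_skew, hzx]
    simp
  rw [LieEquiv.map_lie]
  rcases hz with hz | hz
  · rw [hz, h1]
  · rw [hz, neg_lie, map_neg, h1, neg_zero]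

theorem isCompl : IsCompl (fixedSubalgebra θ).toSubmodule (antifixedSubspace θ) := by
  refine ⟨Submodule.disjoint_def.2 fun x hx hx' => ?_, codisjoint_iff.2 (eq_top_iff.2 ?_)⟩
  · have h1 : θ x = x := hx
    have h2 : θ x = -x := hx'
    have h3 : (2 : ℝ) • x = 0 := by
      rw [two_smul]
      nth_rewrite 1 [h1.symm.trans h2]
      exact neg_add_cancel x
    exact (smul_eq_zero.1 h3).resolve_left two_ne_zero
  · rintro x -
    refine Submodule.mem_sup.2 ⟨(1 / 2 : ℝ) • (x + θ x), ?_, (1 / 2 : ℝ) • (x - θ x), ?_, ?_⟩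
    · change θ _ = _
      rw [map_smul, map_add, hθ.involutive, add_comm]
    · change θ _ = _
      rw [map_smul, map_sub, hθ.involutive, ← smul_neg, neg_sub]
    · rw [← smul_add, add_add_sub_cancel, ← two_smul ℝ x, smul_smul]
      norm_num

theorem lie_mem_antifixed : ∀ x ∈ (fixedSubalgebra θ).toSubmodule, ∀ y ∈ antifixedSubspace θ,
    ⁅x, y⁆ ∈ antifixedSubspace θ := by
  intro x (hx : θ x = x) y (hy : θ y = -y)
  change θ _ = _
  rw [LieEquiv.map_lie, hx, hy, lie_neg]

theorem lie_mem_fixed : ∀ x ∈ antifixedSubspace θ, ∀ y ∈ antifixedSubspace θ,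
    ⁅x, y⁆ ∈ (fixedSubalgebra θ).toSubmodule := by
  intro x (hx : θ x = -x) y (hy : θ y = -y)
  change θ _ = _
  rw [LieEquiv.map_lie, hx, hy, lie_neg, neg_lie, neg_neg]

variable {t₀ : LieSubalgebra ℝ g₀} (ht₀ : IsMaximalAbelianIn (fixedSubalgebra θ) t₀)
include ht₀

theorem mem_of_commute_of_fixed {x : g₀} (hx : θ x = x) (hxt : ∀ z ∈ t₀, ⁅z, x⁆ = 0) : x ∈ t₀ := by
  have hab := LieSubalgebra.isLieAbelian_iff_forall.1 ht₀.prop.2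
  have hcomm := lie_eq_zero_of_mem_sup_span (s := t₀.toSubmodule) hab hxt
  have hle : t₀ ≤ LieSubalgebra.ofCommute _ hcomm := fun z hz => Submodule.mem_sup_left hz
  refine ht₀.le_of_ge ⟨?_, LieSubalgebra.isLieAbelian_iff_forall.2 hcomm⟩ hle
    (Submodule.mem_sup_right (Submodule.mem_span_singleton_self x))
  change t₀.toSubmodule ⊔ Submodule.span ℝ {x} ≤ (fixedSubalgebra θ).toSubmodule
  refine sup_le ht₀.prop.1 ?_
  rw [Submodule.span_le, Set.singleton_subset_iff]
  exact hx

/-- A maximal abelian subalgebra of `k₀` is a Cartan subalgebra of `k₀`, so its dimension is the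
rank. -/
theorem finrank_of_hasRank_fixed {r : ℕ} (hr : HasRank (fixedSubalgebra θ) r) :
    Module.finrank ℝ t₀ = r := by
  have hab := LieSubalgebra.isLieAbelian_iff_forall.1 ht₀.prop.2
  let H : LieSubalgebra ℝ (fixedSubalgebra θ) := t₀.comap (fixedSubalgebra θ).incl
  have hcartan : H.IsCartanSubalgebra := by
    have hH : IsLieAbelian H :=
      ⟨fun x y => Subtype.ext (Subtype.ext (hab _ x.2 _ y.2))⟩
    refine ⟨inferInstance, le_antisymm (fun x hx => ?_) H.le_normalizer⟩
    rw [LieSubalgebra.mem_normalizer_iff'] at hx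
    refine hθ.mem_of_commute_of_fixed ht₀ x.2 fun z hz => ?_
    refine hθ.lie_eq_zero_of_lie_lie_eq_zero (Or.inl (ht₀.prop.1 hz)) ?_
    exact hab z hz _ (hx ⟨z, ht₀.prop.1 hz⟩ hz)
  rw [← hr H hcartan]
  exact (Submodule.comapSubtypeEquivOfLe (p := t₀.toSubmodule)
    (q := (fixedSubalgebra θ).toSubmodule) ht₀.prop.1).finrank_eq.symm

variable [FiniteDimensional ℝ g₀]

/-- The equal rank condition: the centralizer of `t₀` in `g₀` is `t₀`. Indeed a maximal `θ`-stable
abelian subalgebra containing `t₀` is a Cartan subalgebra of `g₀`, and it has the dimension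
of `t₀`. -/
theorem mem_of_commute {r : ℕ} (hr : HasRank g₀ r) (hr' : HasRank (fixedSubalgebra θ) r) {x : g₀}
    (hxt : ∀ z ∈ t₀, ⁅z, x⁆ = 0) : x ∈ t₀ := by
  have hab := LieSubalgebra.isLieAbelian_iff_forall.1 ht₀.prop.2
  let C : Set (Submodule ℝ g₀) := {s | t₀.toSubmodule ≤ s ∧ (∀ x ∈ s, θ x ∈ s) ∧
    ∀ x ∈ s, ∀ y ∈ s, ⁅x, y⁆ = 0}
  have hC : t₀.toSubmodule ∈ C :=
    ⟨le_rfl, fun x hx => by rw [show θ x = x from ht₀.prop.1 hx]; exact hx, hab⟩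
  obtain ⟨s, hs⟩ : ∃ s, Maximal (· ∈ C) s := by
    obtain ⟨s, hs, hmax⟩ := wellFounded_gt.has_min C ⟨_, hC⟩
    exact ⟨s, hs, fun u hu hle => by
      by_contra hn
      exact hmax u hu (lt_of_le_not_ge hle hn)⟩
  obtain ⟨hts, hsθ, hsab⟩ := hs.prop
  have hadd : ∀ z, (θ z = z ∨ θ z = -z) → (∀ x ∈ s, ⁅x, z⁆ = 0) → z ∈ s := by
    intro z hz hzs
    refine hs.le_of_ge (y := s ⊔ Submodule.span ℝ {z}) ⟨hts.trans le_sup_left, ?_,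
      lie_eq_zero_of_mem_sup_span hsab hzs⟩ le_sup_left
      (Submodule.mem_sup_right (Submodule.mem_span_singleton_self z))
    intro x hx
    obtain ⟨y, hy, u, hu, rfl⟩ := Submodule.mem_sup.1 hx
    obtain ⟨c, rfl⟩ := Submodule.mem_span_singleton.1 hu
    rw [map_add, map_smul]
    refine add_mem (Submodule.mem_sup_left (hsθ y hy)) (Submodule.mem_sup_right ?_)
    refine Submodule.smul_mem _ _ ?_
    rcases hz with hz | hz
    · rw [hz]
      exact Submodule.mem_span_singleton_self z
    · rw [hz]
      exact neg_mem (Submodule.mem_span_singleton_self z)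
  have hcent : ∀ z, (∀ x ∈ s, ⁅x, z⁆ = 0) → z ∈ s := by
    intro z hz
    have hθz : ∀ x ∈ s, ⁅x, θ z⁆ = 0 := by
      intro x hx
      have := congrArg θ (hz (θ x) (hsθ x hx))
      rwa [LieEquiv.map_lie, hθ.involutive, map_zero] at this
    have h1 : z + θ z ∈ s := by
      refine hadd _ (Or.inl ?_) fun x hx => by rw [lie_add, hz x hx, hθz x hx, add_zero]
      rw [map_add, hθ.involutive, add_comm]
    have h2 : z - θ z ∈ s := by
      refine hadd _ (Or.inr ?_) fun x hx => by rw [lie_sub, hz x hx, hθz x hx, sub_zero]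
      rw [map_sub, hθ.involutive, neg_sub]
    have h3 := s.smul_mem (1 / 2 : ℝ) (add_mem h1 h2)
    rw [add_add_sub_cancel, ← two_smul ℝ z, smul_smul] at h3
    norm_num at h3
    exact h3
  let H := LieSubalgebra.ofCommute s hsab
  have hcartan : H.IsCartanSubalgebra := by
    have hH : IsLieAbelian H := LieSubalgebra.isLieAbelian_iff_forall.2 hsab
    refine ⟨inferInstance, le_antisymm (fun x hx => ?_) H.le_normalizer⟩
    rw [LieSubalgebra.mem_normalizer_iff'] at hx
    have key : ∀ z ∈ s, (θ z = z ∨ θ z = -z) → ⁅z, x⁆ = 0 := fun z hz hzθ =>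
      hθ.lie_eq_zero_of_lie_lie_eq_zero hzθ (hsab z hz _ (hx z hz))
    refine hcent x fun z hz => ?_
    have h1 := key (z + θ z) (add_mem hz (hsθ z hz))
      (Or.inl (by rw [map_add, hθ.involutive, add_comm]))
    have h2 := key (z - θ z) (sub_mem hz (hsθ z hz))
      (Or.inr (by rw [map_sub, hθ.involutive, neg_sub]))
    have h3 : (2 : ℝ) • ⁅z, x⁆ = 0 := by
      rw [← add_zero (0 : g₀)]
      nth_rewrite 1 [← h1]
      rw [← h2, ← add_lie, add_add_sub_cancel, ← two_smul ℝ z, smul_lie]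
    exact (smul_eq_zero.1 h3).resolve_left two_ne_zero
  have hst : t₀.toSubmodule = s := by
    refine Submodule.eq_of_le_of_finrank_eq hts ?_
    exact (hθ.finrank_of_hasRank_fixed ht₀ hr').trans (hr H hcartan).symm
  have : x ∈ t₀.toSubmodule := by
    rw [hst]
    exact hcent x fun z hz => hxt z (show z ∈ t₀.toSubmodule from hst ▸ hz)
  exact this

/-- If the ranks of `g₀` and `k₀` are equal, the complexification of `t₀` is a Cartan subalgebra. -/
theorem isCartanSubalgebra {r : ℕ} (hr : HasRank g₀ r) (hr' : HasRank (fixedSubalgebra θ) r)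
    {h : LieSubalgebra ℂ (ℂ ⊗[ℝ] g₀)} (hh : h.toSubmodule = t₀.toSubmodule.baseChange ℂ) :
    h.IsCartanSubalgebra := by
  have hab := LieSubalgebra.isLieAbelian_iff_forall.1 ht₀.prop.2
  have hmem : ∀ {x}, x ∈ h ↔ x ∈ t₀.toSubmodule.baseChange ℂ := fun {x} => by rw [← hh]; rfl
  have habh : ∀ x ∈ h, ∀ y ∈ h, ⁅x, y⁆ = 0 := by
    intro x hx y hy
    have := lie_mem_baseChange (U := ⊥) (fun x hx y hy => (Submodule.mem_bot ℝ).2 (hab x hx y hy))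
      (hmem.1 hx) (hmem.1 hy)
    rwa [Submodule.baseChange_bot, Submodule.mem_bot] at this
  have hH : IsLieAbelian h := ⟨fun x y => Subtype.ext (habh x x.2 y y.2)⟩
  refine ⟨inferInstance, le_antisymm (fun x hx => ?_) h.le_normalizer⟩
  rw [LieSubalgebra.mem_normalizer_iff'] at hx
  obtain ⟨a, b, rfl⟩ := exists_eq_tmul_add_tmul x
  have key : ∀ z ∈ t₀, ⁅z, ⁅z, a⁆⁆ = 0 ∧ ⁅z, ⁅z, b⁆⁆ = 0 := by
    intro z hz
    have hz' : (1 : ℂ) ⊗ₜ[ℝ] z ∈ h := hmem.2 (Submodule.tmul_mem_baseChange_of_mem 1 hz)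
    have h1 := habh _ hz' _ (hx _ hz')
    rw [lie_one_tmul, lie_one_tmul] at h1
    exact eq_zero_of_tmul_add_tmul h1
  rw [hmem, mem_baseChange_iff]
  refine ⟨hθ.mem_of_commute ht₀ hr hr' fun z hz => ?_,
    hθ.mem_of_commute ht₀ hr hr' fun z hz => ?_⟩
  · exact hθ.lie_eq_zero_of_lie_lie_eq_zero (Or.inl (ht₀.prop.1 hz)) (key z hz).1
  · exact hθ.lie_eq_zero_of_lie_lie_eq_zero (Or.inl (ht₀.prop.1 hz)) (key z hz).2

theorem isSymmetricPair {h k : LieSubalgebra ℂ (ℂ ⊗[ℝ] g₀)} {p : Submodule ℂ (ℂ ⊗[ℝ] g₀)}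
    (hh : h.toSubmodule = t₀.toSubmodule.baseChange ℂ)
    (hk : k.toSubmodule = (fixedSubalgebra θ).toSubmodule.baseChange ℂ)
    (hp : p = (antifixedSubspace θ).baseChange ℂ) : IsSymmetricPair h k p where
  le := by
    change h.toSubmodule ≤ k.toSubmodule
    rw [hh, hk]
    intro x hx
    obtain ⟨a, b, rfl⟩ := exists_eq_tmul_add_tmul x
    rw [mem_baseChange_iff] at hx ⊢
    exact ⟨ht₀.prop.1 hx.1, ht₀.prop.1 hx.2⟩
  isCompl := by
    rw [hk, hp]
    exact isCompl_baseChange hθ.isCompl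
  lie_mem_p x hx y hy := by
    rw [← LieSubalgebra.mem_toSubmodule, hk] at hx
    rw [hp] at hy ⊢
    exact lie_mem_baseChange hθ.lie_mem_antifixed hx hy
  lie_mem_k x hx y hy := by
    rw [← LieSubalgebra.mem_toSubmodule, hk]
    rw [hp] at hx hy
    exact lie_mem_baseChange hθ.lie_mem_fixed hx hy

end IsCartanInvolution

end CartanInvolution

/-! ### Borel-de Siebenthal positive systems -/

section BorelDeSiebenthal

variable {g : Type*} [LieRing g] [LieAlgebra ℂ g] [FiniteDimensional ℂ g]
  [LieAlgebra.IsKilling ℂ g] {h k : LieSubalgebra ℂ g} [h.IsCartanSubalgebra] {p : Submodule ℂ g}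

/-- For semisimple `k`, the Borel-de Siebenthal systems are the positive systems of the bases with
one noncompact root `ν`, whose coefficient in the highest root is `2`. -/
theorem IsBorelDeSiebenthal.exists_isGradedBase (hss : LieAlgebra.IsSemisimple ℂ k)
    {P : Set (Module.Dual ℂ h)} (hP : IsBorelDeSiebenthal h k p P) :
    ∃ ν δ, IsGradedBase (roots h ⊤) (roots h p) (simpleRoots P) ν δ ∧
      P = {α | α ∈ roots h ⊤ ∧ α ∈ AddSubmonoid.closure (simpleRoots P)} := by
  obtain ⟨⟨Φ, hΦ, rfl⟩, ν, δ, hν, hδ, -, h2⟩ := hP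
  rw [isRootSet_roots.simpleRoots_eq hΦ] at *
  exact ⟨ν, δ, ⟨hΦ, hν, hδ, h2 hss⟩, rfl⟩

theorem IsGradedBase.isBorelDeSiebenthal (hss : LieAlgebra.IsSemisimple ℂ k)
    {Φ : Set (Module.Dual ℂ h)} {ν δ : Module.Dual ℂ h}
    (hΦ : IsGradedBase (roots h ⊤) (roots h p) Φ ν δ) :
    IsBorelDeSiebenthal h k p {α | α ∈ roots h ⊤ ∧ α ∈ AddSubmonoid.closure Φ} := by
  refine ⟨⟨Φ, hΦ.simple, rfl⟩, ν, δ, ?_⟩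
  rw [isRootSet_roots.simpleRoots_eq hΦ.simple]
  exact ⟨hΦ.inter_eq, hΦ.highest, fun hc => absurd (LieAlgebra.center_eq_bot ℂ k) hc,
    fun _ => hΦ.coeff⟩

end BorelDeSiebenthal

theorem theorem1p1
    -- a real simple Lie algebra with a Cartan decomposition, of equal rank
    {g₀ : Type*} [LieRing g₀] [LieAlgebra ℝ g₀] [FiniteDimensional ℝ g₀] [LieAlgebra.IsSimple ℝ g₀]
    (θ : g₀ ≃ₗ⁅ℝ⁆ g₀) (hθ : IsCartanInvolution θ)
    (hrank : ∃ r : ℕ, HasRank g₀ r ∧ HasRank (fixedSubalgebra θ) r)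
    (t₀ : LieSubalgebra ℝ g₀) (ht₀ : IsMaximalAbelianIn (fixedSubalgebra θ) t₀)
    -- the complexifications of `t₀`, `k₀`, `p₀` in `g = ℂ ⊗ g₀`
    (h k : LieSubalgebra ℂ (ℂ ⊗[ℝ] g₀)) (p : Submodule ℂ (ℂ ⊗[ℝ] g₀))
    (hh : h.toSubmodule = t₀.toSubmodule.baseChange ℂ)
    (hk : k.toSubmodule = (fixedSubalgebra θ).toSubmodule.baseChange ℂ)
    (hp : p = (antifixedSubspace θ).baseChange ℂ)
    (hss : LieAlgebra.IsSemisimple ℂ k)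
    -- a positive system of the compact roots, and a Borel-de Siebenthal system containing it
    (Pk P : Set (Module.Dual ℂ h))
    (hPk : IsPositiveSystem (roots h k.toSubmodule) Pk)
    (hP : IsBorelDeSiebenthal h k p P) (hPkP : Pk ⊆ P)
    (Φk Φ Φ₀ : Set (Module.Dual ℂ h)) (ν δ lam : Module.Dual ℂ h)
    (hΦk : Φk = simpleRoots Pk) (hΦ : Φ = simpleRoots P)
    (hν : Φ ∩ roots h p = {ν}) (hδ : IsHighest Φ (roots h ⊤) δ)
    (hΦ₀ : Φ₀ = Φ \ {ν})
    -- the Levi subalgebra `l₀`, its positive system `P₀`, and the longest element of its Weyl group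
    (l₀ : LieSubalgebra ℂ (ℂ ⊗[ℝ] g₀)) (hl₀ : l₀ = leviSubalgebra h ⊤ Φ₀)
    (P₀ : Set (Module.Dual ℂ h)) (hP₀ : P₀ = roots h l₀.toSubmodule ∩ Pk)
    (w₀ : Module.Dual ℂ h ≃ₗ[ℂ] Module.Dual ℂ h)
    (hw₀ : IsLongestElement (weylGroup h (roots h l₀.toSubmodule)) P₀ w₀)
    (hlam : lam = w₀ ν) :
    (∀ φ' ∈ Φ₀, HasCoeff Φ φ' δ 1 →
      (∃ φ ∈ Φ₀, w₀ φ' = -φ) ∧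
      ∀ φ ∈ Φ₀, w₀ φ' = -φ →
        (∃ ν', IsLowestWeightOfSubmodule h k p (Φk \ {φ}) lam ν') ∧
        ∀ ν', IsLowestWeightOfSubmodule h k p (Φk \ {φ}) lam ν' →
          ∃ P', IsBorelDeSiebenthal h k p P' ∧ Pk ⊆ P' ∧ simpleRoots P' = (Φk \ {φ}) ∪ {ν'}) ∧
    (∀ P', IsBorelDeSiebenthal h k p P' → Pk ⊆ P' →
      P' = P ∨
      ∃ φ' ∈ Φ₀, HasCoeff Φ φ' δ 1 ∧ ∃ φ ∈ Φ₀, w₀ φ' = -φ ∧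
        ∃ ν', IsLowestWeightOfSubmodule h k p (Φk \ {φ}) lam ν' ∧
          simpleRoots P' = (Φk \ {φ}) ∪ {ν'}) := by
  obtain ⟨r, hr, hr'⟩ := hrank
  have := hθ.isKilling
  have := isKilling_complexification (g₀ := g₀)
  have := hθ.isCartanSubalgebra ht₀ hr hr' hh
  have hkp := hθ.isSymmetricPair ht₀ hh hk hp
  have hΔ := isRootSet_roots (h := h)
  have hn := hkp.isNoncompactPart
  have hrefl : ∀ α ∈ roots h ⊤, ∃ s, IsRootReflection (roots h ⊤) α s := fun α hα =>
    (exists_weylGroup_reflection subset_rfl hα).imp fun _ hs => hs.2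
  -- the given data form a graded base
  obtain ⟨ν₁, δ₁, hbase, hPeq⟩ := hP.exists_isGradedBase hss
  rw [← hΦ] at hbase hPeq
  obtain rfl : ν₁ = ν := by
    rw [← Set.singleton_eq_singleton_iff, ← hbase.inter_eq, hν]
  obtain rfl : δ₁ = δ := hbase.highest.unique hbase.simple.linearIndependent hδ
  rw [hkp.roots_compact_eq] at hPk
  have hsimple : IsSimpleSystem (roots h ⊤ \ roots h p) Φk ∧
      Pk = {α | α ∈ roots h ⊤ \ roots h p ∧ α ∈ AddSubmonoid.closure Φk} := by
    obtain ⟨Φ', hΦ', rfl⟩ := hPk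
    rw [(hn.isRootSet_compact hΔ).simpleRoots_eq hΦ'] at hΦk
    subst hΦk
    exact ⟨hΦ', rfl⟩
  obtain ⟨hsimple, hPkeq⟩ := hsimple
  have hΦkPk : Φk ⊆ Pk := by rw [hΦk]; exact fun α hα => hα.1
  have hsub : Φk ⊆ AddSubmonoid.closure Φ := fun α hα => by
    have := hPkP (hΦkPk hα)
    rw [hPeq] at this
    exact this.2
  subst hΦ₀ hl₀ hlam
  -- the element `w₀` is the opposition of the Levi subalgebra
  have hroots := roots_leviSubalgebra hbase.simple (Ψ := Φ \ {ν₁}) Set.sdiff_subset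
  have hP₀eq : P₀ = {α | (α ∈ roots h ⊤ ∧ α ∈ AddSubgroup.closure (Φ \ {ν₁})) ∧
      α ∈ AddSubmonoid.closure (Φ \ {ν₁})} := by
    rw [hP₀, hroots]
    ext α
    constructor
    · rintro ⟨hα, hαk⟩
      refine ⟨hα, hbase.simple.linearIndependent.mem_closure_of_mem_span Set.sdiff_subset ?_
        (addSubgroupClosure_le_span α hα.2)⟩
      have := hPkP hαk
      rw [hPeq] at this
      exact this.2
    · rintro ⟨hα, hpos⟩
      refine ⟨hα, ?_⟩
      obtain ⟨f, hf⟩ := hbase.simple.exists_isCoord hbase.mem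
      have hαn : α ∉ roots h p := by
        intro hαn
        have h1 := hbase.coord_noncompact hΔ hn hf hαn
        rw [hf.eq_zero hα.2] at h1
        norm_num at h1
      rw [hPkeq]
      refine ⟨⟨hα.1, hαn⟩, (hsimple.mem_or_neg_mem α ⟨hα.1, hαn⟩).resolve_right fun hneg => ?_⟩
      have hcl : AddSubmonoid.closure Φk ≤ AddSubmonoid.closure Φ := AddSubmonoid.closure_le.2 hsub
      exact hα.1.1 (hbase.simple.linearIndependent.eq_zero_of_mem_of_neg_mem
        (AddSubmonoid.closure_mono Set.sdiff_subset hpos) (hcl hneg))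
  rw [hP₀eq, hroots] at hw₀
  obtain ⟨hw, hw'⟩ := hΔ.isOpposition_of_isLongest hbase.isSimpleSystem_diff
    (weylGroup_le_reflectionGroup fun α hα => hα.1)
    (fun ψ hψ => exists_weylGroup_reflection (fun α hα => hα.1)
      ⟨hbase.simple.subset hψ.1, AddSubgroup.subset_closure hψ⟩) hw₀
  constructor
  · intro φ' hφ' hcoeff
    refine ⟨?_, fun φ hφ heq => ?_⟩
    · exact ⟨_, hw.neg_mem φ' hφ', (neg_neg _).symm⟩
    · have hφk : φ ∈ Φk := by
        rw [hbase.eq_insert_apply hΔ hn hw hw' hsimple hsub]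
        exact Set.mem_insert_of_mem _ hφ
      obtain ⟨c, hc⟩ := hsimple.exists_isCoord hφk
      have hex := hbase.isExchangeable hΔ hn hw hw' hsimple hsub hφ' heq hc hcoeff
      obtain ⟨η, hη⟩ := hex.exists_isLowest hΔ hn hrefl
      have hiff := fun ν' => hkp.isLowestWeightOfSubmodule_iff hex hη (ν' := ν')
      refine ⟨⟨η, (hiff η).2 rfl⟩, fun ν' hν' => ?_⟩
      obtain rfl := (hiff ν').1 hν'
      obtain ⟨δ', hbase'⟩ := hex.isGradedBase_insert hΔ hn hη hrefl
        fun α hα => hbase.exists_noncompact_form_ne_zero hΔ hn hα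
      refine ⟨_, hbase'.isBorelDeSiebenthal hss, ?_, ?_⟩
      · rw [hPkeq]
        exact fun α hα => ⟨hα.1.1, hex.closure_le_closure_insert hΔ hn hη hα.2⟩
      · rw [hΔ.simpleRoots_eq hbase'.simple, Set.union_singleton]
  · intro P' hP' hPkP'
    obtain ⟨ν', δ', hbase', hPeq'⟩ := hP'.exists_isGradedBase hss
    have hsub' : Φk ⊆ AddSubmonoid.closure (simpleRoots P') := fun α hα => by
      have := hPkP' (hΦkPk hα)
      rw [hPeq'] at this
      exact this.2
    rcases hbase.eq_or_exists_exchange hΔ hn hrefl hw hw' hsimple hsub hbase' hsub' with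
      heq | ⟨φ', hφ', hcoeff, φ, hφ, heq, hins, c, hex, hη⟩
    · left
      rw [hPeq', hPeq, heq]
    · exact Or.inr ⟨φ', hφ', hcoeff, φ, hφ, heq, ν',
        (hkp.isLowestWeightOfSubmodule_iff hex hη).2 rfl, by rw [hins, Set.union_singleton]⟩
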